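/- Let $\mathbf{k}$ be an algebraically closed field of characteristic $0$, let $X$ and $S$ be algebraic varieties over $\mathbf{k}$ (integral separated schemes of finite type), let $m\ge 0$ be an integer, and let $f\colon X\to S$ be a $\mathbb{P}^m$-fibration over $\mathbf{k}$: there is a dense open $U\subseteq S$ such that for every point $s\in U$ (closed or not) the geometric fibre of $f$ over $s$ is isomorphic to $\mathbb{P}^m$. Let $Z\subseteq X\times_S X$ be the part of the fibre product that dominates $S$, i.e. the scheme-theoretic closure of the generic fibre of $X\times_S X\to S$, and let $p_1,p_2\colon Z\to X$ be the two projections. Then: 1. $Z$ is integral, and $Z$ coincides with $X\times_S X$ over a nonempty open subset of $S$; if $f$ is flat, then $Z=X\times_S X$. 2. $p_1$, $p_2$ and $Z\to S$ are dominant, the diagonal $X\to X\times_S X$ factors through $Z$, and it is a section of both $p_1$ and $p_2$. 3. For each $i\in\{1,2\}$, the $X$-scheme $p_i\colon Z\to X$ is birational over $X$ (in particular over $S$) to $X\times\mathbf{k}^m\to X$. 4. $Z$ admits $2m$ algebraically independent cancellations over $S$, coming from the two projections. Precisely, put $K=\mathbf{k}(Z)$ and regard $\mathbf{k}(S)$ as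 a subfield of $K$. There are elements $x_1,\dots,x_m,y_1,\dots,y_m\in K$, algebraically independent over $\mathbf{k}(S)$, such that, for each $i$, with $$K'_i=p_1^*\mathbf{k}(X)\bigl(x_j : j\ne i\bigr),\qquad K''_i=p_2^*\mathbf{k}(X)\bigl(y_j : j\ne i\bigr),$$ one has $K=K'_i(x_i)$ with $x_i$ transcendental over $K'_i$, and $K=K''_i(y_i)$ with $y_i$ transcendental over $K''_i$. -/

import Mathlib

open CategoryTheory CategoryTheory.Limits AlgebraicGeometry

universe u

namespace SelfProduct

attribute [local instance] MvPolynomial.gradedAlgebra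

/-- Projective space `ℙ^m` over a field `L`, as `Proj L[x₀, …, x_m]`. -/
noncomputable def projectiveSpace (m : ℕ) (L : Type u) [Field L] : Scheme.{u} :=
  Proj (MvPolynomial.homogeneousSubmodule (Fin (m + 1)) L)

/-- The structure morphism `ℙ^m_L ⟶ Spec L`. -/
noncomputable def projectiveSpaceStr (m : ℕ) (L : Type u) [Field L] :
    projectiveSpace m L ⟶ Spec (.of L) :=
  Proj.toSpecZero (MvPolynomial.homogeneousSubmodule (Fin (m + 1)) L) ≫
    Spec.map (CommRingCat.ofHom
      (algebraMap L (MvPolynomial.homogeneousSubmodule (Fin (m + 1)) L 0)))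

/-- The geometric point `Spec κ(s)^alg ⟶ S` over a point `s` of `S`. -/
noncomputable def geometricPoint (S : Scheme.{u}) (s : S) :
    Spec (.of (AlgebraicClosure (S.residueField s))) ⟶ S :=
  Spec.map (CommRingCat.ofHom
    (algebraMap (S.residueField s) (AlgebraicClosure (S.residueField s)))) ≫
    S.fromSpecResidueField s

/-- `f : X ⟶ S` is a `ℙ^m`-fibration: its general fibre is a projective space `ℙ^m`, i.e. there is
a dense open `U ⊆ S` such that for every `s ∈ U` the geometric fibre of `f` over `s` is isomorphic
to `ℙ^m`, as a scheme over the algebraic closure of `κ(s)`. -/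
def IsProjectiveSpaceFibration {X S : Scheme.{u}} (f : X ⟶ S) (m : ℕ) : Prop :=
  ∃ U : S.Opens, Dense (U : Set S) ∧ ∀ s ∈ U,
    ∃ e : pullback f (geometricPoint S s) ≅
        projectiveSpace m (AlgebraicClosure (S.residueField s)),
      e.hom ≫ projectiveSpaceStr m (AlgebraicClosure (S.residueField s)) =
        pullback.snd f (geometricPoint S s)

section FibreProduct

variable {X S : Scheme.{u}} [IrreducibleSpace S] (f : X ⟶ S)

/-- The inclusion into the scheme `X ×_S X` of its fibre over the generic point of `S`. -/
noncomputable def genericFibreι :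
    (pullback.fst f f ≫ f).fiber (genericPoint S) ⟶ pullback f f :=
  (pullback.fst f f ≫ f).fiberι (genericPoint S)

/-- The fibre product `X ×_S X` in the sense of birational geometry: the part of the scheme
`X ×_S X` that dominates `S`, i.e. the scheme-theoretic closure of its generic fibre over `S`. -/
noncomputable def fibreProduct : Scheme.{u} := (genericFibreι f).image

/-- The closed immersion of `fibreProduct f` into the scheme `X ×_S X`. -/
noncomputable def fibreProductι : fibreProduct f ⟶ pullback f f := (genericFibreι f).imageι

/-- The left projection to `X`. -/
noncomputable def proj₁ : fibreProduct f ⟶ X := fibreProductι f ≫ pullback.fst f f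

/-- The right projection to `X`. -/
noncomputable def proj₂ : fibreProduct f ⟶ X := fibreProductι f ≫ pullback.snd f f

/-- The structure morphism to `S`. -/
noncomputable def toBase : fibreProduct f ⟶ S := proj₁ f ≫ f

end FibreProduct

/-- A dominant morphism of integral schemes maps the generic point to the generic point. -/
theorem map_genericPoint {Z Y : Scheme.{u}} [IsIntegral Z] [IsIntegral Y] (g : Z ⟶ Y)
    [IsDominant g] : g (genericPoint Z) = genericPoint Y := by
  apply ((genericPoint_spec Y).eq _).symm
  have h := (genericPoint_spec Z).image g.continuous
  rwa [Set.image_univ, g.denseRange.closure_range] at h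

/-- The inclusion of function fields `g^* : k(Y) ⟶ k(Z)` given by a dominant morphism
`g : Z ⟶ Y` of integral schemes. -/
noncomputable def functionFieldMap {Z Y : Scheme.{u}} [IsIntegral Z] [IsIntegral Y] (g : Z ⟶ Y)
    [IsDominant g] : Y.functionField ⟶ Z.functionField :=
  Y.presheaf.stalkSpecializes (specializes_of_eq (map_genericPoint g)) ≫
    g.stalkMap (genericPoint Z)

/-- The subfield `g^* k(Y)` of `k(Z)`. -/
noncomputable def functionFieldRange {Z Y : Scheme.{u}} [IsIntegral Z] [IsIntegral Y] (g : Z ⟶ Y)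
    [IsDominant g] : Subfield Z.functionField :=
  (functionFieldMap g).hom.fieldRange

/-- A cancellation of a field `K` over a subfield `F`: a presentation `K = K'(x)` with
`F ⊆ K' ⊆ K` a subfield and `x ∈ K` transcendental over `K'`. -/
structure Cancellation {K : Type*} [Field K] (F : Subfield K) where
  /-- The subfield `K'`. -/
  coeff : Subfield K
  /-- The element `x`. -/
  var : K
  le_coeff : F ≤ coeff
  transcendental : Transcendental coeff var
  closure_eq_top : Subfield.closure (insert var (coeff : Set K)) = ⊤

end SelfProduct

/-! Let `F` be the residue field at the generic point of `S`, `E = k(X)`, and `Ω` an algebraic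
closure of `F`. The theorem rests on the fact that a form of projective space becomes rational over
its own function field. Of the fibration only the geometric fibre over the generic point is used.

That fibre is `ℙ^m` over `Ω`, so `Ω ⊗ E` is its function field `K`. `Gal(Ω/F)` acts on the fibre by
scheme automorphisms, hence permutes the local rings of `ℙ^m` inside `K`. The space of linear forms
divided by `X₀` is described by local rings at divisors alone (`mem_linSys_iff`), so an automorphism
carries it to the space of degree `e` forms over some irreducible `π` of degree `e`. Counting
dimensions gives `e = 1`. The span `W` of the affine coordinates and `1` is therefore preserved up
to a factor `d σ` (`exists_smul_linSys`).

The factors `d σ` form a cocycle only up to constants in `Ω`. Let `N` be the fraction field of `E ⊗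
E`, and `j` the second embedding of `K` in `Ω ⊗ N`. The quotients `j (d σ) / d σ`, with the
denominator in the first copy, form an honest cocycle because the constants cancel. Galois descent
for the action twisted by it gives invariant generators of the `K`-span of `j W`. Quotients of these
by one of them are invariant under the untwisted action, hence lie in `N`, and there are at most `m`
of them (`exists_invariant_generators`, `exists_generators`). So `N` is generated by `m` elements
over either copy of `E`, and a transcendence degree count makes them independent. Shifting one
system by elements of the first copy of `E` makes the two systems jointly independent over `F`
(`exists_shift_algebraicIndependent`).

On the geometric side, `Spec (E ⊗ E)` and the generic fibre of `X ×_S X` have the same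
scheme-theoretic closure `Z` (`ker_tensorSquarePoint`). As `E ⊗ E` is a domain, `Z` is integral with
function field `N`. Generators of `N` over `E` spread out to a birational map from `Z` to affine
space over `X`. Coincidence of `Z` with `X ×_S X` over an open set follows from Chevalley's theorem.
-/

namespace SelfProduct

/-! ### Factors of homogeneous polynomials. -/

section HomogeneousFactors

open MvPolynomial

variable {ι M : Type*} [Field M]

/-- The algebra map `M[x] → M[x][T]`, `x_i ↦ x_i T`, recording homogeneous components. -/
noncomputable def homogenizingMap (ι M : Type*) [Field M] :
    MvPolynomial ι M →ₐ[M] Polynomial (MvPolynomial ι M) :=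
  aeval fun i => Polynomial.monomial 1 (X i)

theorem homogenizingMap_of_isHomogeneous {p : MvPolynomial ι M} {n : ℕ} (hp : p.IsHomogeneous n) :
    homogenizingMap ι M p = Polynomial.monomial n p := by
  have key : ∀ (d : ι →₀ ℕ) (a : M), homogenizingMap ι M (monomial d a) =
      Polynomial.monomial d.degree (monomial d a) := by
    intro d a
    classical
    rw [homogenizingMap, aeval_monomial, monomial_eq, ← Polynomial.C_mul_monomial]
    congr 1
    rw [Finsupp.prod, Finsupp.prod, Finsupp.degree_apply]
    simp_rw [Polynomial.monomial_pow, one_mul]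
    refine Finset.induction_on d.support (by simp) fun i s hi ih => ?_
    rw [Finset.prod_insert hi, ih, Polynomial.monomial_mul_monomial, Finset.sum_insert hi,
      Finset.prod_insert hi]
  conv_lhs => rw [p.as_sum]
  conv_rhs => rw [p.as_sum]
  rw [map_sum, map_sum]
  refine Finset.sum_congr rfl fun d hd => ?_
  rw [key, hp.degree_eq_sum_deg_support hd]
  rfl

theorem coeff_homogenizingMap (p : MvPolynomial ι M) (n : ℕ) :
    (homogenizingMap ι M p).coeff n = homogeneousComponent n p := by
  conv_lhs => rw [← sum_homogeneousComponent p, map_sum]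
  simp_rw [homogenizingMap_of_isHomogeneous (homogeneousComponent_isHomogeneous _ p)]
  rw [Polynomial.finsetSum_coeff]
  simp_rw [Polynomial.coeff_monomial]
  rw [Finset.sum_ite_eq']
  split_ifs with h
  · rfl
  · rw [homogeneousComponent_eq_zero]
    simpa using h

theorem homogenizingMap_ne_zero {p : MvPolynomial ι M} (hp : p ≠ 0) :
    homogenizingMap ι M p ≠ 0 := by
  intro h
  apply hp
  rw [← sum_homogeneousComponent p]
  refine Finset.sum_eq_zero fun n _ => ?_
  rw [← coeff_homogenizingMap, h, Polynomial.coeff_zero]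

/-- The powers of `T` that occur are the degrees of the nonzero homogeneous components, so equality
of the extreme ones leaves a single component. -/
theorem isHomogeneous_of_natTrailingDegree_eq {p : MvPolynomial ι M}
    (h : (homogenizingMap ι M p).natTrailingDegree = (homogenizingMap ι M p).natDegree) :
    p.IsHomogeneous (homogenizingMap ι M p).natDegree := by
  have : homogeneousComponent (homogenizingMap ι M p).natDegree p = p := by
    conv_rhs => rw [← sum_homogeneousComponent p]
    by_cases hmem : (homogenizingMap ι M p).natDegree ∈ Finset.range (p.totalDegree + 1)
    · rw [Finset.sum_eq_single_of_mem _ hmem]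
      intro n _ hn
      rw [← coeff_homogenizingMap]
      rcases lt_or_gt_of_ne hn with h1 | h1
      · exact Polynomial.coeff_eq_zero_of_lt_natTrailingDegree (h ▸ h1)
      · exact Polynomial.coeff_eq_zero_of_natDegree_lt h1
    · rw [Finset.sum_eq_zero, homogeneousComponent_eq_zero]
      · simpa using hmem
      · intro n hn
        rw [← coeff_homogenizingMap]
        have hn' : n ≠ (homogenizingMap ι M p).natDegree := fun e => hmem (e ▸ hn)
        rcases lt_or_gt_of_ne hn' with h1 | h1
        · exact Polynomial.coeff_eq_zero_of_lt_natTrailingDegree (h ▸ h1)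
        · exact Polynomial.coeff_eq_zero_of_natDegree_lt h1
  rw [← this]
  conv => enter [2]; rw [this]
  exact homogeneousComponent_isHomogeneous _ p

/-- Factors of a nonzero homogeneous polynomial are homogeneous. -/
theorem exists_isHomogeneous_of_mul {p q : MvPolynomial ι M} {n : ℕ}
    (h : (p * q).IsHomogeneous n) (h0 : p * q ≠ 0) :
    ∃ a b, p.IsHomogeneous a ∧ q.IsHomogeneous b ∧ a + b = n := by
  obtain ⟨hp, hq⟩ := mul_ne_zero_iff.mp h0
  have hP := homogenizingMap_ne_zero hp
  have hQ := homogenizingMap_ne_zero hq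
  have hPQ : homogenizingMap ι M p * homogenizingMap ι M q = Polynomial.monomial n (p * q) := by
    rw [← map_mul, homogenizingMap_of_isHomogeneous h]
  -- Lowest and highest `T`-degrees are both additive and both sum to `n`; since lowest is at most
  -- highest for each factor, they agree for each.
  have h1 := Polynomial.natDegree_mul hP hQ
  have h2 := Polynomial.natTrailingDegree_mul hP hQ
  rw [hPQ, Polynomial.natDegree_monomial_eq n h0] at h1
  rw [hPQ, Polynomial.natTrailingDegree_monomial h0] at h2
  have h3 := Polynomial.natTrailingDegree_le_natDegree (homogenizingMap ι M p)
  have h4 := Polynomial.natTrailingDegree_le_natDegree (homogenizingMap ι M q)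
  exact ⟨_, _, isHomogeneous_of_natTrailingDegree_eq (by omega),
    isHomogeneous_of_natTrailingDegree_eq (by omega), by omega⟩

theorem exists_isHomogeneous_of_dvd {p r : MvPolynomial ι M} {n : ℕ}
    (h : r.IsHomogeneous n) (h0 : r ≠ 0) (hd : p ∣ r) : ∃ a, p.IsHomogeneous a := by
  obtain ⟨q, rfl⟩ := hd
  obtain ⟨a, _, ha, _⟩ := exists_isHomogeneous_of_mul h h0
  exact ⟨a, ha⟩

end HomogeneousFactors

end SelfProduct

namespace SelfProduct

/-! ### Local rings of projective space as subrings of a fraction field, and linear systems. -/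

section HomogeneousLocalRings

attribute [local instance] MvPolynomial.gradedAlgebra

open MvPolynomial

variable {ι M : Type*} [Field M]

/-- The degree zero fractions `G / H` of homogeneous polynomials with `H ∉ 𝔭`. -/
def homLoc (𝔭 : Ideal (MvPolynomial ι M)) : Set (FractionRing (MvPolynomial ι M)) :=
  {q | ∃ (n : ℕ) (G H : MvPolynomial ι M), G.IsHomogeneous n ∧ H.IsHomogeneous n ∧ H ∉ 𝔭 ∧
    q = algebraMap _ _ G / algebraMap _ _ H}

theorem homLoc_anti {𝔭 𝔮 : Ideal (MvPolynomial ι M)} (h : 𝔭 ≤ 𝔮) : homLoc 𝔮 ⊆ homLoc 𝔭 :=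
  fun _ ⟨n, G, H, hG, hH, hH', e⟩ => ⟨n, G, H, hG, hH, fun h' => hH' (h h'), e⟩

theorem algebraMap_fractionRing_ne_zero {H : MvPolynomial ι M} (hH : H ≠ 0) :
    algebraMap (MvPolynomial ι M) (FractionRing (MvPolynomial ι M)) H ≠ 0 :=
  (map_ne_zero_iff _ (IsFractionRing.injective _ _)).mpr hH

theorem div_eq_div_iff_fractionRing {A B C D : MvPolynomial ι M} (hB : B ≠ 0) (hD : D ≠ 0) :
    (algebraMap _ (FractionRing (MvPolynomial ι M)) A / algebraMap _ _ B =
      algebraMap _ _ C / algebraMap _ _ D) ↔ A * D = C * B := by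
  rw [div_eq_div_iff (algebraMap_fractionRing_ne_zero hB) (algebraMap_fractionRing_ne_zero hD),
    ← map_mul, ← map_mul, (IsFractionRing.injective _ _).eq_iff]

theorem ne_zero_of_notMem {𝔭 : Ideal (MvPolynomial ι M)} {H : MvPolynomial ι M} (h : H ∉ 𝔭) :
    H ≠ 0 := fun e => h (e ▸ 𝔭.zero_mem)

/-- A homogeneous prime contains the components of its elements, hence an irreducible factor of a
nonzero one. Geometrically, every non-generic point lies on a prime divisor. -/
theorem exists_irreducible_mem {𝔭 : Ideal (MvPolynomial ι M)} [𝔭.IsPrime]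
    (h𝔭 : 𝔭.IsHomogeneous (homogeneousSubmodule ι M)) (h0 : 𝔭 ≠ ⊥) :
    ∃ (π : MvPolynomial ι M) (e : ℕ), Irreducible π ∧ π.IsHomogeneous e ∧ π ∈ 𝔭 := by
  obtain ⟨f, hf, hf0⟩ := Submodule.exists_mem_ne_zero_of_ne_bot h0
  obtain ⟨n, hn⟩ : ∃ n, homogeneousComponent n f ≠ 0 := by
    by_contra! h
    apply hf0
    rw [← sum_homogeneousComponent f]
    exact Finset.sum_eq_zero fun n _ => h n
  have hmem : homogeneousComponent n f ∈ 𝔭 := homogeneousComponent_mem_of_mem h𝔭 hf n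
  obtain ⟨s, hs, hprod⟩ := WfDvdMonoid.exists_factors _ hn
  have hs' : s.prod ∈ 𝔭 := 𝔭.mem_of_dvd hprod.symm.dvd hmem
  obtain ⟨π, hπ, hπ'⟩ := (Ideal.IsPrime.multiset_prod_mem_iff_exists_mem ‹_› s).mp hs'
  obtain ⟨e, he⟩ := exists_isHomogeneous_of_dvd (homogeneousComponent_isHomogeneous n f) hn
    ((Multiset.dvd_prod hπ).trans hprod.dvd)
  exact ⟨π, e, hs π hπ, he, hπ'⟩

theorem exists_not_dvd_X [Nontrivial ι] {π : MvPolynomial ι M} (hπ : Irreducible π) :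
    ∃ i, ¬ π ∣ X i := by
  obtain ⟨i, j, hij⟩ := exists_pair_ne ι
  by_contra! h
  have hi : Irreducible (X i : MvPolynomial ι M) := (X_prime (i := i)).irreducible
  have := (hπ.associated_of_dvd hi (h i)).symm.dvd.trans (h j)
  exact hij (by simpa using this)

theorem X_pow_div_mem_homLoc {𝔭 : Ideal (MvPolynomial ι M)} {π : MvPolynomial ι M} {e : ℕ}
    (he : π.IsHomogeneous e) (h : π ∉ 𝔭) (i : ι) :
    algebraMap (MvPolynomial ι M) _ (X i ^ e) / algebraMap _ _ π ∈ homLoc 𝔭 :=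
  ⟨e, _, _, isHomogeneous_X_pow i e, he, h, rfl⟩

theorem X_pow_div_notMem_homLoc {π : MvPolynomial ι M} {e : ℕ} (hπ : Irreducible π) {i : ι}
    (hi : ¬ π ∣ X i) :
    algebraMap (MvPolynomial ι M) _ (X i ^ e) / algebraMap _ _ π ∉
      homLoc (Ideal.span {π}) := by
  rintro ⟨n, G, H, hG, hH, hH', h⟩
  rw [div_eq_div_iff_fractionRing hπ.ne_zero (ne_zero_of_notMem hH')] at h
  rw [Ideal.mem_span_singleton] at hH'
  rcases hπ.prime.dvd_or_dvd (Dvd.intro_left G h.symm) with h1 | h1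
  · exact hi (hπ.prime.dvd_of_dvd_pow h1)
  · exact hH' h1

/-- For a variable not divisible by `π'`, the fraction `X i ^ e' / π'` has its only pole along `π'`,
so it separates the local ring at `π'` from that at any other divisor. -/
theorem associated_of_homLoc_le [Nontrivial ι] {π π' : MvPolynomial ι M} {e' : ℕ}
    (hπ : Irreducible π) (hπ' : Irreducible π') (he' : π'.IsHomogeneous e')
    (h : homLoc (Ideal.span {π}) ⊆ homLoc (Ideal.span {π'})) : Associated π π' := by
  by_contra hn
  obtain ⟨i, hi⟩ := exists_not_dvd_X hπ'
  refine X_pow_div_notMem_homLoc (e := e') hπ' hi (h (X_pow_div_mem_homLoc he' ?_ i))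
  rw [Ideal.mem_span_singleton]
  exact fun hd => hn (hπ.associated_of_dvd hπ' hd)

theorem span_singleton_eq_of_associated {π π' : MvPolynomial ι M} (h : Associated π π') :
    Ideal.span {π} = Ideal.span {π'} :=
  Ideal.span_singleton_eq_span_singleton.mpr h

theorem homLoc_ne_homLoc_bot [Nontrivial ι] {𝔭 : Ideal (MvPolynomial ι M)} [𝔭.IsPrime]
    (h𝔭 : 𝔭.IsHomogeneous (homogeneousSubmodule ι M)) (h0 : 𝔭 ≠ ⊥) : homLoc 𝔭 ≠ homLoc ⊥ := by
  obtain ⟨π, e, hπ, he, hmem⟩ := exists_irreducible_mem h𝔭 h0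
  obtain ⟨i, hi⟩ := exists_not_dvd_X hπ
  intro h
  refine X_pow_div_notMem_homLoc (e := e) hπ hi (homLoc_anti
    ((Ideal.span_singleton_le_iff_mem _).mpr hmem) (h ▸ X_pow_div_mem_homLoc he ?_ i))
  simpa using hπ.ne_zero

/-- Cancelling common factors in the factorial polynomial ring preserves homogeneity, because
factors of homogeneous polynomials are homogeneous. -/
theorem exists_reduced_fraction {g : FractionRing (MvPolynomial ι M)} (hg : g ∈ homLoc ⊥) :
    ∃ (n : ℕ) (A B : MvPolynomial ι M), A.IsHomogeneous n ∧ B.IsHomogeneous n ∧ IsRelPrime A B ∧ B ≠ 0 ∧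
      g = algebraMap _ _ A / algebraMap _ _ B := by
  obtain ⟨n, A, B, hA, hB, hB0, rfl⟩ := hg
  replace hB0 : B ≠ 0 := by simpa using hB0
  by_cases hA0 : A = 0
  · exact ⟨0, 0, 1, isHomogeneous_zero _ _ _, isHomogeneous_one _ _,
      isRelPrime_one_right, one_ne_zero, by simp [hA0]⟩
  obtain ⟨A', B', c, hrel, rfl, rfl⟩ := UniqueFactorizationMonoid.exists_reduced_factors' A B hB0
  obtain ⟨k, a, hk, ha, hka⟩ := exists_isHomogeneous_of_mul hA hA0
  obtain ⟨l, b, hl, hb, hlb⟩ := exists_isHomogeneous_of_mul hB hB0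
  have hc := left_ne_zero_of_mul hA0
  have hkl : k = l := hk.inj_right hl hc
  have hab : a = b := by omega
  subst hab
  refine ⟨a, A', B', ha, hb, hrel, right_ne_zero_of_mul hB0, ?_⟩
  rw [div_eq_div_iff_fractionRing hB0 (right_ne_zero_of_mul hB0)]
  ring

/-- The fractions `G / π` with `G` homogeneous of degree `e`. -/
def linSys (π : MvPolynomial ι M) (e : ℕ) : Set (FractionRing (MvPolynomial ι M)) :=
  {q | ∃ G : MvPolynomial ι M, G.IsHomogeneous e ∧ q = algebraMap _ _ G / algebraMap _ _ π}

/-- The linear system `linSys π e` in terms of the local rings at codimension one points. -/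
theorem mem_linSys_iff [Nontrivial ι] {π : MvPolynomial ι M} {e : ℕ} (hπ : Irreducible π)
    (he : π.IsHomogeneous e) (g : FractionRing (MvPolynomial ι M)) :
    g ∈ linSys π e ↔ g ∈ homLoc ⊥ ∧
      (∀ π' : MvPolynomial ι M, Irreducible π' → (∃ e', π'.IsHomogeneous e') →
        homLoc (Ideal.span {π'}) ≠ homLoc (Ideal.span {π}) → g ∈ homLoc (Ideal.span {π'})) ∧
      ∀ r ∈ homLoc (Ideal.span {π}), r⁻¹ ∉ homLoc (Ideal.span {π}) →
        g * r ∈ homLoc (Ideal.span {π}) := by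
  -- The conditions on the right say that `g` has no pole away from `π`, and that multiplying it by
  -- a nonzero element of the maximal ideal at `π` (an `r` whose inverse is not regular) removes its
  -- pole there. Together they mean a pole of order at most one along `π` and none elsewhere.
  constructor
  · rintro ⟨G, hG, rfl⟩
    refine ⟨⟨e, G, π, hG, he, by simpa using hπ.ne_zero, rfl⟩, ?_, ?_⟩
    · intro π' hπ' _ hne
      refine ⟨e, G, π, hG, he, ?_, rfl⟩
      rw [Ideal.mem_span_singleton]
      exact fun hd => hne (congrArg homLoc
        (span_singleton_eq_of_associated (hπ'.associated_of_dvd hπ hd)))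
    · rintro r ⟨n, A, B, hA, hB, hB', rfl⟩ hr
      have hπA : π ∣ A := by
        by_contra hd
        exact hr ⟨n, B, A, hB, hA, by rwa [Ideal.mem_span_singleton], by rw [inv_div]⟩
      obtain ⟨A', rfl⟩ := hπA
      by_cases hA0 : A' = 0
      · subst hA0
        exact ⟨0, 0, 1, isHomogeneous_zero _ _ _, isHomogeneous_one _ _, fun h1 =>
          hπ.not_isUnit (isUnit_of_dvd_one (Ideal.mem_span_singleton.mp h1)), by simp⟩
      obtain ⟨a, b, ha, hb, hab⟩ := exists_isHomogeneous_of_mul hA (mul_ne_zero hπ.ne_zero hA0)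
      have := ha.inj_right he hπ.ne_zero
      subst this
      refine ⟨n, G * A', B, hab ▸ hG.mul hb, hB, hB', ?_⟩
      have h1 := algebraMap_fractionRing_ne_zero hπ.ne_zero
      have h2 := algebraMap_fractionRing_ne_zero (ne_zero_of_notMem hB')
      rw [map_mul, map_mul]
      field_simp
  · rintro ⟨hg, h1, h2⟩
    obtain ⟨n, A, B, hA, hB, hrel, hB0, rfl⟩ := exists_reduced_fraction hg
    have hfin : FiniteMultiplicity π B :=
      FiniteMultiplicity.of_prime_left hπ.prime hB0
    obtain ⟨B', hB', hndvd⟩ := hfin.exists_eq_pow_mul_and_not_dvd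
    have hB'0 : B' ≠ 0 := by rintro rfl; exact hndvd (dvd_zero _)
    -- In lowest terms, a prime factor of the denominator other than `π` would be a pole forbidden
    -- by the second condition.
    have hunit : IsUnit B' := by
      by_contra hnu
      obtain ⟨π', hπ', hd⟩ := WfDvdMonoid.exists_irreducible_factor hnu hB'0
      have hdB : π' ∣ B := hB' ▸ hd.mul_left _
      obtain ⟨e', he'⟩ := exists_isHomogeneous_of_dvd hB hB0 hdB
      have hne : homLoc (Ideal.span {π'}) ≠ homLoc (Ideal.span {π}) := fun h => hndvd
        ((associated_of_homLoc_le hπ' hπ he h.subset).symm.dvd.trans hd)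
      obtain ⟨_, C, D, _, _, hD, hCD⟩ := h1 π' hπ' ⟨e', he'⟩ hne
      rw [div_eq_div_iff_fractionRing hB0 (ne_zero_of_notMem hD)] at hCD
      rw [Ideal.mem_span_singleton] at hD
      rcases hπ'.prime.dvd_or_dvd (hCD ▸ hdB.mul_left C) with h3 | h3
      · exact hπ'.not_isUnit (hrel h3 hdB)
      · exact hD h3
    have hk : multiplicity π B ≤ 1 := by
      by_contra! hk
      obtain ⟨i, hi⟩ := exists_not_dvd_X hπ
      have hXi : X i ^ e ≠ (0 : MvPolynomial ι M) := pow_ne_zero _ (X_ne_zero i)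
      -- Test the third condition on a uniformiser at `π`: if `π ^ 2` divided `B`, one pole would
      -- survive.
      have hr := h2 (algebraMap _ _ π / algebraMap _ _ (X i ^ e))
        ⟨e, _, _, he, isHomogeneous_X_pow i e, by
          rw [Ideal.mem_span_singleton]
          exact fun h => hi (hπ.prime.dvd_of_dvd_pow h), rfl⟩
        (by rw [inv_div]; exact X_pow_div_notMem_homLoc hπ hi)
      rw [div_mul_div_comm, ← map_mul, ← map_mul] at hr
      obtain ⟨_, C, D, _, _, hD, hCD⟩ := hr
      rw [div_eq_div_iff_fractionRing (mul_ne_zero hB0 hXi) (ne_zero_of_notMem hD)] at hCD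
      rw [Ideal.mem_span_singleton] at hD
      obtain ⟨B₂, hB₂⟩ : π ^ 2 ∣ B := (pow_dvd_pow π hk).trans ⟨B', hB'⟩
      have h3 : A * D = π * (C * B₂ * X i ^ e) := by
        apply mul_left_cancel₀ hπ.ne_zero
        rw [hB₂] at hCD
        linear_combination hCD
      rcases hπ.prime.dvd_or_dvd (Dvd.intro _ h3.symm) with h4 | h4
      · exact hπ.not_isUnit (hrel h4 (hB₂ ▸ (dvd_pow_self π two_ne_zero).mul_right _))
      · exact hD h4
    obtain ⟨t, ht⟩ : B ∣ π := by
      rw [hB', mul_comm, hunit.mul_left_dvd]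
      exact (pow_dvd_pow π hk).trans (pow_one π).dvd
    have ht0 : B * t ≠ 0 := ht ▸ hπ.ne_zero
    obtain ⟨a, b, ha, hb, hab⟩ := exists_isHomogeneous_of_mul (ht ▸ he) ht0
    have := ha.inj_right hB hB0
    subst this
    refine ⟨A * t, hab ▸ hA.mul hb, ?_⟩
    rw [div_eq_div_iff_fractionRing hB0 hπ.ne_zero, ht]
    ring

end HomogeneousLocalRings

end SelfProduct

namespace SelfProduct

/-! ### Semilinear automorphisms permuting the local rings act linearly on coordinates, up to a
factor. -/

section ProjectiveLinearity

attribute [local instance] MvPolynomial.gradedAlgebra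

open MvPolynomial

variable {ι M : Type*} [Field M]

theorem isHomogeneous_span_singleton {π : MvPolynomial ι M} {e : ℕ} (he : π.IsHomogeneous e) :
    (Ideal.span {π}).IsHomogeneous (homogeneousSubmodule ι M) :=
  Ideal.homogeneous_span _ _ fun x hx => by
    rw [Set.mem_singleton_iff] at hx
    exact hx ▸ ⟨e, he⟩

/-- The codimension one point of `Proj M[x]` given by an irreducible homogeneous polynomial. -/
noncomputable def primeDivisor [Nontrivial ι] {π : MvPolynomial ι M} {e : ℕ} (hπ : Irreducible π)
    (he : π.IsHomogeneous e) : ProjectiveSpectrum (homogeneousSubmodule ι M) where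
  asHomogeneousIdeal := ⟨Ideal.span {π}, isHomogeneous_span_singleton he⟩
  isPrime := (Ideal.span_singleton_prime hπ.ne_zero).mpr hπ.prime
  not_irrelevant_le h := by
    obtain ⟨i, hi⟩ := exists_not_dvd_X hπ
    refine hi (Ideal.mem_span_singleton.mp (h (x := X i) ?_))
    rw [HomogeneousIdeal.mem_irrelevant_iff, GradedRing.proj_apply,
      DirectSum.decompose_of_mem_ne (i := 1) _ (isHomogeneous_X M i) one_ne_zero]

/-- Homogeneous polynomials of degree at least two span a space of dimension greater than the
number of variables. -/
theorem degree_le_one_of_span [Fintype ι] [Nontrivial ι] {e : ℕ} (G : ι → MvPolynomial ι M)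
    (h : ∀ P : MvPolynomial ι M, P.IsHomogeneous e → P ∈ Submodule.span M (Set.range G)) :
    e ≤ 1 := by
  classical
  by_contra! he
  obtain ⟨i, j, hij⟩ := exists_pair_ne ι
  -- One monomial more than there are variables: `X_j ^ e` and all `X_i ^ (e - 1) * X_k`. They are
  -- distinct because `e ≥ 2` makes `X_i` occur in each of the latter.
  let v : Option ι → (ι →₀ ℕ) := fun o =>
    o.elim (Finsupp.single j e) fun k => Finsupp.single i (e - 1) + Finsupp.single k 1
  have hv : Function.Injective v := by
    rintro (_ | a) (_ | b) hab
    · rfl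
    · have := DFunLike.congr_fun hab i
      simp [v, hij.symm, Finsupp.single_apply] at this
      omega
    · have := DFunLike.congr_fun hab i
      simp [v, hij.symm, Finsupp.single_apply] at this
      omega
    · simpa [v, Finsupp.single_left_inj] using hab
  have hli : LinearIndependent M (fun o => monomial (v o) (1 : M)) := by
    have := (basisMonomials ι M).linearIndependent.comp v hv
    simpa [Function.comp_def] using this
  have hmem : ∀ o, monomial (v o) (1 : M) ∈ Submodule.span M (Set.range G) := by
    intro o
    refine h _ (isHomogeneous_monomial _ ?_)
    cases o with
    | none => simp [v]
    | some k =>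
      simp only [v, Option.elim_some, map_add, Finsupp.degree_single]
      omega
  have hli' : LinearIndependent M
      (fun o => (⟨_, hmem o⟩ : Submodule.span M (Set.range G))) :=
    LinearIndependent.of_comp (Submodule.span M (Set.range G)).subtype hli
  have : FiniteDimensional M (Submodule.span M (Set.range G)) :=
    FiniteDimensional.span_of_finite M (Set.finite_range G)
  have hle := hli'.fintype_card_le_finrank
  have := finrank_range_le_card (R := M) G
  simp only [Set.finrank] at this
  rw [Fintype.card_option] at hle
  omega

variable {K : Type*} [Field K] (θ : K →+* FractionRing (MvPolynomial ι M))
  (hθ : Set.range θ = homLoc ⊥) (σ : K ≃+* K)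

-- Divisors have the maximal local rings among non-generic points, which is a property of inclusions
-- and so survives `σ`. Concretely, the image point of `π` lies on some divisor `π'`, and the point
-- mapping to `π'` lies on some `ρ`. The chain of inclusions from `π` to `ρ` forces them to be
-- associated, so all inclusions are equalities.
include hθ in
theorem image_homLoc_eq_of_maximal [Nontrivial ι]
    (hσ : ∀ y : ProjectiveSpectrum (homogeneousSubmodule ι M),
      ∃ y' : ProjectiveSpectrum (homogeneousSubmodule ι M), ∀ x,
        θ x ∈ homLoc y.asHomogeneousIdeal.toIdeal ↔
          θ (σ x) ∈ homLoc y'.asHomogeneousIdeal.toIdeal)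
    (hσ' : ∀ y' : ProjectiveSpectrum (homogeneousSubmodule ι M),
      ∃ y : ProjectiveSpectrum (homogeneousSubmodule ι M), ∀ x,
        θ x ∈ homLoc y.asHomogeneousIdeal.toIdeal ↔
          θ (σ x) ∈ homLoc y'.asHomogeneousIdeal.toIdeal)
    {π : MvPolynomial ι M} {e : ℕ} (hπ : Irreducible π) (he : π.IsHomogeneous e) :
    ∃ (π' : MvPolynomial ι M) (e' : ℕ), Irreducible π' ∧ π'.IsHomogeneous e' ∧ ∀ x,
      θ x ∈ homLoc (Ideal.span {π}) ↔ θ (σ x) ∈ homLoc (Ideal.span {π'}) := by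
  have hbot : ∀ y y' : ProjectiveSpectrum (homogeneousSubmodule ι M),
      (∀ x, θ x ∈ homLoc y.asHomogeneousIdeal.toIdeal ↔
          θ (σ x) ∈ homLoc y'.asHomogeneousIdeal.toIdeal) →
      (y.asHomogeneousIdeal.toIdeal ≠ ⊥ ↔ y'.asHomogeneousIdeal.toIdeal ≠ ⊥) := by
    intro y y' h
    have hle : ∀ 𝔭 : Ideal (MvPolynomial ι M), homLoc 𝔭 ⊆ homLoc ⊥ := fun 𝔭 => homLoc_anti bot_le
    have hmem : ∀ x, θ x ∈ homLoc ⊥ := fun x => hθ ▸ ⟨x, rfl⟩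
    have := y.isPrime
    have := y'.isPrime
    constructor
    · intro h1 h2
      refine homLoc_ne_homLoc_bot y.asHomogeneousIdeal.isHomogeneous h1
        ((hle _).antisymm fun q hq => ?_)
      obtain ⟨x, rfl⟩ := hθ.symm ▸ hq
      exact (h x).mpr (h2 ▸ hmem _)
    · intro h1 h2
      refine homLoc_ne_homLoc_bot y'.asHomogeneousIdeal.isHomogeneous h1
        ((hle _).antisymm fun q hq => ?_)
      obtain ⟨x, rfl⟩ := hθ.symm ▸ hq
      have := (h (σ.symm x)).mp (h2 ▸ hmem _)
      rwa [σ.apply_symm_apply] at this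
  obtain ⟨y', hy'⟩ := hσ (primeDivisor hπ he)
  have hy0 : y'.asHomogeneousIdeal.toIdeal ≠ ⊥ := (hbot _ _ hy').mp (by
    change Ideal.span {π} ≠ ⊥
    simpa using hπ.ne_zero)
  have := y'.isPrime
  obtain ⟨π', e', hπ', he', hmem⟩ :=
    exists_irreducible_mem y'.asHomogeneousIdeal.isHomogeneous hy0
  have hsub : homLoc y'.asHomogeneousIdeal.toIdeal ⊆ homLoc (Ideal.span {π'}) :=
    homLoc_anti ((Ideal.span_singleton_le_iff_mem _).mpr hmem)
  obtain ⟨y, hy⟩ := hσ' (primeDivisor hπ' he')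
  have hy0' : y.asHomogeneousIdeal.toIdeal ≠ ⊥ := (hbot _ _ hy).mpr (by
    change Ideal.span {π'} ≠ ⊥
    simpa using hπ'.ne_zero)
  have := y.isPrime
  obtain ⟨ρ, _, hρ, heρ, hmemρ⟩ :=
    exists_irreducible_mem y.asHomogeneousIdeal.isHomogeneous hy0'
  have hsubρ : homLoc y.asHomogeneousIdeal.toIdeal ⊆ homLoc (Ideal.span {ρ}) :=
    homLoc_anti ((Ideal.span_singleton_le_iff_mem _).mpr hmemρ)
  have hπy : homLoc (Ideal.span {π}) ⊆ homLoc y.asHomogeneousIdeal.toIdeal := by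
    intro q hq
    obtain ⟨x, rfl⟩ := hθ.symm ▸ homLoc_anti bot_le hq
    exact (hy x).mpr (hsub ((hy' x).mp hq))
  have hass := associated_of_homLoc_le hπ hρ heρ (hπy.trans hsubρ)
  have heq : homLoc y.asHomogeneousIdeal.toIdeal = homLoc (Ideal.span {π}) :=
    (hsubρ.trans (congrArg homLoc (span_singleton_eq_of_associated hass.symm)).subset).antisymm hπy
  exact ⟨π', e', hπ', he', fun x => heq ▸ hy x⟩

include hθ in
/-- A semilinear automorphism of the function field of projective space which permutes the local
rings of projective space is projectively linear. -/
theorem exists_smul_linSys [Finite ι] [Nontrivial ι] (τ : M →+* M)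
    (hτ : ∀ x a, θ x = algebraMap _ _ (C a : MvPolynomial ι M) →
      θ (σ x) = algebraMap _ _ (C (τ a) : MvPolynomial ι M))
    (hσ : ∀ y : ProjectiveSpectrum (homogeneousSubmodule ι M),
      ∃ y' : ProjectiveSpectrum (homogeneousSubmodule ι M), ∀ x,
        θ x ∈ homLoc y.asHomogeneousIdeal.toIdeal ↔
          θ (σ x) ∈ homLoc y'.asHomogeneousIdeal.toIdeal)
    (hσ' : ∀ y' : ProjectiveSpectrum (homogeneousSubmodule ι M),
      ∃ y : ProjectiveSpectrum (homogeneousSubmodule ι M), ∀ x,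
        θ x ∈ homLoc y.asHomogeneousIdeal.toIdeal ↔
          θ (σ x) ∈ homLoc y'.asHomogeneousIdeal.toIdeal) (i₀ : ι) :
    ∃ d : K, d ≠ 0 ∧ ∀ x, θ x ∈ linSys (X i₀) 1 ↔ θ (d * σ x) ∈ linSys (X i₀) 1 := by
  have := Fintype.ofFinite ι
  have hX : Irreducible (X i₀ : MvPolynomial ι M) := X_prime.irreducible
  obtain ⟨π, e, hπ, he, h⟩ := image_homLoc_eq_of_maximal θ hθ σ hσ hσ' hX (isHomogeneous_X M i₀)
  have hsymm : ∀ y : ProjectiveSpectrum (homogeneousSubmodule ι M),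
      ∃ y' : ProjectiveSpectrum (homogeneousSubmodule ι M), ∀ x,
        θ x ∈ homLoc y.asHomogeneousIdeal.toIdeal ↔
          θ (σ.symm x) ∈ homLoc y'.asHomogeneousIdeal.toIdeal := fun y => by
    obtain ⟨y', hy'⟩ := hσ' y
    exact ⟨y', fun x => by rw [hy', σ.apply_symm_apply]⟩
  have hsymm' : ∀ y' : ProjectiveSpectrum (homogeneousSubmodule ι M),
      ∃ y : ProjectiveSpectrum (homogeneousSubmodule ι M), ∀ x,
        θ x ∈ homLoc y.asHomogeneousIdeal.toIdeal ↔
          θ (σ.symm x) ∈ homLoc y'.asHomogeneousIdeal.toIdeal := fun y => by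
    obtain ⟨y', hy'⟩ := hσ y
    exact ⟨y', fun x => by rw [hy', σ.apply_symm_apply]⟩
  have hK : ∀ x, θ x ∈ homLoc (⊥ : Ideal (MvPolynomial ι M)) := fun x => hθ ▸ ⟨x, rfl⟩
  -- Each condition of `mem_linSys_iff` mentions only local rings at divisors, and `σ` permutes
  -- these, taking `X i₀` to `π`.
  have key : ∀ x, θ x ∈ linSys (X i₀) 1 ↔ θ (σ x) ∈ linSys π e := by
    intro x
    rw [mem_linSys_iff hX (isHomogeneous_X M i₀), mem_linSys_iff hπ he]
    refine and_congr (iff_of_true (hK _) (hK _)) (and_congr ?_ ?_)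
    · constructor
      · rintro H π' hπ' ⟨e', he'⟩ hne
        obtain ⟨ρ, f, hρ, hf, hρ'⟩ :=
          image_homLoc_eq_of_maximal θ hθ σ.symm hsymm hsymm' hπ' he'
        have := (hρ' (σ x)).mpr
        rw [σ.symm_apply_apply] at this
        refine this (H ρ hρ ⟨f, hf⟩ fun heq => hne (Set.Subset.antisymm ?_ ?_))
        · intro q hq
          obtain ⟨z, rfl⟩ := hθ.symm ▸ homLoc_anti bot_le hq
          have := (h (σ.symm z)).mp (heq ▸ (hρ' z).mp hq)
          rwa [σ.apply_symm_apply] at this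
        · intro q hq
          obtain ⟨z, rfl⟩ := hθ.symm ▸ homLoc_anti bot_le hq
          refine (hρ' z).mpr (heq.symm ▸ (h (σ.symm z)).mpr ?_)
          rwa [σ.apply_symm_apply]
      · rintro H π' hπ' ⟨e', he'⟩ hne
        obtain ⟨ρ, f, hρ, hf, hρ'⟩ := image_homLoc_eq_of_maximal θ hθ σ hσ hσ' hπ' he'
        refine (hρ' x).mpr (H ρ hρ ⟨f, hf⟩ fun heq => hne (Set.Subset.antisymm ?_ ?_))
        · intro q hq
          obtain ⟨z, rfl⟩ := hθ.symm ▸ homLoc_anti bot_le hq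
          exact (h z).mpr (heq ▸ (hρ' z).mp hq)
        · intro q hq
          obtain ⟨z, rfl⟩ := hθ.symm ▸ homLoc_anti bot_le hq
          exact (hρ' z).mpr (heq.symm ▸ (h z).mp hq)
    · constructor
      · intro H r hr hr'
        obtain ⟨z, rfl⟩ := hθ.symm ▸ homLoc_anti bot_le hr
        have := H (θ (σ.symm z)) ((h _).mpr (by rwa [σ.apply_symm_apply])) (by
          rw [← map_inv₀, ← map_inv₀, h, σ.apply_symm_apply, map_inv₀]
          exact hr')
        rw [← map_mul, h, map_mul, σ.apply_symm_apply] at this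
        rwa [← map_mul]
      · intro H r hr hr'
        obtain ⟨z, rfl⟩ := hθ.symm ▸ homLoc_anti bot_le hr
        have := H (θ (σ z)) ((h _).mp hr) (by
          rw [← map_inv₀, ← map_inv₀, ← h, map_inv₀]
          exact hr')
        rwa [← map_mul, ← map_mul, ← h, map_mul] at this
  have hπ0 := algebraMap_fractionRing_ne_zero hπ.ne_zero
  have hX0 := algebraMap_fractionRing_ne_zero hX.ne_zero
  -- The images of the coordinates `X i / X i₀` span all forms of degree `e` over `π`, one generator
  -- per variable; this is too few once `e ≥ 2`. Semilinearity enters through `τ`.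
  have he1 : e ≤ 1 := by
    have hz : ∀ i, ∃ z : K, θ z = algebraMap (MvPolynomial ι M) (FractionRing (MvPolynomial ι M))
        (X i) / algebraMap (MvPolynomial ι M) _ (X i₀) := by
      intro i
      rw [← Set.mem_range, hθ]
      exact ⟨1, X i, X i₀, isHomogeneous_X M i, isHomogeneous_X M i₀, by simp, rfl⟩
    choose z hz using hz
    have hzG : ∀ i, ∃ G : MvPolynomial ι M, G.IsHomogeneous e ∧
        θ (σ (z i)) = algebraMap (MvPolynomial ι M) _ G / algebraMap (MvPolynomial ι M) _ π := fun i =>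
      (key (z i)).mp ⟨X i, isHomogeneous_X M i, hz i⟩
    choose G hG hzG using hzG
    refine degree_le_one_of_span G fun P hP => ?_
    have hmem : algebraMap (MvPolynomial ι M) (FractionRing (MvPolynomial ι M)) P /
        algebraMap (MvPolynomial ι M) _ π ∈ Set.range θ := by
      rw [hθ]
      exact ⟨e, P, π, hP, he, by simpa using hπ.ne_zero, rfl⟩
    obtain ⟨w, hw⟩ := hmem
    obtain ⟨w, rfl⟩ := σ.surjective w
    obtain ⟨ℓ, hℓ, hwℓ⟩ := (key w).mpr ⟨P, hP, hw⟩
    rw [← mem_homogeneousSubmodule, homogeneousSubmodule_one_eq_span_X,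
      Submodule.mem_span_range_iff_exists_fun] at hℓ
    obtain ⟨a, rfl⟩ := hℓ
    have hC : ∀ a : M, ∃ c : K, θ c = algebraMap _ _ (C a : MvPolynomial ι M) := by
      intro a
      rw [← Set.mem_range, hθ]
      exact ⟨0, C a, 1, isHomogeneous_C _ _, isHomogeneous_one _ _, by simp, by simp⟩
    choose c hc using hC
    have hw' : w = ∑ i, c (a i) * z i := by
      apply θ.injective
      rw [hwℓ, map_sum, map_sum, Finset.sum_div]
      refine Finset.sum_congr rfl fun i _ => ?_
      rw [map_mul, hc, hz, smul_eq_C_mul, map_mul, mul_div_assoc]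
    rw [hw', map_sum, map_sum] at hw
    have : P = ∑ i, C (τ (a i)) * G i := by
      apply IsFractionRing.injective (MvPolynomial ι M) (FractionRing (MvPolynomial ι M))
      rw [eq_div_iff hπ0, Finset.sum_mul] at hw
      rw [← hw, map_sum]
      refine Finset.sum_congr rfl fun i _ => ?_
      rw [map_mul, map_mul, map_mul, hzG, hτ _ _ (hc _)]
      field_simp
    rw [this]
    refine Submodule.sum_mem _ fun i _ => ?_
    rw [← smul_eq_C_mul]
    exact Submodule.smul_mem _ _ (Submodule.subset_span ⟨i, rfl⟩)
  have he0 : e ≠ 0 := by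
    rintro rfl
    rw [← totalDegree_zero_iff_isHomogeneous, totalDegree_eq_zero_iff_eq_C] at he
    apply hπ.not_isUnit
    rw [he]
    refine (IsUnit.mk0 _ fun h0 => hπ.ne_zero ?_).map C
    rw [he, h0, map_zero]
  obtain rfl : e = 1 := by omega
  -- With `e = 1`, the factor `π / X i₀` replaces the denominator `π` by `X i₀`.
  have hd : algebraMap (MvPolynomial ι M) (FractionRing (MvPolynomial ι M)) π /
      algebraMap (MvPolynomial ι M) _ (X i₀) ∈ Set.range θ := by
    rw [hθ]
    exact ⟨1, π, X i₀, he, isHomogeneous_X M i₀, by simp, rfl⟩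
  obtain ⟨d, hd⟩ := hd
  refine ⟨d, ?_, fun x => (key x).trans ?_⟩
  · rintro rfl
    rw [map_zero] at hd
    exact div_ne_zero hπ0 hX0 hd.symm
  · rw [map_mul, hd]
    constructor
    · rintro ⟨G, hG, h⟩
      exact ⟨G, hG, by rw [h]; field_simp⟩
    · rintro ⟨G, hG, h⟩
      refine ⟨G, hG, ?_⟩
      rw [eq_div_iff hX0] at h
      rw [eq_div_iff hπ0, ← h]
      field_simp

end ProjectiveLinearity

end SelfProduct

namespace SelfProduct

/-! ### Galois descent for an action twisted by a cocycle. -/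

section GaloisDescent

variable {F Ω K N : Type*} [Field F] [Field Ω] [Field K] [Field N] [Algebra F Ω] [Algebra Ω K]
  [Algebra K N]

/-- Semilinear actions of a Galois group, with discrete-continuous orbits, on a subspace of a field
extension `N / K`: the subspace is spanned by its invariants. -/
theorem mem_span_invariants [IsGalois F Ω] (ρ : Gal(Ω/F) → N → N) (t : Gal(Ω/F) → K → K)
    (ht : ∀ σ a, t σ (algebraMap Ω K a) = algebraMap Ω K (σ a))
    (hadd : ∀ σ v w, ρ σ (v + w) = ρ σ v + ρ σ w)
    (hsmul : ∀ σ (a : K) v, ρ σ (a • v) = t σ a • ρ σ v)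
    (hmul : ∀ σ τ v, ρ (σ * τ) v = ρ σ (ρ τ v))
    (V : Submodule K N) (hV : ∀ σ, ∀ v ∈ V, ρ σ v ∈ V)
    (hcont : ∀ v ∈ V, ∃ L : IntermediateField F Ω, FiniteDimensional F L ∧
      ∀ σ ∈ L.fixingSubgroup, ρ σ v = v) {v : N} (hv : v ∈ V) :
    v ∈ Submodule.span K {v | v ∈ V ∧ ∀ σ, ρ σ v = v} := by
  classical
  by_contra hmem
  -- A functional killing all invariants must be shown to kill `v`. It kills the traces of multiples
  -- of `v`, and independence of characters isolates `v`.
  obtain ⟨φ, hφv, hφ⟩ := Submodule.exists_le_ker_of_notMem hmem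
  apply hφv
  obtain ⟨L₀, hL₀, hfix₀⟩ := hcont v hv
  let L := IntermediateField.normalClosure F L₀ Ω
  have hL : L₀ ≤ L := IntermediateField.le_normalClosure L₀
  have hfix : ∀ σ ∈ L.fixingSubgroup, ρ σ v = v := fun σ hσ =>
    hfix₀ σ (IntermediateField.fixingSubgroup_antitone hL hσ)
  have hsurj : Function.Surjective (AlgEquiv.restrictNormalHom L : Gal(Ω/F) →* Gal(L/F)) :=
    AlgEquiv.restrictNormalHom_surjective Ω
  choose lift hlift using hsurj
  have hρ : ∀ σ τ : Gal(Ω/F), AlgEquiv.restrictNormalHom L σ = AlgEquiv.restrictNormalHom L τ →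
      ρ σ v = ρ τ v := by
    intro σ τ h
    have : τ⁻¹ * σ ∈ L.fixingSubgroup := by
      rw [← IntermediateField.restrictNormalHom_ker, MonoidHom.mem_ker, map_mul, map_inv, h,
        inv_mul_cancel]
    calc ρ σ v = ρ (τ * (τ⁻¹ * σ)) v := by rw [mul_inv_cancel_left]
      _ = ρ τ v := by rw [hmul, hfix _ this]
  have hzero : ∀ σ, ρ σ 0 = 0 := fun σ => by simpa using hadd σ 0 0
  have hsum : ∀ σ (g : Gal(L/F) → N), ρ σ (∑ i, g i) = ∑ i, ρ σ (g i) := fun σ g =>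
    map_sum (⟨⟨ρ σ, hzero σ⟩, hadd σ⟩ : N →+ N) g Finset.univ
  -- Twisted trace of `α • v` over a finite normal extension whose fixing group fixes `v`; the
  -- choice of lifts is immaterial by `hρ`.
  let T : L → N := fun α => ∑ g : Gal(L/F), algebraMap Ω K (g α : L) • ρ (lift g) v
  have hTV : ∀ α, T α ∈ V := fun α =>
    Submodule.sum_mem _ fun g _ => Submodule.smul_mem _ _ (hV _ _ hv)
  have hTinv : ∀ α σ, ρ σ (T α) = T α := by
    intro α σ
    rw [hsum]
    refine Fintype.sum_equiv (Equiv.mulLeft (AlgEquiv.restrictNormalHom L σ)) _ _ fun g => ?_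
    rw [hsmul, ht, ← hmul]
    congr 1
    · simp only [Equiv.coe_mulLeft, AlgEquiv.mul_apply]
      congr 1
      exact (AlgEquiv.restrictNormal_commutes σ L (g α)).symm
    · exact hρ _ _ (by rw [map_mul, hlift, hlift]; rfl)
  have hlin : ∀ α : L, ∑ g : Gal(L/F), φ (ρ (lift g) v) * algebraMap Ω K (g α : L) = 0 := by
    intro α
    have : φ (T α) = 0 := hφ (Submodule.subset_span ⟨hTV α, hTinv α⟩)
    rw [map_sum] at this
    rw [← this]
    exact Finset.sum_congr rfl fun g _ => by rw [map_smul, smul_eq_mul, mul_comm]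
  let χ : Gal(L/F) → (L →* K) := fun g =>
    ((algebraMap Ω K).comp ((algebraMap L Ω).comp (g : L →+* L)) : L →+* K)
  have hχ : Function.Injective χ := by
    intro g h hgh
    ext α
    exact (algebraMap Ω K).injective (DFunLike.congr_fun hgh α)
  -- Dedekind's independence of the embeddings of `L` in `K`; the coefficient at the identity is `φ
  -- v`.
  have hind := (linearIndependent_monoidHom L K).comp χ hχ
  rw [Fintype.linearIndependent_iff] at hind
  have h1 := hind (fun g => φ (ρ (lift g) v)) (by
    funext α
    simpa [Finset.sum_apply, χ] using hlin α) 1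
  rw [hρ (lift 1) 1 (by rw [hlift, map_one])] at h1
  rwa [hfix 1 (one_mem _)] at h1

variable [Algebra Ω N] [IsScalarTower Ω K N]
  (t : Gal(Ω/F) →* RingAut K) (s : Gal(Ω/F) →* RingAut N)

/-- Let `j` be a second embedding of `K` into `N`, equivariant for semilinear actions of a Galois
group, and `W` a finite-dimensional space of elements of `K` which the action preserves up to
scalars. Then `j W` lies in an extension of `K` generated by few invariant elements. -/
theorem exists_invariant_generators [IsGalois F Ω] [IsAlgClosed Ω]
    (ht : ∀ σ a, t σ (algebraMap Ω K a) = algebraMap Ω K (σ a))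
    (hs : ∀ σ x, s σ (algebraMap K N x) = algebraMap K N (t σ x))
    (hcont : ∀ x : N, ∃ L : IntermediateField F Ω, FiniteDimensional F L ∧
      ∀ σ ∈ L.fixingSubgroup, s σ x = x)
    (j : K →ₐ[Ω] N) (hj : ∀ σ x, s σ (j x) = j (t σ x)) {m : ℕ} (w : Fin (m + 1) → K)
    (hw : 1 ∈ Submodule.span Ω (Set.range w)) (d : Gal(Ω/F) → K) (hd : ∀ σ, d σ ≠ 0)
    (hdw : ∀ σ x, x ∈ Submodule.span Ω (Set.range w) ↔
      d σ * t σ x ∈ Submodule.span Ω (Set.range w)) :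
    ∃ u : Fin m → N, (∀ σ i, s σ (u i) = u i) ∧
      ∀ x ∈ Submodule.span Ω (Set.range w), j x ∈ IntermediateField.adjoin K (Set.range u) := by
  classical
  set W := Submodule.span Ω (Set.range w) with hW
  have hW0 : W ≠ ⊥ := fun h => one_ne_zero ((Submodule.mem_bot Ω).mp (h ▸ hw))
  have hWfg : W.FG := ⟨Finset.univ.image w, by simp [hW]⟩
  -- a scalar preserving `W` is a constant
  have hconst : ∀ r : K, (∀ x ∈ W, r * x ∈ W) → ∃ a, algebraMap Ω K a = r := by
    intro r hr
    have hr' : r ∈ integralClosure Ω K := isIntegral_of_smul_mem_submodule W hW0 hWfg r hr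
    obtain ⟨a, ha⟩ := (IsAlgClosed.algebraMap_bijective_of_isIntegral (k := Ω)
      (K := integralClosure Ω K)).2 ⟨r, hr'⟩
    exact ⟨a, congrArg Subtype.val ha⟩
  have htW : ∀ σ, (∀ i, t σ (w i) = w i) → ∀ x ∈ W, t σ x ∈ W := by
    intro σ hσ x hx
    induction hx using Submodule.span_induction with
    | mem x hx =>
      obtain ⟨i, rfl⟩ := hx
      rw [hσ]
      exact Submodule.subset_span ⟨i, rfl⟩
    | zero => rw [map_zero]; exact zero_mem _
    | add x y _ _ hx hy => rw [map_add]; exact add_mem hx hy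
    | smul a x _ hx =>
      rw [Algebra.smul_def, map_mul, ht, ← Algebra.smul_def]
      exact Submodule.smul_mem _ _ hx
  have hinj := (algebraMap K N).injective
  have hdN : ∀ σ, algebraMap K N (d σ) ≠ 0 := fun σ => (map_ne_zero _).mpr (hd σ)
  have hjΩ : ∀ a, j (algebraMap Ω K a) = algebraMap K N (algebraMap Ω K a) := fun a => by
    rw [AlgHom.commutes, ← IsScalarTower.algebraMap_apply]
  -- Both embeddings of `K` agree on `Ω`, so the constants by which `d` fails to be a cocycle cancel
  -- in this quotient.
  let c : Gal(Ω/F) → N := fun σ => j (d σ) / algebraMap K N (d σ)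
  -- If `σ` fixes the generators of `W`, then `d σ` itself preserves `W` and is constant. This gives
  -- continuity of the twisted action.
  have hc1 : ∀ σ, (∀ i, t σ (w i) = w i) → c σ = 1 := by
    intro σ hσ
    have hσ' : ∀ i, t σ⁻¹ (w i) = w i := fun i => by
      conv_lhs => rw [← hσ i]
      rw [← RingAut.mul_apply, ← map_mul, inv_mul_cancel, map_one, RingAut.one_apply]
    obtain ⟨a, ha⟩ := hconst (d σ) fun x hx => by
      have := (hdw σ _).mp (htW _ hσ' x hx)
      rwa [← RingAut.mul_apply, ← map_mul, mul_inv_cancel, map_one, RingAut.one_apply] at this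
    have h0 := hdN σ
    simp only [c]
    rw [← ha] at h0 ⊢
    rw [hjΩ, div_self h0]
  have hcmul : ∀ σ τ, c (σ * τ) = c σ * s σ (c τ) := by
    intro σ τ
    have hD : d σ * t σ (d τ) ≠ 0 := mul_ne_zero (hd _) ((map_ne_zero _).mpr (hd _))
    -- Both factors bring the image of `W` under `σ * τ` back to `W`, so their quotient preserves
    -- `W`.
    obtain ⟨a, ha⟩ := hconst (d (σ * τ) / (d σ * t σ (d τ))) fun x hx => by
      obtain ⟨y, hy⟩ := (t (σ * τ)).surjective (x / (d σ * t σ (d τ)))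
      have hyW : y ∈ W := by
        rw [hdw τ, hdw σ, map_mul, ← mul_assoc, ← RingAut.mul_apply, ← map_mul, hy,
          mul_div_cancel₀ _ hD]
        exact hx
      have := (hdw (σ * τ) y).mp hyW
      rw [hy] at this
      convert this using 1
      ring
    rw [eq_div_iff hD] at ha
    have h1 := hdN σ
    have h2 := hdN τ
    have h3 : algebraMap K N (t σ (d τ)) ≠ 0 := by simpa using hd τ
    have ha0 : algebraMap K N (algebraMap Ω K a) ≠ 0 := by
      intro h0
      rw [map_eq_zero] at h0
      rw [h0, zero_mul] at ha
      exact hd _ ha.symm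
    simp only [c]
    rw [← ha, map_div₀, hs, hj]
    simp only [map_mul, hjΩ]
    field_simp
  let ρ : Gal(Ω/F) → N → N := fun σ v => c σ * s σ v
  let V : Submodule K N := Submodule.span K (Set.range (j ∘ w))
  have hjV : ∀ x ∈ W, j x ∈ V := by
    intro x hx
    induction hx using Submodule.span_induction with
    | mem x hx =>
      obtain ⟨i, rfl⟩ := hx
      exact Submodule.subset_span ⟨i, rfl⟩
    | zero => rw [map_zero]; exact zero_mem _
    | add x y _ _ hx hy => rw [map_add]; exact add_mem hx hy
    | smul a x _ hx =>
      rw [Algebra.smul_def, map_mul, hjΩ, ← Algebra.smul_def]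
      exact Submodule.smul_mem _ _ hx
  have hρadd : ∀ σ v w, ρ σ (v + w) = ρ σ v + ρ σ w := fun σ v w => by
    simp only [ρ, map_add, mul_add]
  have hρsmul : ∀ σ (a : K) v, ρ σ (a • v) = t σ a • ρ σ v := fun σ a v => by
    simp only [ρ, Algebra.smul_def, map_mul, hs]
    ring
  have hρmul : ∀ σ τ v, ρ (σ * τ) v = ρ σ (ρ τ v) := fun σ τ v => by
    simp only [ρ, hcmul, map_mul, RingAut.mul_apply, mul_assoc]
  have hρV : ∀ σ, ∀ v ∈ V, ρ σ v ∈ V := by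
    intro σ v hv
    induction hv using Submodule.span_induction with
    | mem x hx =>
      obtain ⟨i, rfl⟩ := hx
      have := V.smul_mem (d σ)⁻¹ (hjV _ ((hdw σ _).mp (Submodule.subset_span ⟨i, rfl⟩)))
      convert this using 1
      simp only [ρ, c, Function.comp_apply, hj, map_mul, Algebra.smul_def, map_inv₀]
      ring
    | zero => simp only [ρ, map_zero, mul_zero]; exact zero_mem _
    | add x y _ _ hx hy => rw [hρadd]; exact add_mem hx hy
    | smul a x _ hx => rw [hρsmul]; exact Submodule.smul_mem _ _ hx
  have hρcont : ∀ v ∈ V, ∃ L : IntermediateField F Ω, FiniteDimensional F L ∧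
      ∀ σ ∈ L.fixingSubgroup, ρ σ v = v := by
    intro v _
    obtain ⟨L, hL, hLv⟩ := hcont v
    choose L' hL' hLw using fun i => hcont (algebraMap K N (w i))
    refine ⟨L ⊔ ⨆ i, L' i, inferInstance, fun σ hσ => ?_⟩
    have h1 := IntermediateField.fixingSubgroup_antitone (le_sup_left : L ≤ L ⊔ ⨆ i, L' i) hσ
    have h2 : ∀ i, t σ (w i) = w i := fun i => hinj <| by
      rw [← hs]
      exact hLw i σ (IntermediateField.fixingSubgroup_antitone
        ((le_iSup L' i).trans (le_sup_right : _ ≤ L ⊔ ⨆ i, L' i)) hσ)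
    simp only [ρ, hc1 σ h2, one_mul, hLv σ h1]
  have hspan := fun v hv => mem_span_invariants ρ (fun σ => t σ) ht hρadd hρsmul hρmul V hρV hρcont
    (v := v) hv
  obtain ⟨b, hb, hbspan, hli⟩ := exists_linearIndependent K {v | v ∈ V ∧ ∀ σ, ρ σ v = v}
  have hVb : V ≤ Submodule.span K b := fun v hv => hbspan ▸ hspan v hv
  have hle : Set.range ((↑) : b → N) ≤ Submodule.span K (Set.range (j ∘ w)) := by
    rintro _ ⟨x, rfl⟩
    exact (hb x.2).1
  have hbfin : Finite b := LinearIndependent.finite_of_le_span_finite _ hli _ hle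
  have := Fintype.ofFinite b
  have hcard : Fintype.card b ≤ m + 1 := by
    refine (linearIndependent_le_span_aux' _ hli _ hle).trans ?_
    simpa using Fintype.card_range_le (j ∘ w)
  have h1V : (1 : N) ∈ V := by simpa using hjV 1 hw
  obtain ⟨v₀, hv₀⟩ : b.Nonempty := by
    rw [Set.nonempty_iff_ne_empty]
    rintro rfl
    simpa using hVb h1V
  have hv₀0 : v₀ ≠ 0 := hli.ne_zero ⟨v₀, hv₀⟩
  obtain ⟨emb⟩ : Nonempty ({x : b // x ≠ ⟨v₀, hv₀⟩} ↪ Fin m) := by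
    apply Function.Embedding.nonempty_of_card_le
    rw [Fintype.card_subtype_compl, Fintype.card_subtype_eq, Fintype.card_fin]
    omega
  -- The invariant basis `b` has at most `m + 1` elements. One of them, `v₀`, serves as denominator;
  -- unused indices are padded with it.
  let e : Fin m → N := Function.extend emb (fun x => x.1.1) fun _ => v₀
  have he : ∀ i, e i ∈ b := by
    intro i
    by_cases hi : ∃ x, emb x = i
    · obtain ⟨x, rfl⟩ := hi
      simp only [e, emb.injective.extend_apply]
      exact x.1.2
    · simp only [e, Function.extend_apply' _ _ _ hi]
      exact hv₀
  -- Numerator and denominator are fixed by the action twisted by the same `c σ`, so the ratio is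
  -- fixed by `s σ`.
  refine ⟨fun i => e i / v₀, fun σ i => ?_, fun x hx => ?_⟩
  · have h1 := (hb (he i)).2 σ
    have h2 := (hb hv₀).2 σ
    simp only [ρ] at h1 h2
    have hc0 : c σ ≠ 0 := fun h => hv₀0 (by rw [← h2, h, zero_mul])
    rw [map_div₀, ← mul_div_mul_left _ _ hc0, h1, h2]
  · set A := IntermediateField.adjoin K (Set.range fun i => e i / v₀)
    have key : ∀ v ∈ V, v / v₀ ∈ A := by
      intro v hv
      replace hv := hVb hv
      induction hv using Submodule.span_induction with
      | mem x hx =>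
        by_cases hx0 : x = v₀
        · rw [hx0, div_self hv₀0]
          exact one_mem _
        · refine IntermediateField.subset_adjoin _ _ ⟨emb ⟨⟨x, hx⟩, fun h => hx0 ?_⟩, ?_⟩
          · exact congrArg Subtype.val h
          · simp only [e, emb.injective.extend_apply]
      | zero => rw [zero_div]; exact zero_mem _
      | add x y _ _ hx hy => rw [add_div]; exact add_mem hx hy
      | smul a x _ hx => rw [smul_div_assoc]; exact A.smul_mem hx
    -- Since `1 ∈ V`, the inverse of `v₀` is among the ratios, which recovers `V` itself and not
    -- only its quotients.
    have h0 : v₀ ∈ A := by simpa using inv_mem (key 1 h1V)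
    simpa [hv₀0] using mul_mem (key _ (hjV x hx)) h0

end GaloisDescent

end SelfProduct

namespace SelfProduct

/-! ### Tensor products that remain domains. -/

section TensorDomain

open scoped TensorProduct

/-- If `A ⊗ R` is a domain, so is `A ⊗ Frac R`. -/
theorem isDomain_tensor_fractionRing {k A R K : Type*} [Field k] [CommRing A] [Algebra k A]
    [CommRing R] [Algebra k R] [IsDomain (A ⊗[k] R)] [Field K] [Algebra k K] [Algebra R K]
    [IsScalarTower k R K] [IsFractionRing R K] : IsDomain (A ⊗[k] K) := by
  let φ : A ⊗[k] R →ₐ[k] A ⊗[k] K :=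
    Algebra.TensorProduct.map (AlgHom.id k A) (IsScalarTower.toAlgHom k R K)
  have hφ : Function.Injective φ := Module.Flat.lTensor_preserves_injective_linearMap (M := A)
    (IsScalarTower.toAlgHom k R K).toLinearMap (IsFractionRing.injective R K)
  -- Denominators can be cleared by elements of `R`, which become units in `A ⊗ K`.
  have hden : ∀ z : A ⊗[k] K, ∃ r : R, algebraMap R K r ≠ 0 ∧ ∃ y : A ⊗[k] R,
      (1 ⊗ₜ algebraMap R K r) * z = φ y := by
    intro z
    induction z with
    | zero => exact ⟨1, by simp, 0, by simp⟩
    | tmul a x =>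
      obtain ⟨p, q, hq, rfl⟩ := IsFractionRing.div_surjective (A := R) x
      have hq0 : algebraMap R K q ≠ 0 := fun h0 => by
        have : Nontrivial R := (algebraMap R K).domain_nontrivial
        exact nonZeroDivisors.ne_zero hq (IsFractionRing.injective R K (by rw [h0, map_zero]))
      refine ⟨q, hq0, a ⊗ₜ p, ?_⟩
      simp [φ, mul_div_cancel₀ _ hq0]
    | add z z' hz hz' =>
      obtain ⟨r, hr, y, hy⟩ := hz
      obtain ⟨r', hr', y', hy'⟩ := hz'
      refine ⟨r * r', by simp [hr, hr'], (1 ⊗ₜ r') * y + (1 ⊗ₜ r) * y', ?_⟩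
      have h1 : φ (1 ⊗ₜ r') = 1 ⊗ₜ algebraMap R K r' := by simp [φ]
      have h2 : φ (1 ⊗ₜ r) = 1 ⊗ₜ algebraMap R K r := by simp [φ]
      have h3 : (1 ⊗ₜ algebraMap R K (r * r') : A ⊗[k] K) =
          (1 ⊗ₜ algebraMap R K r) * (1 ⊗ₜ algebraMap R K r') := by simp
      rw [h3, map_add φ, map_mul φ, map_mul φ, h1, h2, ← hy, ← hy']
      ring
  have hcancel : ∀ (r : R) (z : A ⊗[k] K), algebraMap R K r ≠ 0 →
      (1 ⊗ₜ algebraMap R K r) * z = 0 → z = 0 := by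
    intro r z hr h
    have : (1 ⊗ₜ (algebraMap R K r)⁻¹ : A ⊗[k] K) * (1 ⊗ₜ algebraMap R K r) = 1 := by
      simp [inv_mul_cancel₀ hr, Algebra.TensorProduct.one_def]
    rw [← one_mul z, ← this, mul_assoc, h, mul_zero]
  have : Nontrivial (A ⊗[k] K) := hφ.nontrivial
  have : NoZeroDivisors (A ⊗[k] K) := by
    refine ⟨fun {z z'} h => ?_⟩
    obtain ⟨r, hr, y, hy⟩ := hden z
    obtain ⟨r', hr', y', hy'⟩ := hden z'
    have : φ (y * y') = 0 := by
      rw [map_mul, ← hy, ← hy', mul_mul_mul_comm, h, mul_zero]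
    rw [map_eq_zero_iff φ hφ, mul_eq_zero] at this
    rcases this with rfl | rfl
    · exact .inl (hcancel r z hr (by rw [hy, map_zero]))
    · exact .inr (hcancel r' z' hr' (by rw [hy', map_zero]))
  exact NoZeroDivisors.to_isDomain _

/-- Base change of an algebraically independent family. -/
theorem algebraicIndependent_one_tmul {k A B ι : Type*} [Field k] [CommRing A] [Algebra k A]
    [CommRing B] [Algebra k B] {x : ι → B} (hx : AlgebraicIndependent k x) :
    AlgebraicIndependent A (fun i => (1 ⊗ₜ x i : A ⊗[k] B)) := by
  have h := Module.Flat.lTensor_preserves_injective_linearMap (M := A)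
    (MvPolynomial.aeval x : MvPolynomial ι k →ₐ[k] B).toLinearMap hx
  have heq : (MvPolynomial.aeval fun i => (1 ⊗ₜ x i : A ⊗[k] B)).comp
      (MvPolynomial.algebraTensorAlgEquiv (σ := ι) k A).toAlgHom =
      Algebra.TensorProduct.map (AlgHom.id A A) (MvPolynomial.aeval x) := by
    ext i
    simp [MvPolynomial.algebraTensorAlgEquiv_tmul]
  have heq' : ∀ p, MvPolynomial.aeval (fun i => (1 ⊗ₜ x i : A ⊗[k] B)) p =
      Algebra.TensorProduct.map (AlgHom.id A A) (MvPolynomial.aeval x)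
        ((MvPolynomial.algebraTensorAlgEquiv (σ := ι) k A).symm p) := fun p => by
    rw [← heq]
    simp
  intro p q hpq
  rw [heq', heq'] at hpq
  exact (MvPolynomial.algebraTensorAlgEquiv k A).symm.injective (h hpq)

/-- A purely transcendental extension stays a domain after tensoring with a domain. -/
theorem isDomain_tensor_of_adjoin_eq_top {k A K ι : Type*} [Field k] [CommRing A] [IsDomain A]
    [Algebra k A] [Field K] [Algebra k K] {x : ι → K} (hx : AlgebraicIndependent k x)
    (htop : IntermediateField.adjoin k (Set.range x) = ⊤) : IsDomain (A ⊗[k] K) := by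
  let R := Algebra.adjoin k (Set.range x)
  have hR : IsFractionRing R K := by
    refine IsFractionRing.of_field _ _ fun z => ?_
    obtain ⟨r, hr, s, hs, h⟩ := IntermediateField.mem_adjoin_iff_div.mp
      (htop ▸ IntermediateField.mem_top : z ∈ IntermediateField.adjoin k (Set.range x))
    exact ⟨⟨r, hr⟩, ⟨s, hs⟩, h⟩
  have : IsDomain (A ⊗[k] R) :=
    ((Algebra.TensorProduct.congr (AlgEquiv.refl (R := k) (A₁ := A)) hx.aevalEquiv.symm).trans
      ((MvPolynomial.algebraTensorAlgEquiv k A).restrictScalars k)).toMulEquiv.isDomain _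
  exact isDomain_tensor_fractionRing (R := R)

end TensorDomain

end SelfProduct

namespace SelfProduct

/-! ### The Galois action on a base change and its invariants. -/

section GaloisAction

open scoped TensorProduct

variable (F Ω A : Type*) [Field F] [Field Ω] [Algebra F Ω] [CommRing A] [Algebra F A]

/-- The action of the Galois group on `Ω ⊗ A` through the first factor. -/
noncomputable def galoisAction : Gal(Ω/F) →* RingAut (Ω ⊗[F] A) where
  toFun σ := (Algebra.TensorProduct.congr σ (AlgEquiv.refl (A₁ := A))).toRingEquiv
  map_one' := by
    ext x
    induction x with
    | zero => simp
    | tmul a y => simp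
    | add x y hx hy => rw [map_add, map_add, hx, hy]
  map_mul' σ τ := by
    ext x
    induction x with
    | zero => simp
    | tmul a y => simp
    | add x y hx hy => rw [map_add, map_add, hx, hy]

variable {F Ω A}

@[simp]
theorem galoisAction_tmul (σ : Gal(Ω/F)) (a : Ω) (y : A) :
    galoisAction F Ω A σ (a ⊗ₜ y) = σ a ⊗ₜ y := rfl

/-- A tensor involves finitely many elements of `Ω`, all algebraic; this is the continuity needed
for descent. -/
theorem exists_forall_mem_fixingSubgroup [Algebra.IsAlgebraic F Ω] (x : Ω ⊗[F] A) :
    ∃ L : IntermediateField F Ω, FiniteDimensional F L ∧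
      ∀ σ ∈ L.fixingSubgroup, galoisAction F Ω A σ x = x := by
  induction x with
  | zero => exact ⟨⊥, inferInstance, by simp⟩
  | tmul a y =>
    refine ⟨IntermediateField.adjoin F {a}, IntermediateField.adjoin.finiteDimensional
      (Algebra.IsIntegral.isIntegral a), fun σ hσ => ?_⟩
    rw [galoisAction_tmul]
    congr 1
    exact (IntermediateField.mem_fixingSubgroup_iff _ _).mp hσ a
      (IntermediateField.mem_adjoin_simple_self F a)
  | add x y hx hy =>
    obtain ⟨L, hL, hLx⟩ := hx
    obtain ⟨M, hM, hMy⟩ := hy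
    refine ⟨L ⊔ M, inferInstance, fun σ hσ => ?_⟩
    rw [map_add, hLx σ (IntermediateField.fixingSubgroup_antitone le_sup_left hσ),
      hMy σ (IntermediateField.fixingSubgroup_antitone le_sup_right hσ)]

/-- In an `F`-basis of `A` the group acts on coordinates, so those of an invariant tensor lie in the
fixed field `F`. -/
theorem exists_one_tmul_of_galoisAction_eq [IsGalois F Ω] (x : Ω ⊗[F] A)
    (hx : ∀ σ, galoisAction F Ω A σ x = x) : ∃ y : A, x = 1 ⊗ₜ y := by
  let b := Module.Basis.ofVectorSpace F A
  let B := Algebra.TensorProduct.basis Ω b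
  have hrepr : ∀ (σ : Gal(Ω/F)) (z : Ω ⊗[F] A) i,
      B.repr (galoisAction F Ω A σ z) i = σ (B.repr z i) := by
    intro σ z i
    induction z with
    | zero => simp
    | tmul a y => simp [B, Algebra.TensorProduct.basis_repr_tmul]
    | add z w hz hw => simp only [map_add, Finsupp.add_apply, hz, hw]
  have hF : ∀ i, ∃ c : F, algebraMap F Ω c = B.repr x i := fun i =>
    (InfiniteGalois.mem_range_algebraMap_iff_fixed (k := F) (K := Ω) _).mpr fun σ => by
      rw [← hrepr, hx]
  choose c hc using hF
  refine ⟨∑ i ∈ (B.repr x).support, c i • b i, ?_⟩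
  conv_lhs => rw [← B.linearCombination_repr x, Finsupp.linearCombination_apply, Finsupp.sum]
  rw [TensorProduct.tmul_sum]
  refine Finset.sum_congr rfl fun i _ => ?_
  rw [← hc, Algebra.TensorProduct.basis_apply, TensorProduct.tmul_smul, algebraMap_smul]

end GaloisAction

/-! ### Descending generators from `Ω ⊗ N` to `N`. -/

section Generators

open scoped TensorProduct

variable {F Ω E N K : Type*} [Field F] [Field Ω] [Field E] [Field N] [Field K] [Algebra F Ω]
  [Algebra F E] [Algebra F N] [Algebra Ω K]

/-- An `F`-linear retraction of `Ω` onto `F` induces a retraction of `Ω ⊗ N` onto `N` that maps `Ω ⊗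
M` into `M`. -/
theorem mem_of_one_tmul_mem_range (M : Submodule F N) {y : N}
    (hy : (1 ⊗ₜ y : Ω ⊗[F] N) ∈ LinearMap.range (M.subtype.lTensor Ω)) : y ∈ M := by
  obtain ⟨r, hr⟩ := (Algebra.linearMap F Ω).exists_leftInverse_of_injective
    (LinearMap.ker_eq_bot.mpr (algebraMap F Ω).injective)
  let R : Ω ⊗[F] N →ₗ[F] N := (TensorProduct.lid F N).toLinearMap ∘ₗ r.rTensor N
  have hR : ∀ z : Ω ⊗[F] M, R (M.subtype.lTensor Ω z) ∈ M := by
    intro z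
    induction z with
    | zero => simp
    | tmul a y => simpa [R] using M.smul_mem _ y.2
    | add z w hz hw => rw [map_add, map_add]; exact add_mem hz hw
  obtain ⟨z, hz⟩ := hy
  have h1 : r 1 = 1 := by simpa using LinearMap.congr_fun hr 1
  have : R (1 ⊗ₜ y) = y := by simp [R, h1]
  rw [← this, ← hz]
  exact hR z

/-- Let `N` be generated by two copies of `E`. If `K = Ω ⊗ E` has a finite-dimensional generating
space, preserved up to scalars by the Galois group, then `N` is generated over the first copy
of `E` by few elements. -/
theorem exists_generators [IsGalois F Ω] [IsAlgClosed Ω] (ι₁ ι₂ : E →ₐ[F] N)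
    [IsDomain (Ω ⊗[F] N)]
    (hN : IntermediateField.adjoin F (Set.range ι₁ ∪ Set.range ι₂) = ⊤)
    (e : Ω ⊗[F] E ≃ₐ[Ω] K) {m : ℕ} (w : Fin (m + 1) → K)
    (hw : 1 ∈ Submodule.span Ω (Set.range w))
    (hwtop : IntermediateField.adjoin Ω (Set.range w) = ⊤)
    (d : Gal(Ω/F) → K) (hd : ∀ σ, d σ ≠ 0)
    (hdw : ∀ σ x, x ∈ Submodule.span Ω (Set.range w) ↔
      d σ * e (galoisAction F Ω E σ (e.symm x)) ∈ Submodule.span Ω (Set.range w)) :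
    ∃ u : Fin m → N, IntermediateField.adjoin F (Set.range ι₁ ∪ Set.range u) = ⊤ := by
  -- A domain obtained from a field by an algebraic base change is a field.
  let _ : Field (Ω ⊗[F] N) :=
    (Algebra.TensorProduct.isField_of_isAlgebraic F Ω N (.inl inferInstance)).toField
  let j₁ : K →ₐ[Ω] Ω ⊗[F] N :=
    (Algebra.TensorProduct.map (AlgHom.id Ω Ω) ι₁).comp e.symm.toAlgHom
  let j₂ : K →ₐ[Ω] Ω ⊗[F] N :=
    (Algebra.TensorProduct.map (AlgHom.id Ω Ω) ι₂).comp e.symm.toAlgHom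
  let _ : Algebra K (Ω ⊗[F] N) := j₁.toRingHom.toAlgebra
  have : IsScalarTower Ω K (Ω ⊗[F] N) := IsScalarTower.of_algebraMap_eq fun a =>
    (j₁.commutes a).symm
  let t : Gal(Ω/F) →* RingAut K :=
    { toFun := fun σ => (e.symm.toRingEquiv.trans (galoisAction F Ω E σ)).trans e.toRingEquiv
      map_one' := by
        ext x
        simp
      map_mul' := fun σ τ => by
        ext x
        simp }
  have ht : ∀ σ x, t σ x = e (galoisAction F Ω E σ (e.symm x)) := fun σ x => rfl
  have hmap : ∀ (ι : E →ₐ[F] N) σ x, galoisAction F Ω N σ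
      (Algebra.TensorProduct.map (AlgHom.id Ω Ω) ι x) =
      Algebra.TensorProduct.map (AlgHom.id Ω Ω) ι (galoisAction F Ω E σ x) := by
    intro ι σ x
    induction x with
    | zero => simp
    | tmul a y => simp
    | add x y hx hy => simp only [map_add, hx, hy]
  obtain ⟨u', hu', hju'⟩ := exists_invariant_generators t (galoisAction F Ω N)
    (fun σ a => by
      rw [ht, e.symm.commutes, Algebra.TensorProduct.algebraMap_apply, galoisAction_tmul]
      exact e.commutes (σ a))
    (fun σ x => by
      change galoisAction F Ω N σ (j₁ x) = j₁ (t σ x)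
      simp [j₁, hmap, ht])
    exists_forall_mem_fixingSubgroup j₂ (fun σ x => by simp [j₂, hmap, ht]) w hw d hd
    (fun σ x => hdw σ x)
  choose u hu using fun i => exists_one_tmul_of_galoisAction_eq (u' i) fun σ => hu' σ i
  refine ⟨u, ?_⟩
  set N₀ := IntermediateField.adjoin F (Set.range ι₁ ∪ Set.range u) with hN₀
  -- the image of `Ω ⊗ N₀` is a subfield
  let ψ : Ω ⊗[F] N₀ →ₐ[Ω] Ω ⊗[F] N := Algebra.TensorProduct.map (AlgHom.id Ω Ω) N₀.val
  have hψ : Function.Injective ψ := Module.Flat.lTensor_preserves_injective_linearMap (M := Ω)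
    N₀.val.toLinearMap N₀.val.injective
  have : IsDomain (Ω ⊗[F] N₀) := hψ.isDomain ψ.toRingHom
  let _ : Field (Ω ⊗[F] N₀) :=
    (Algebra.TensorProduct.isField_of_isAlgebraic F Ω N₀ (.inl inferInstance)).toField
  have hιmem : ∀ a x, (a ⊗ₜ ι₁ x : Ω ⊗[F] N) ∈ Set.range ψ := fun a x =>
    ⟨a ⊗ₜ ⟨ι₁ x, IntermediateField.subset_adjoin _ _ (.inl ⟨x, rfl⟩)⟩, by simp [ψ]⟩
  -- `D` contains the first copy of `K` and the descended generators, hence `j₂ w` and all of `j₂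
  -- K`. Its elements from `N` lie in `N₀`.
  let D : IntermediateField K (Ω ⊗[F] N) :=
    { ψ.toRingHom.fieldRange with
      algebraMap_mem' := fun x => by
        obtain ⟨x, rfl⟩ := e.surjective x
        change j₁ (e x) ∈ ψ.toRingHom.fieldRange
        simp only [j₁, AlgHom.comp_apply, AlgEquiv.toAlgHom_apply, AlgEquiv.symm_apply_apply]
        induction x with
        | zero => rw [map_zero]; exact zero_mem _
        | tmul a y => exact hιmem a y
        | add x y hx hy => rw [map_add]; exact add_mem hx hy }
  have hD : ∀ z, z ∈ D ↔ ∃ y, ψ y = z := fun z => Iff.rfl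
  have hadjD : IntermediateField.adjoin K (Set.range u') ≤ D := by
    rw [IntermediateField.adjoin_le_iff]
    rintro _ ⟨i, rfl⟩
    exact ⟨1 ⊗ₜ ⟨u i, IntermediateField.subset_adjoin _ _ (.inr ⟨i, rfl⟩)⟩, by simp [ψ, hu]⟩
  have hj₂ : ∀ x, j₂ x ∈ D := by
    let D' : IntermediateField Ω (Ω ⊗[F] N) := D.restrictScalars Ω
    have hle : IntermediateField.adjoin Ω (Set.range w) ≤ D'.comap j₂ := by
      rw [IntermediateField.adjoin_le_iff]
      rintro _ ⟨i, rfl⟩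
      exact hadjD (hju' _ (Submodule.subset_span ⟨i, rfl⟩))
    intro x
    exact hle (hwtop ▸ IntermediateField.mem_top : x ∈ IntermediateField.adjoin Ω (Set.range w))
  rw [eq_top_iff, ← hN, IntermediateField.adjoin_le_iff]
  rintro y (hy | ⟨x, rfl⟩)
  · exact IntermediateField.subset_adjoin _ _ (.inl hy)
  · obtain ⟨z, hz⟩ := (hD _).mp (hj₂ (e (1 ⊗ₜ x)))
    refine mem_of_one_tmul_mem_range (Ω := Ω) (Subalgebra.toSubmodule N₀.toSubalgebra) ⟨z, ?_⟩
    have : j₂ (e (1 ⊗ₜ x)) = 1 ⊗ₜ ι₂ x := by simp [j₂]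
    rw [← this, ← hz]
    rfl

end Generators

end SelfProduct

namespace SelfProduct

/-! ### Transcendence degree, general position, and independent generators. -/

section Transcendence

open scoped TensorProduct

/-- Generators of a field extension, no more in number than some algebraically independent
family, are algebraically independent. -/
theorem algebraicIndependent_of_adjoin_eq_top {E N : Type u} [Field E] [Field N] [Algebra E N]
    {m : ℕ} {x y : Fin m → N} (hx : IntermediateField.adjoin E (Set.range x) = ⊤)
    (hy : AlgebraicIndependent E y) : AlgebraicIndependent E x := by
  have : Algebra.IsAlgebraic (Algebra.adjoin E (Set.range x)) N := by
    refine ⟨fun z => IntermediateField.isAlgebraic_adjoin_iff.mp ?_⟩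
    exact isAlgebraic_algebraMap
      (⟨z, hx ▸ IntermediateField.mem_top⟩ : IntermediateField.adjoin E (Set.range x))
  exact (Algebra.IsAlgebraic.isTranscendenceBasis_of_lift_le_trdeg_of_finite E x hy.lift_cardinalMk_le_trdeg).1

/-- Two families, algebraically independent over subfields with enough algebraically independent
elements, become jointly independent after a shift by elements of one of the subfields. -/
theorem exists_shift_algebraicIndependent {F N : Type u} [Field F] [Field N] [Algebra F N]
    (A : IntermediateField F N) {m : ℕ} {a : Fin m → A} (ha : AlgebraicIndependent F a)
    {x v : Fin m → N} (hx : AlgebraicIndependent A x) (hv : AlgebraicIndependent F v) :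
    ∃ b : Fin m → A, AlgebraicIndependent F (Sum.elim v fun i => x i + b i) := by
  classical
  suffices h : ∀ T : Finset (Fin m), ∃ b : Fin m → A,
      AlgebraicIndepOn F (Sum.elim v fun i => x i + b i) (Set.range Sum.inl ∪ Sum.inr '' T) by
    obtain ⟨b, hb⟩ := h Finset.univ
    refine ⟨b, ?_⟩
    have huniv : (Set.range Sum.inl ∪ Sum.inr '' (Finset.univ : Finset (Fin m)) :
        Set (Fin m ⊕ Fin m)) = Set.univ := by
      ext (i | i) <;> simp
    rw [huniv] at hb
    exact AlgebraicIndepOn.univ.mp hb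
  intro T
  induction T using Finset.induction_on with
  | empty =>
    refine ⟨0, ?_⟩
    rw [Finset.coe_empty, Set.image_empty, Set.union_empty]
    convert hv.comp _ (Equiv.ofInjective (Sum.inl : Fin m → Fin m ⊕ Fin m)
      Sum.inl_injective).symm.injective using 1
    funext ⟨_, i, rfl⟩
    simp
  | insert j T hj ih =>
    obtain ⟨b, hb⟩ := ih
    set I : Set (Fin m ⊕ Fin m) := Set.range Sum.inl ∪ Sum.inr '' (T : Set (Fin m)) with hI
    have hjI : Sum.inr j ∉ I := by simpa [hI] using hj
    set s : Set N := (Sum.elim v fun i => x i + b i) '' I with hs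
    by_contra hcon
    push Not at hcon
    -- If no shift of `x j` works, all its shifts are algebraic over the family built so far, hence
    -- so are their differences, the elements of `A`.
    have halg : ∀ β : A, IsAlgebraic (Algebra.adjoin F s) (x j + β) := by
      intro β
      by_contra htr
      apply hcon (Function.update b j β)
      have hset : (Set.range Sum.inl ∪ Sum.inr '' ((insert j T : Finset (Fin m)) : Set (Fin m)) :
          Set (Fin m ⊕ Fin m)) = insert (Sum.inr j) I := by
        rw [Finset.coe_insert, Set.image_insert_eq, hI, Set.union_insert]
      have heq : Set.EqOn (Sum.elim v fun i => x i + (b i : N))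
          (Sum.elim v fun i => x i + (Function.update b j β i : N)) I := by
        rintro (i | i) hi
        · rfl
        · have : i ≠ j := by rintro rfl; exact hjI hi
          simp [this]
      rw [hset, AlgebraicIndepOn.insert_iff hjI]
      constructor
      · have hfun : (fun i : I => Sum.elim v (fun i => x i + (b i : N)) i) =
            fun i : I => Sum.elim v (fun i => x i + (Function.update b j β i : N)) i :=
          funext fun i => heq i.2
        unfold AlgebraicIndepOn at hb ⊢
        rw [← hfun]
        exact hb
      · rw [← heq.image_eq]
        simpa [Transcendental] using htr
    set C := Subalgebra.algebraicClosure (Algebra.adjoin F s) N with hC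
    have hxj : x j ∈ C := by
      change IsAlgebraic _ _
      simpa using halg 0
    have hA : ∀ β : A, (β : N) ∈ C := fun β => by
      simpa using sub_mem (show x j + β ∈ C from halg β) hxj
    have hsC : s ⊆ C := fun z hz =>
      isAlgebraic_algebraMap (⟨z, Algebra.subset_adjoin hz⟩ : Algebra.adjoin F s)
    have hxi : ∀ i ∈ insert j T, x i ∈ C := by
      intro i hi
      rcases Finset.mem_insert.mp hi with rfl | hi
      · exact hxj
      · simpa using sub_mem (hsC ⟨Sum.inr i, .inr ⟨i, hi, rfl⟩, rfl⟩) (hA (b i))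
    -- The `m` elements of `a` and the `|T| + 1` elements `x i` are independent, yet algebraic over
    -- a set `s` of at most `m + |T|` elements.
    have hind := (ha.sumElim_comp (hx.comp
      (Subtype.val : {i // i ∈ insert j T} → Fin m) Subtype.val_injective))
    have hindep : (AlgebraicIndependent.matroid F N).Indep _ := hind.to_subtype_range
    have hle := hindep.encard_le_eRk_of_subset (X := (AlgebraicIndependent.matroid F N).closure s) (by
      rw [AlgebraicIndependent.matroid_closure_eq]
      rintro _ ⟨i | i, rfl⟩
      · exact hxi _ i.2
      · exact hA _)
    rw [Matroid.eRk_closure_eq] at hle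
    replace hle := hle.trans (Matroid.eRk_le_encard _ _)
    have hcard : s.encard ≤ (m + T.card : ℕ) := by
      refine (Set.encard_image_le _ _).trans ((Set.encard_union_le _ _).trans ?_)
      rw [← Set.image_univ, Sum.inl_injective.injOn.encard_image, Sum.inr_injective.injOn.encard_image]
      simp
    have hcard' := (hind.injective.encard_range.trans hle).trans hcard
    simp only [ENat.card_eq_coe_fintype_card, Fintype.card_sum, Fintype.card_coe, Fintype.card_fin,
      Finset.card_insert_of_notMem hj, Nat.cast_le] at hcard'
    omega

/-- A rational function field in several variables is rational in each of them. -/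
theorem transcendental_closure {N : Type*} [Field N] (A : Subfield N) {ι : Type*} {x : ι → N}
    (hx : AlgebraicIndependent A x) (i : ι) :
    Transcendental (Subfield.closure ((A : Set N) ∪ {z | ∃ j, j ≠ i ∧ z = x j})) (x i) := by
  set B := Subfield.closure ((A : Set N) ∪ {z | ∃ j, j ≠ i ∧ z = x j})
  have h := (AlgebraicIndependent.iff_transcendental_adjoin_image i).mp hx |>.2
  rw [← IntermediateField.transcendental_adjoin_iff] at h
  have hle : B ≤ (IntermediateField.adjoin A (x '' {i}ᶜ)).toSubfield := by
    rw [Subfield.closure_le]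
    rintro z (hz | ⟨j, hj, rfl⟩)
    · exact (IntermediateField.adjoin A (x '' {i}ᶜ)).algebraMap_mem ⟨z, hz⟩
    · exact IntermediateField.subset_adjoin _ _ ⟨j, hj, rfl⟩
  exact h.of_ringHom_of_comp_eq (Subfield.inclusion hle) (RingHom.id N)
    (Subfield.inclusion hle).injective rfl

theorem closure_insert_eq_top {N : Type*} [Field N] (A : Subfield N) {ι : Type*} {x : ι → N}
    (hx : Subfield.closure ((A : Set N) ∪ Set.range x) = ⊤) (i : ι) :
    Subfield.closure (insert (x i)
      (Subfield.closure ((A : Set N) ∪ {z | ∃ j, j ≠ i ∧ z = x j}) : Set N)) = ⊤ := by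
  rw [eq_top_iff, ← hx, Subfield.closure_le]
  rintro z (hz | ⟨j, rfl⟩)
  · exact Subfield.subset_closure (.inr (Subfield.subset_closure (.inl hz)))
  · by_cases hj : j = i
    · exact Subfield.subset_closure (.inl (hj ▸ rfl))
    · exact Subfield.subset_closure (.inr (Subfield.subset_closure (.inr ⟨j, hj, rfl⟩)))

section

variable {F Ω E N K : Type u} [Field F] [Field Ω] [Field E] [Field N] [Field K] [Algebra F Ω]
  [Algebra F E] [Algebra F N] [Algebra Ω K]

/-- If `Ω ⊗ E` is a purely transcendental extension of `Ω`, where `Ω / F` is algebraic, then `E`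
and `Ω ⊗ E` have the same transcendence degree. -/
theorem exists_algebraicIndependent_of_algEquiv [Algebra.IsAlgebraic F Ω] (e : Ω ⊗[F] E ≃ₐ[Ω] K)
    {m : ℕ} {y : Fin m → K} (hy : AlgebraicIndependent Ω y) :
    ∃ t : Fin m → E, AlgebraicIndependent F t := by
  let _ : Algebra F K := ((algebraMap Ω K).comp (algebraMap F Ω)).toAlgebra
  have : IsScalarTower F Ω K := IsScalarTower.of_algebraMap_eq fun _ => rfl
  let ε : E →ₐ[F] K := (e.toAlgHom.restrictScalars F).comp Algebra.TensorProduct.includeRight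
  let _ : Algebra E K := ε.toRingHom.toAlgebra
  have : IsScalarTower F E K := IsScalarTower.of_algebraMap_eq fun a => (ε.commutes a).symm
  have halg : Algebra.IsAlgebraic E K := by
    refine ⟨fun z => ?_⟩
    obtain ⟨z, rfl⟩ := e.surjective z
    induction z with
    | zero => rw [map_zero]; exact isAlgebraic_zero
    | tmul a x =>
      have : e (a ⊗ₜ x) = algebraMap Ω K a * algebraMap E K x := by
        rw [← e.commutes, Algebra.TensorProduct.algebraMap_apply]
        change _ = e (a ⊗ₜ 1) * e (1 ⊗ₜ x)
        rw [← map_mul, Algebra.TensorProduct.tmul_mul_tmul, mul_one, one_mul]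
      rw [this]
      refine IsAlgebraic.mul ?_ (isAlgebraic_algebraMap x)
      exact ((Algebra.IsAlgebraic.isAlgebraic (R := F) a).algebraMap).tower_top E
    | add z w hz hw => rw [map_add]; exact hz.add hw
  -- Compute the degree of `K / F` through `Ω` and through `E`: both `Ω / F` and `K / E` are
  -- algebraic.
  have h1 := trdeg_add_eq F Ω (A := K)
  have h2 := trdeg_add_eq F E (A := K)
  rw [trdeg_eq_zero, zero_add] at h1
  rw [trdeg_eq_zero (R := E), add_zero, ← h1] at h2
  have hle := hy.lift_cardinalMk_le_trdeg
  obtain ⟨ι, t, ht⟩ := exists_isTranscendenceBasis' F E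
  rw [← h2, ← ht.cardinalMk_eq_trdeg] at hle
  obtain ⟨f⟩ := Cardinal.lift_mk_le'.mp hle
  exact ⟨t ∘ f, ht.1.comp f f.injective⟩

/-- If `Ω ⊗ E` is purely transcendental over `Ω`, then `Ω ⊗ (E ⊗ E)` is a domain. -/
theorem isDomain_tensor_tensor (e : Ω ⊗[F] E ≃ₐ[Ω] K) {ι : Type*} {y : ι → K}
    (hy : AlgebraicIndependent Ω y) (hytop : IntermediateField.adjoin Ω (Set.range y) = ⊤) :
    IsDomain (Ω ⊗[F] (E ⊗[F] E)) := by
  have h1 : IsDomain (K ⊗[Ω] K) := isDomain_tensor_of_adjoin_eq_top hy hytop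
  have h2 : IsDomain ((Ω ⊗[F] E) ⊗[Ω] (Ω ⊗[F] E)) :=
    (Algebra.TensorProduct.congr e e).toMulEquiv.isDomain _
  have h3 : IsDomain ((Ω ⊗[F] E) ⊗[F] E) :=
    (Algebra.TensorProduct.cancelBaseChange F Ω Ω (Ω ⊗[F] E) E).symm.toMulEquiv.isDomain _
  exact (Algebra.TensorProduct.assoc F F F Ω E E).symm.toMulEquiv.isDomain _

theorem isDomain_tensor_self (e : Ω ⊗[F] E ≃ₐ[Ω] K) {ι : Type*} {y : ι → K}
    (hy : AlgebraicIndependent Ω y) (hytop : IntermediateField.adjoin Ω (Set.range y) = ⊤) :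
    IsDomain (E ⊗[F] E) := by
  have := isDomain_tensor_tensor e hy hytop
  exact (Algebra.TensorProduct.includeRight_injective (algebraMap F Ω).injective :
    Function.Injective (Algebra.TensorProduct.includeRight : E ⊗[F] E →ₐ[F] Ω ⊗[F] (E ⊗[F] E))).isDomain
      Algebra.TensorProduct.includeRight.toRingHom

/-- Base change makes `1 ⊗ t` independent over `E` in `E ⊗ E`, and the injection into `N` preserves
this. It supplies the family to which generators are compared. -/
theorem algebraicIndependent_fieldRange (ι₁ ι₂ : E →ₐ[F] N)
    (hinj : Function.Injective (Algebra.TensorProduct.productMap ι₁ ι₂)) {ι : Type*} {t : ι → E}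
    (ht : AlgebraicIndependent F t) : AlgebraicIndependent ι₁.fieldRange (ι₂ ∘ t) := by
  have h := (algebraicIndependent_one_tmul (A := E) ht).ringHom_of_comp_eq
    (S := ι₁.fieldRange) ι₁.rangeRestrict.toRingHom
    (Algebra.TensorProduct.productMap ι₁ ι₂) ι₁.rangeRestrict_surjective hinj (by
      ext x
      simp; rfl)
  convert h using 1
  ext i
  simp

/-- The two systems of generators of `N = Frac (E ⊗ E)` over the two copies of `E`, in general
position. -/
theorem exists_independent_generators [IsGalois F Ω] [IsAlgClosed Ω] (ι₁ ι₂ : E →ₐ[F] N)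
    (hinj : Function.Injective (Algebra.TensorProduct.productMap ι₁ ι₂))
    (hdiv : ∀ z, ∃ p q, z = Algebra.TensorProduct.productMap ι₁ ι₂ p /
      Algebra.TensorProduct.productMap ι₁ ι₂ q)
    (e : Ω ⊗[F] E ≃ₐ[Ω] K) {m : ℕ} {y : Fin m → K} (hy : AlgebraicIndependent Ω y)
    (hytop : IntermediateField.adjoin Ω (Set.range y) = ⊤) (w : Fin (m + 1) → K)
    (hw : 1 ∈ Submodule.span Ω (Set.range w))
    (hwtop : IntermediateField.adjoin Ω (Set.range w) = ⊤)
    (d : Gal(Ω/F) → K) (hd : ∀ σ, d σ ≠ 0)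
    (hdw : ∀ σ x, x ∈ Submodule.span Ω (Set.range w) ↔
      d σ * e (galoisAction F Ω E σ (e.symm x)) ∈ Submodule.span Ω (Set.range w)) :
    ∃ x v : Fin m → N, AlgebraicIndependent F (Sum.elim x v) ∧
      (IntermediateField.adjoin F (Set.range ι₁ ∪ Set.range x) = ⊤ ∧
        AlgebraicIndependent ι₁.fieldRange x) ∧
      (IntermediateField.adjoin F (Set.range ι₂ ∪ Set.range v) = ⊤ ∧
        AlgebraicIndependent ι₂.fieldRange v) := by
  have := isDomain_tensor_tensor e hy hytop
  let φ := Algebra.TensorProduct.productMap ι₁ ι₂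
  let _ : Algebra (E ⊗[F] E) N := φ.toRingHom.toAlgebra
  have : IsScalarTower F (E ⊗[F] E) N :=
    IsScalarTower.of_algebraMap_eq fun a => (φ.commutes a).symm
  have : FaithfulSMul (E ⊗[F] E) N := (faithfulSMul_iff_algebraMap_injective _ _).mpr hinj
  have : IsFractionRing (E ⊗[F] E) N := IsFractionRing.of_field _ _ hdiv
  have hdom : IsDomain (Ω ⊗[F] N) := isDomain_tensor_fractionRing (R := E ⊗[F] E)
  have hgen : IntermediateField.adjoin F (Set.range ι₁ ∪ Set.range ι₂) = ⊤ := by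
    set A := IntermediateField.adjoin F (Set.range ι₁ ∪ Set.range ι₂)
    have hφ : ∀ p, φ p ∈ A := by
      intro p
      induction p with
      | zero => rw [map_zero]; exact zero_mem _
      | tmul a b =>
        exact mul_mem (IntermediateField.subset_adjoin _ _ (.inl ⟨a, rfl⟩))
          (IntermediateField.subset_adjoin _ _ (.inr ⟨b, rfl⟩))
      | add p q hp hq => rw [map_add]; exact add_mem hp hq
    rw [eq_top_iff]
    rintro z -
    obtain ⟨p, q, rfl⟩ := hdiv z
    exact div_mem (hφ p) (hφ q)
  have hinj' : Function.Injective (Algebra.TensorProduct.productMap ι₂ ι₁) := by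
    have : Algebra.TensorProduct.productMap ι₂ ι₁ =
        φ.comp (Algebra.TensorProduct.comm F E E).toAlgHom := by
      ext <;> simp [φ]
    rw [this]
    exact hinj.comp (Algebra.TensorProduct.comm F E E).injective
  obtain ⟨t, ht⟩ := exists_algebraicIndependent_of_algEquiv e hy
  have hmain : ∀ j₁ j₂ : E →ₐ[F] N,
      Function.Injective (Algebra.TensorProduct.productMap j₁ j₂) →
      IntermediateField.adjoin F (Set.range j₁ ∪ Set.range j₂) = ⊤ →
      (∃ u : Fin m → N, IntermediateField.adjoin F (Set.range j₁ ∪ Set.range u) = ⊤) ∧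
      ∀ u : Fin m → N, IntermediateField.adjoin F (Set.range j₁ ∪ Set.range u) = ⊤ →
        AlgebraicIndependent j₁.fieldRange u := by
    intro j₁ j₂ hj hgen
    refine ⟨exists_generators j₁ j₂ hgen e w hw hwtop d hd hdw, fun u hu => ?_⟩
    refine algebraicIndependent_of_adjoin_eq_top ?_ (algebraicIndependent_fieldRange j₁ j₂ hj ht)
    rw [← IntermediateField.restrictScalars_eq_top_iff (K := F), eq_top_iff, ← hu,
      IntermediateField.adjoin_le_iff]
    rintro z (⟨z, rfl⟩ | hz)
    · exact (IntermediateField.adjoin j₁.fieldRange (Set.range u)).algebraMap_mem ⟨_, z, rfl⟩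
    · exact IntermediateField.subset_adjoin j₁.fieldRange (Set.range u) hz
  obtain ⟨⟨u, hu⟩, hind⟩ := hmain ι₁ ι₂ hinj hgen
  obtain ⟨⟨v, hv⟩, hind'⟩ := hmain ι₂ ι₁ hinj' (by rwa [Set.union_comm])
  have ht' : AlgebraicIndependent F (ι₁.rangeRestrict ∘ t) :=
    ht.map' (f := ι₁.rangeRestrict) ι₁.rangeRestrict.toRingHom.injective
  have hvF : AlgebraicIndependent F v :=
    (hind' v hv).restrictScalars (algebraMap F ι₂.fieldRange).injective
  -- Only the first system is moved, by elements of the first copy of `E`, so it still generates `N`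
  -- over that copy.
  obtain ⟨b, hb⟩ := exists_shift_algebraicIndependent ι₁.fieldRange ht' (hind u hu) hvF
  have hx : IntermediateField.adjoin F (Set.range ι₁ ∪ Set.range fun i => u i + b i) = ⊤ := by
    rw [eq_top_iff, ← hu, IntermediateField.adjoin_le_iff]
    rintro z (hz | ⟨i, rfl⟩)
    · exact IntermediateField.subset_adjoin _ _ (.inl hz)
    · have h1 := IntermediateField.subset_adjoin F
        (Set.range ι₁ ∪ Set.range fun i => u i + b i) (.inr ⟨i, rfl⟩)
      have h2 := IntermediateField.subset_adjoin F
        (Set.range ι₁ ∪ Set.range fun i => u i + b i) (.inl (b i).2)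
      simpa using sub_mem h1 h2
  refine ⟨fun i => u i + b i, v, ?_, ⟨hx, hind _ hx⟩, hv, hind' v hv⟩
  convert hb.comp _ (Equiv.sumComm (Fin m) (Fin m)).injective using 1
  ext (i | i) <;> rfl

end

end Transcendence

end SelfProduct

namespace SelfProduct

/-! ### Affine coordinates and the Galois action on them. -/

section Coordinates

attribute [local instance] MvPolynomial.gradedAlgebra

open MvPolynomial
open scoped TensorProduct

variable {Ω K : Type u} [Field Ω] [Field K] [Algebra Ω K] {m : ℕ}

section

variable (ι M : Type*) [Field M] (Q : Type*) [Field Q] [Algebra M Q]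
  [Algebra (MvPolynomial ι M) Q] [IsScalarTower M (MvPolynomial ι M) Q]
  [IsFractionRing (MvPolynomial ι M) Q]

theorem adjoin_algebraMap_X :
    IntermediateField.adjoin M (Set.range fun i : ι => algebraMap (MvPolynomial ι M) Q (X i)) =
      ⊤ := by
  set A := IntermediateField.adjoin M (Set.range fun i : ι => algebraMap (MvPolynomial ι M) Q (X i))
  have hA : ∀ p : MvPolynomial ι M, algebraMap _ Q p ∈ A := by
    intro p
    induction p using MvPolynomial.induction_on with
    | C a =>
      rw [← algebraMap_eq, ← IsScalarTower.algebraMap_apply]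
      exact A.algebraMap_mem a
    | add p q hp hq => rw [map_add]; exact add_mem hp hq
    | mul_X p i hp =>
      rw [map_mul]
      exact mul_mem hp (IntermediateField.subset_adjoin _ _ ⟨i, rfl⟩)
  rw [eq_top_iff]
  rintro z -
  obtain ⟨p, q, -, rfl⟩ := IsFractionRing.div_surjective (A := MvPolynomial ι M) z
  exact div_mem (hA p) (hA q)

theorem algebraicIndependent_algebraMap_X :
    AlgebraicIndependent M fun i : ι => algebraMap (MvPolynomial ι M) Q (X i) :=
  (MvPolynomial.algebraicIndependent_X ι M).map' (f := IsScalarTower.toAlgHom M _ _)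
    (IsFractionRing.injective _ _)

end

/-- The dehomogenised coordinates are algebraically independent. -/
theorem algebraicIndependent_X_div (m : ℕ) (M Q : Type u) [Field M] [Field Q] [Algebra M Q]
    [Algebra (MvPolynomial (Fin (m + 1)) M) Q] [IsScalarTower M (MvPolynomial (Fin (m + 1)) M) Q]
    [IsFractionRing (MvPolynomial (Fin (m + 1)) M) Q] :
    AlgebraicIndependent M fun i : Fin m => algebraMap (MvPolynomial (Fin (m + 1)) M) Q
        (X i.succ) / algebraMap (MvPolynomial (Fin (m + 1)) M) Q (X 0) := by
  let x : Fin (m + 1) → Q := fun i => algebraMap (MvPolynomial (Fin (m + 1)) M) Q (X i)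
  have hx0 : x 0 ≠ 0 := by simp [x]
  -- Together with `x 0` the ratios generate the field; as `m + 1` generators of a field of
  -- transcendence degree `m + 1`, they are independent.
  let z : Fin (m + 1) → Q := Fin.cons (x 0) fun i => x i.succ / x 0
  have hz : IntermediateField.adjoin M (Set.range z) = ⊤ := by
    rw [eq_top_iff, ← adjoin_algebraMap_X (Fin (m + 1)) M Q, IntermediateField.adjoin_le_iff]
    rintro _ ⟨i, rfl⟩
    have h0 : x 0 ∈ IntermediateField.adjoin M (Set.range z) :=
      IntermediateField.subset_adjoin M (Set.range z) ⟨0, rfl⟩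
    obtain rfl | ⟨i, rfl⟩ := Fin.eq_zero_or_eq_succ i
    · exact h0
    · have h := mul_mem (IntermediateField.subset_adjoin M (Set.range z) ⟨i.succ, rfl⟩) h0
      have hz : z i.succ * x 0 = x i.succ := by
        simp only [z, Fin.cons_succ]
        exact div_mul_cancel₀ _ hx0
      rwa [hz] at h
  have hind := algebraicIndependent_of_adjoin_eq_top hz (algebraicIndependent_algebraMap_X _ M Q)
  have hc : z ∘ Fin.succ = fun i : Fin m => x i.succ / x 0 := by
    funext i
    simp only [z, Function.comp_apply, Fin.cons_succ]
  have h := hind.comp Fin.succ (Fin.succ_injective m)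
  rw [hc] at h
  simp only [x] at h
  exact h

theorem aeval_mul_of_isHomogeneous {R A ι : Type*} [CommRing R] [CommRing A] [Algebra R A]
    [Fintype ι] {G : MvPolynomial ι R} {n : ℕ} (hG : G.IsHomogeneous n) (x : ι → A) (a : A) :
    aeval (fun i => x i * a) G = aeval x G * a ^ n := by
  rw [aeval_def, aeval_def, eval₂_eq', eval₂_eq', Finset.sum_mul]
  refine Finset.sum_congr rfl fun d hd => ?_
  have hdn : ∑ i, d i = n := by
    rw [← hG (mem_support_iff.mp hd), Finsupp.weight_apply,
      Finsupp.sum_fintype _ _ (by simp)]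
    simp
  simp only [mul_pow, Finset.prod_mul_distrib, Finset.prod_pow_eq_pow_sum, hdn, mul_assoc]

/-- Affine coordinates in the function field of projective space. -/
theorem exists_affine_coordinates (θ : K →+* FractionRing (MvPolynomial (Fin (m + 1)) Ω))
    (hθ : Set.range θ = homLoc ⊥) (hθΩ : ∀ a, θ (algebraMap Ω K a) = algebraMap _ _ (C a : MvPolynomial (Fin (m + 1)) Ω)) :
    ∃ w : Fin (m + 1) → K, w 0 = 1 ∧
      (∀ x, x ∈ Submodule.span Ω (Set.range w) ↔ θ x ∈ linSys (X 0) 1) ∧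
      IntermediateField.adjoin Ω (Set.range w) = ⊤ ∧
      AlgebraicIndependent Ω (fun i : Fin m => w i.succ) := by
  have hX0 : algebraMap (MvPolynomial (Fin (m + 1)) Ω)
      (FractionRing (MvPolynomial (Fin (m + 1)) Ω)) (X 0) ≠ 0 :=
    algebraMap_fractionRing_ne_zero (X_ne_zero _)
  have hex : ∀ i, ∃ z : K, θ z = algebraMap (MvPolynomial (Fin (m + 1)) Ω) _ (X i) /
      algebraMap (MvPolynomial (Fin (m + 1)) Ω) _ (X 0) := by
    intro i
    rw [← Set.mem_range, hθ]
    exact ⟨1, X i, X 0, isHomogeneous_X Ω i, isHomogeneous_X Ω 0, by simp, rfl⟩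
  choose w hw using hex
  let Θ : K →ₐ[Ω] FractionRing (MvPolynomial (Fin (m + 1)) Ω) :=
    { θ with commutes' := fun a => (hθΩ a).trans (by
        rw [← algebraMap_eq, ← IsScalarTower.algebraMap_apply]) }
  have hsum : ∀ c : Fin (m + 1) → Ω, θ (∑ i, c i • w i) =
      algebraMap (MvPolynomial (Fin (m + 1)) Ω) _ (∑ i, c i • X i) /
        algebraMap (MvPolynomial (Fin (m + 1)) Ω) _ (X 0) := by
    intro c
    rw [map_sum, map_sum, Finset.sum_div]
    refine Finset.sum_congr rfl fun i _ => ?_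
    rw [Algebra.smul_def, map_mul, hθΩ, hw, smul_eq_C_mul, map_mul, mul_div_assoc]
  refine ⟨w, θ.injective (by rw [hw, map_one, div_self hX0]), fun x => ?_, ?_, ?_⟩
  · rw [Submodule.mem_span_range_iff_exists_fun]
    constructor
    · rintro ⟨c, rfl⟩
      refine ⟨∑ i, c i • X i, IsHomogeneous.sum _ _ _ fun i _ => ?_, hsum c⟩
      rw [smul_eq_C_mul]
      exact (isHomogeneous_X Ω i).C_mul _
    · rintro ⟨G, hG, h⟩
      rw [← mem_homogeneousSubmodule, homogeneousSubmodule_one_eq_span_X,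
        Submodule.mem_span_range_iff_exists_fun] at hG
      obtain ⟨c, rfl⟩ := hG
      exact ⟨c, θ.injective (by rw [hsum, h])⟩
  · set A := IntermediateField.adjoin Ω (Set.range w)
    have hA : ∀ (n : ℕ) (G : MvPolynomial (Fin (m + 1)) Ω), G.IsHomogeneous n → ∃ z ∈ A,
        θ z = algebraMap _ _ G / algebraMap (MvPolynomial (Fin (m + 1)) Ω) _ (X 0) ^ n := by
      intro n G hG
      refine ⟨aeval w G, ?_, ?_⟩
      · exact (Algebra.adjoin_le_iff.mpr (IntermediateField.subset_adjoin Ω (Set.range w)) :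
          Algebra.adjoin Ω (Set.range w) ≤ A.toSubalgebra)
            (Algebra.adjoin_range_eq_range_aeval Ω w ▸ ⟨G, rfl⟩)
      · change Θ (aeval w G) = _
        rw [eq_div_iff (pow_ne_zero _ hX0)]
        have h1 : ∀ i, Θ (w i) * algebraMap (MvPolynomial (Fin (m + 1)) Ω) _ (X 0) =
            algebraMap (MvPolynomial (Fin (m + 1)) Ω) _ (X i) := fun i => by
          change θ (w i) * _ = _
          rw [hw, div_mul_cancel₀ _ hX0]
        have h2 := DFunLike.congr_fun (comp_aeval (f := w) Θ) G
        have h3 := DFunLike.congr_fun (comp_aeval (f := X) (IsScalarTower.toAlgHom Ω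
          (MvPolynomial (Fin (m + 1)) Ω) (FractionRing (MvPolynomial (Fin (m + 1)) Ω)))) G
        rw [AlgHom.comp_apply] at h2 h3
        rw [h2, ← aeval_mul_of_isHomogeneous hG]
        simp only [h1]
        refine h3.symm.trans ?_
        rw [aeval_X_left_apply, IsScalarTower.toAlgHom_apply]
    rw [eq_top_iff]
    rintro x -
    obtain ⟨n, G, H, hG, hH, hH0, h⟩ := hθ ▸ Set.mem_range_self (f := θ) x
    obtain ⟨g, hg, hg'⟩ := hA n G hG
    obtain ⟨h', hh, hh'⟩ := hA n H hH
    have : x = g / h' := θ.injective (by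
      rw [h, map_div₀, hg', hh', div_div_div_cancel_right₀ (pow_ne_zero _ hX0)])
    rw [this]
    exact div_mem hg hh
  · have := algebraicIndependent_X_div m Ω (FractionRing (MvPolynomial (Fin (m + 1)) Ω))
    refine AlgebraicIndependent.of_comp Θ ?_
    have hc : (Θ ∘ fun i : Fin m => w i.succ) = _ := funext fun i => hw i.succ
    rw [hc]
    exact this

variable {F E N : Type u} [Field F] [Field E] [Field N] [Algebra F Ω] [Algebra F E] [Algebra F N]

/-- Affine coordinates on which the Galois group acts linearly up to a common factor, when it
permutes the local rings of projective space. -/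
theorem exists_affine_coordinates_galois (e : Ω ⊗[F] E ≃ₐ[Ω] K)
    (θ : K →+* FractionRing (MvPolynomial (Fin (m + 1)) Ω)) (hθ : Set.range θ = homLoc ⊥)
    (hθΩ : ∀ a, θ (algebraMap Ω K a) = algebraMap _ _ (C a : MvPolynomial (Fin (m + 1)) Ω))
    (hperm : ∀ (σ : Gal(Ω/F)) (y : ProjectiveSpectrum (homogeneousSubmodule (Fin (m + 1)) Ω)),
      ∃ y' : ProjectiveSpectrum (homogeneousSubmodule (Fin (m + 1)) Ω), ∀ x,
        θ x ∈ homLoc y.asHomogeneousIdeal.toIdeal ↔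
          θ (e (galoisAction F Ω E σ (e.symm x))) ∈ homLoc y'.asHomogeneousIdeal.toIdeal) :
    ∃ w : Fin (m + 1) → K, w 0 = 1 ∧
      IntermediateField.adjoin Ω (Set.range w) = ⊤ ∧
      AlgebraicIndependent Ω (fun i : Fin m => w i.succ) ∧
      ∃ d : Gal(Ω/F) → K, (∀ σ, d σ ≠ 0) ∧ ∀ σ x, x ∈ Submodule.span Ω (Set.range w) ↔
        d σ * e (galoisAction F Ω E σ (e.symm x)) ∈ Submodule.span Ω (Set.range w) := by
  obtain ⟨w, hw0, hw, hwtop, hind⟩ := exists_affine_coordinates θ hθ hθΩ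
  refine ⟨w, hw0, hwtop, hind, ?_⟩
  -- The divisor argument needs two variables. For `m = 0` the field is `Ω`, equal to the span, and
  -- `d = 1` works.
  obtain rfl | hm := Nat.eq_zero_or_pos m
  · have htop : ∀ x, x ∈ Submodule.span Ω (Set.range w) := by
      intro x
      have hx : x ∈ IntermediateField.adjoin Ω (Set.range w) := hwtop ▸ IntermediateField.mem_top
      have hbot : IntermediateField.adjoin Ω (Set.range w) ≤ ⊥ := by
        rw [IntermediateField.adjoin_le_iff]
        rintro _ ⟨i, rfl⟩
        obtain rfl : i = 0 := Fin.ext (by omega)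
        rw [hw0]
        exact one_mem _
      obtain ⟨a, rfl⟩ := IntermediateField.mem_bot.mp (hbot hx)
      rw [Algebra.algebraMap_eq_smul_one, ← hw0]
      exact Submodule.smul_mem _ _ (Submodule.subset_span ⟨0, rfl⟩)
    exact ⟨fun _ => 1, fun _ => one_ne_zero, fun σ x => iff_of_true (htop _) (htop _)⟩
  · have : Nontrivial (Fin (m + 1)) := Fin.nontrivial_iff_two_le.mpr (by omega)
    have hex : ∀ σ : Gal(Ω/F), ∃ d : K, d ≠ 0 ∧ ∀ x, θ x ∈ linSys (X 0) 1 ↔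
        θ (d * e (galoisAction F Ω E σ (e.symm x))) ∈ linSys (X 0) 1 := by
      intro σ
      refine exists_smul_linSys θ hθ
        ((e.symm.toRingEquiv.trans (galoisAction F Ω E σ)).trans e.toRingEquiv)
        (σ : Ω →+* Ω) ?_ (hperm σ) ?_ 0
      · intro x a hx
        rw [← hθΩ] at hx
        rw [θ.injective hx, ← hθΩ]
        congr 1
        change e (galoisAction F Ω E σ (e.symm (algebraMap Ω K a))) = _
        rw [e.symm.commutes, Algebra.TensorProduct.algebraMap_apply, galoisAction_tmul]
        exact e.commutes (σ a)
      -- The preimage of a local ring under `σ` is its image under `σ⁻¹`.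
      · intro y'
        obtain ⟨y, hy⟩ := hperm σ⁻¹ y'
        refine ⟨y, fun x => ?_⟩
        have := hy (e (galoisAction F Ω E σ (e.symm x)))
        rw [e.symm_apply_apply, ← RingAut.mul_apply, ← map_mul, inv_mul_cancel, map_one,
          RingAut.one_apply, e.apply_symm_apply] at this
        exact this.symm
    choose d hd hdσ using hex
    exact ⟨d, hd, fun σ x => by rw [hw, hw]; exact hdσ σ x⟩

/-- The function field of `X ×_S X` for a `ℙ^m`-fibration `X ⟶ S`: generators over the two copies
of the function field of `X`. -/
theorem exists_independent_generators_of_perm [IsGalois F Ω] [IsAlgClosed Ω] (ι₁ ι₂ : E →ₐ[F] N)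
    (hinj : Function.Injective (Algebra.TensorProduct.productMap ι₁ ι₂))
    (hdiv : ∀ z, ∃ p q, z = Algebra.TensorProduct.productMap ι₁ ι₂ p /
      Algebra.TensorProduct.productMap ι₁ ι₂ q) (e : Ω ⊗[F] E ≃ₐ[Ω] K)
    (θ : K →+* FractionRing (MvPolynomial (Fin (m + 1)) Ω)) (hθ : Set.range θ = homLoc ⊥)
    (hθΩ : ∀ a, θ (algebraMap Ω K a) = algebraMap _ _ (C a : MvPolynomial (Fin (m + 1)) Ω))
    (hperm : ∀ (σ : Gal(Ω/F)) (y : ProjectiveSpectrum (homogeneousSubmodule (Fin (m + 1)) Ω)),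
      ∃ y' : ProjectiveSpectrum (homogeneousSubmodule (Fin (m + 1)) Ω), ∀ x,
        θ x ∈ homLoc y.asHomogeneousIdeal.toIdeal ↔
          θ (e (galoisAction F Ω E σ (e.symm x))) ∈ homLoc y'.asHomogeneousIdeal.toIdeal) :
    ∃ x v : Fin m → N, AlgebraicIndependent F (Sum.elim x v) ∧
      (IntermediateField.adjoin F (Set.range ι₁ ∪ Set.range x) = ⊤ ∧
        AlgebraicIndependent ι₁.fieldRange x) ∧
      (IntermediateField.adjoin F (Set.range ι₂ ∪ Set.range v) = ⊤ ∧
        AlgebraicIndependent ι₂.fieldRange v) := by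
  obtain ⟨w, hw0, hwtop, hind, d, hd, hdw⟩ := exists_affine_coordinates_galois e θ hθ hθΩ hperm
  refine exists_independent_generators ι₁ ι₂ hinj hdiv e hind ?_ w
    (hw0 ▸ Submodule.subset_span ⟨0, rfl⟩) hwtop d hd hdw
  rw [eq_top_iff, ← hwtop, IntermediateField.adjoin_le_iff]
  rintro _ ⟨i, rfl⟩
  obtain rfl | ⟨i, rfl⟩ := Fin.eq_zero_or_eq_succ i
  · rw [hw0]
    exact one_mem _
  · exact IntermediateField.subset_adjoin _ _ ⟨i, rfl⟩

theorem isDomain_tensor_of_projective (e : Ω ⊗[F] E ≃ₐ[Ω] K)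
    (θ : K →+* FractionRing (MvPolynomial (Fin (m + 1)) Ω)) (hθ : Set.range θ = homLoc ⊥)
    (hθΩ : ∀ a, θ (algebraMap Ω K a) = algebraMap _ _ (C a : MvPolynomial (Fin (m + 1)) Ω)) :
    IsDomain (E ⊗[F] E) := by
  obtain ⟨w, hw0, -, hwtop, hind⟩ := exists_affine_coordinates θ hθ hθΩ
  refine isDomain_tensor_self e hind ?_
  rw [eq_top_iff, ← hwtop, IntermediateField.adjoin_le_iff]
  rintro _ ⟨i, rfl⟩
  obtain rfl | ⟨i, rfl⟩ := Fin.eq_zero_or_eq_succ i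
  · rw [hw0]
    exact one_mem _
  · exact IntermediateField.subset_adjoin _ _ ⟨i, rfl⟩

end Coordinates

end SelfProduct

namespace SelfProduct

/-! ### Stalks of `Proj` identified with the rings of homogeneous fractions. -/

section ProjectiveStalks

attribute [local instance] MvPolynomial.gradedAlgebra

open MvPolynomial

variable {ι : Type} {M : Type u} [Field M]

/-- The degree zero part of a localization at a homogeneous prime, inside the fraction field. -/
noncomputable def atPrimeToFrac (𝔭 : Ideal (MvPolynomial ι M)) [𝔭.IsPrime] :
    HomogeneousLocalization.AtPrime (homogeneousSubmodule ι M) 𝔭 →+*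
      FractionRing (MvPolynomial ι M) :=
  (IsLocalization.lift (M := 𝔭.primeCompl) (S := Localization 𝔭.primeCompl)
    (g := algebraMap (MvPolynomial ι M) (FractionRing (MvPolynomial ι M)))
    fun y => (algebraMap_fractionRing_ne_zero (ne_zero_of_notMem y.2)).isUnit).comp
    (algebraMap (HomogeneousLocalization.AtPrime (homogeneousSubmodule ι M) 𝔭)
      (Localization 𝔭.primeCompl))

theorem atPrimeToFrac_mk (𝔭 : Ideal (MvPolynomial ι M)) [𝔭.IsPrime]
    (c : HomogeneousLocalization.NumDenSameDeg (homogeneousSubmodule ι M) 𝔭.primeCompl) :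
    atPrimeToFrac 𝔭 (HomogeneousLocalization.mk c) =
      algebraMap (MvPolynomial ι M) _ c.num / algebraMap (MvPolynomial ι M) _ c.den := by
  rw [atPrimeToFrac, RingHom.comp_apply, HomogeneousLocalization.algebraMap_apply,
    HomogeneousLocalization.val_mk, Localization.mk_eq_mk', IsLocalization.lift_mk'_spec,
    mul_div_cancel₀]
  exact algebraMap_fractionRing_ne_zero (ne_zero_of_notMem c.den_mem)

theorem atPrimeToFrac_injective (𝔭 : Ideal (MvPolynomial ι M)) [𝔭.IsPrime] :
    Function.Injective (atPrimeToFrac 𝔭) := by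
  rw [atPrimeToFrac, RingHom.coe_comp]
  refine Function.Injective.comp ?_ (HomogeneousLocalization.val_injective _)
  rw [IsLocalization.lift_injective_iff]
  intro x y
  rw [(IsFractionRing.injective (MvPolynomial ι M) (FractionRing (MvPolynomial ι M))).eq_iff,
    (IsLocalization.injective (Localization 𝔭.primeCompl)
      𝔭.primeCompl_le_nonZeroDivisors).eq_iff]

theorem range_atPrimeToFrac (𝔭 : Ideal (MvPolynomial ι M)) [𝔭.IsPrime] :
    Set.range (atPrimeToFrac 𝔭) = homLoc 𝔭 := by
  ext q
  constructor
  · rintro ⟨z, rfl⟩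
    obtain ⟨c, rfl⟩ := HomogeneousLocalization.mk_surjective z
    exact ⟨c.deg, c.num, c.den, c.num.2, c.den.2, c.den_mem, atPrimeToFrac_mk _ _⟩
  · rintro ⟨n, G, H, hG, hH, hH', rfl⟩
    exact ⟨.mk ⟨n, ⟨G, hG⟩, ⟨H, hH⟩, hH'⟩, atPrimeToFrac_mk _ _⟩

/-- The homogeneous prime ideal of a point of projective space. -/
noncomputable def pointIdeal (x : Proj (homogeneousSubmodule ι M)) : Ideal (MvPolynomial ι M) :=
  (ProjectiveSpectrum.asHomogeneousIdeal (𝒜 := homogeneousSubmodule ι M) x).toIdeal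

instance (x : Proj (homogeneousSubmodule ι M)) : (pointIdeal x).IsPrime :=
  ProjectiveSpectrum.isPrime (𝒜 := homogeneousSubmodule ι M) x

/-- The local rings of projective space, inside the fraction field of the polynomial ring. -/
noncomputable def stalkToFrac (x : Proj (homogeneousSubmodule ι M)) :
    (Proj (homogeneousSubmodule ι M)).presheaf.stalk x →+* FractionRing (MvPolynomial ι M) :=
  (atPrimeToFrac (pointIdeal x)).comp
    (Proj.stalkIso (homogeneousSubmodule ι M) x).commRingCatIsoToRingEquiv.toRingHom

theorem stalkToFrac_injective (x : Proj (homogeneousSubmodule ι M)) :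
    Function.Injective (stalkToFrac x) :=
  (atPrimeToFrac_injective (pointIdeal x)).comp
    (Proj.stalkIso (homogeneousSubmodule ι M) x).commRingCatIsoToRingEquiv.injective

theorem range_stalkToFrac (x : Proj (homogeneousSubmodule ι M)) :
    Set.range (stalkToFrac x) = homLoc (pointIdeal x) := by
  rw [← range_atPrimeToFrac]
  exact (Proj.stalkIso (homogeneousSubmodule ι M)
    x).commRingCatIsoToRingEquiv.surjective.range_comp (atPrimeToFrac (pointIdeal x))

/-- A section is locally a single fraction, so its value in the fraction field is locally
independent of the point. Compatibility with specialization follows. -/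
theorem exists_stalkToFrac_germ (x : Proj (homogeneousSubmodule ι M))
    (U : (Proj (homogeneousSubmodule ι M)).Opens) (hx : x ∈ U)
    (s : Γ(Proj (homogeneousSubmodule ι M), U)) :
    ∃ (V : (Proj (homogeneousSubmodule ι M)).Opens) (_ : x ∈ V) (q : FractionRing (MvPolynomial ι M)),
      ∀ (y : Proj (homogeneousSubmodule ι M)) (hyU : y ∈ U), y ∈ V → 
      stalkToFrac y ((Proj (homogeneousSubmodule ι M)).presheaf.germ U y hyU s) = q := by
  obtain ⟨V, hV, i, d, r, t, ht, hrt⟩ := s.2 ⟨x, hx⟩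
  refine ⟨V, hV, algebraMap (MvPolynomial ι M) _ r / algebraMap (MvPolynomial ι M) _ t,
    fun y hyU hyV => ?_⟩
  have h := Proj.stalkIso'_germ (homogeneousSubmodule ι M) U y hyU s
  refine (congrArg (atPrimeToFrac (pointIdeal y)) (h.trans (hrt ⟨y, hyV⟩))).trans ?_
  exact atPrimeToFrac_mk (pointIdeal y) _

theorem stalkToFrac_stalkSpecializes {x y : Proj (homogeneousSubmodule ι M)} (h : x ⤳ y)
    (z : (Proj (homogeneousSubmodule ι M)).presheaf.stalk y) :
    stalkToFrac x ((Proj (homogeneousSubmodule ι M)).presheaf.stalkSpecializes h z) =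
      stalkToFrac y z := by
  obtain ⟨U, hy, s, rfl⟩ := (Proj (homogeneousSubmodule ι M)).presheaf.exists_germ_eq z
  obtain ⟨V, hV, q, hq⟩ := exists_stalkToFrac_germ y U hy s
  rw [← CommRingCat.comp_apply, TopCat.Presheaf.germ_stalkSpecializes,
    hq y hy hV, hq x (h.mem_open U.2 hy) (h.mem_open V.2 hV)]

theorem pointIdeal_le_iff {x y : Proj (homogeneousSubmodule ι M)} :
    pointIdeal x ≤ pointIdeal y ↔ x ⤳ y := by
  rw [specializes_iff_mem_closure]
  exact ProjectiveSpectrum.le_iff_mem_closure (homogeneousSubmodule ι M) x y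

theorem exists_pointIdeal_eq_bot [Nonempty ι] :
    ∃ x : Proj (homogeneousSubmodule ι M), pointIdeal x = ⊥ := by
  refine ⟨(⟨⊥, ?_, ?_⟩ : ProjectiveSpectrum (homogeneousSubmodule ι M)), rfl⟩
  · exact Ideal.isPrime_bot
  · intro h
    obtain ⟨i⟩ := ‹Nonempty ι›
    have hX : (X i : MvPolynomial ι M) ∈ HomogeneousIdeal.irrelevant (homogeneousSubmodule ι M) := by
      rw [HomogeneousIdeal.mem_irrelevant_iff]
      exact GradedRing.proj_apply (homogeneousSubmodule ι M) 0 (X i : MvPolynomial ι M) ▸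
        DirectSum.decompose_of_mem_ne _ (isHomogeneous_X M i) one_ne_zero
    exact X_ne_zero i (h hX)

/-- The zero ideal is a dense point and every stalk embeds in a field. -/
instance [Nonempty ι] : IsIntegral (Proj (homogeneousSubmodule ι M)) := by
  obtain ⟨η, hη⟩ := exists_pointIdeal_eq_bot (ι := ι) (M := M)
  have : IrreducibleSpace (Proj (homogeneousSubmodule ι M)) := by
    have huniv : closure {η} = Set.univ := Set.eq_univ_of_forall fun y => by
      rw [← specializes_iff_mem_closure, ← pointIdeal_le_iff, hη]
      exact bot_le
    have := isIrreducible_singleton (x := η).closure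
    rw [huniv] at this
    exact (irreducibleSpace_def _).mpr this
  have (x : Proj (homogeneousSubmodule ι M)) :
      _root_.IsReduced ((Proj (homogeneousSubmodule ι M)).presheaf.stalk x) :=
    isReduced_of_injective _ (stalkToFrac_injective x)
  have := isReduced_of_isReduced_stalk (Proj (homogeneousSubmodule ι M))
  exact isIntegral_of_irreducibleSpace_of_isReduced _

theorem pointIdeal_genericPoint [Nonempty ι] :
    pointIdeal (genericPoint (Proj (homogeneousSubmodule ι M))) = ⊥ := by
  obtain ⟨η, hη⟩ := exists_pointIdeal_eq_bot (ι := ι) (M := M)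
  rw [eq_bot_iff, ← hη, pointIdeal_le_iff]
  exact genericPoint_specializes η

/-- The ring homomorphism from constants to the local ring at a point of a scheme over a ring. -/
noncomputable def constStalk {R : CommRingCat.{u}} {Y : Scheme.{u}} (p : Y ⟶ Spec R) (y : Y) :
    R ⟶ Y.presheaf.stalk y :=
  Spec.preimage (Y.fromSpecStalk y ≫ p)

theorem SpecMap_constStalk {R : CommRingCat.{u}} {Y : Scheme.{u}} (p : Y ⟶ Spec R) (y : Y) :
    Spec.map (constStalk p y) = Y.fromSpecStalk y ≫ p :=
  Spec.map_preimage _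

theorem fromSpecStalk_toSpecZero (y : Proj (homogeneousSubmodule ι M))
    (hy : y ∈ Proj.basicOpen (homogeneousSubmodule ι M) 1) :
    (Proj (homogeneousSubmodule ι M)).fromSpecStalk y ≫ Proj.toSpecZero (homogeneousSubmodule ι M) =
      Spec.map (CommRingCat.ofHom (HomogeneousLocalization.fromZeroRingHom
          (homogeneousSubmodule ι M) (Submonoid.powers 1)) ≫
        Proj.awayToSection (homogeneousSubmodule ι M) 1 ≫
        (Proj (homogeneousSubmodule ι M)).presheaf.germ _ y hy) := by
  set U := Proj.basicOpen (homogeneousSubmodule ι M) 1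
  have h1 : U.ι ≫ (Scheme.topIso _).inv ≫
      (Scheme.isoOfEq _ (Proj.basicOpen_one (homogeneousSubmodule ι M))).inv = 𝟙 _ := by
    rw [← cancel_mono U.ι]
    simp [U]
  rw [← U.fromSpecStalkOfMem_ι y hy, Proj.toSpecZero, Category.assoc, reassoc_of% h1,
    Proj.basicOpenToSpec, Category.assoc, U.fromSpecStalkOfMem_toSpecΓ_assoc, Spec.map_comp,
    Spec.map_comp, Category.assoc]

theorem stalkToFrac_constStalk (y : Proj (homogeneousSubmodule ι M)) (a : M) :
    stalkToFrac y (constStalk (Proj.toSpecZero (homogeneousSubmodule ι M) ≫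
      Spec.map (CommRingCat.ofHom (algebraMap M (homogeneousSubmodule ι M 0)))) y a) =
      algebraMap _ _ (C a : MvPolynomial ι M) := by
  have hy : y ∈ Proj.basicOpen (homogeneousSubmodule ι M) 1 := by
    rw [Proj.basicOpen_one]; trivial
  have h : constStalk (Proj.toSpecZero (homogeneousSubmodule ι M) ≫
      Spec.map (CommRingCat.ofHom (algebraMap M (homogeneousSubmodule ι M 0)))) y =
      CommRingCat.ofHom (algebraMap M (homogeneousSubmodule ι M 0)) ≫
      CommRingCat.ofHom (HomogeneousLocalization.fromZeroRingHom
          (homogeneousSubmodule ι M) (Submonoid.powers 1)) ≫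
        Proj.awayToSection (homogeneousSubmodule ι M) 1 ≫
        (Proj (homogeneousSubmodule ι M)).presheaf.germ _ y hy := by
    apply Spec.map_injective
    rw [SpecMap_constStalk, Spec.map_comp, ← fromSpecStalk_toSpecZero, Category.assoc]
  rw [h, CommRingCat.comp_apply, CommRingCat.comp_apply, CommRingCat.comp_apply]
  have h2 := Proj.stalkIso'_germ (homogeneousSubmodule ι M) _ y hy
    ((Proj.awayToSection (homogeneousSubmodule ι M) 1)
      (HomogeneousLocalization.fromZeroRingHom (homogeneousSubmodule ι M) (Submonoid.powers 1)
        (algebraMap M (homogeneousSubmodule ι M 0) a)))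
  refine (congrArg (atPrimeToFrac (pointIdeal y)) h2).trans ?_
  refine (atPrimeToFrac_mk (pointIdeal y) ⟨0, algebraMap M (homogeneousSubmodule ι M 0) a, 1, ?_⟩).trans ?_
  change algebraMap _ _ (C a : MvPolynomial ι M) /
    algebraMap _ (FractionRing (MvPolynomial ι M)) (1 : MvPolynomial ι M) = _
  rw [map_one, div_one]

end ProjectiveStalks

end SelfProduct

namespace SelfProduct

/-! ### Flat preimmersions. -/

section FlatPreimmersions

instance {Y : Scheme.{u}} (y : Y) : Flat (Y.fromSpecStalk y) := by
  obtain ⟨U, hU, hyU, -⟩ := exists_isAffineOpen_mem_and_subset (X := Y) (U := ⊤) (x := y) trivial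
  rw [← hU.fromSpecStalk_eq_fromSpecStalk hyU, IsAffineOpen.fromSpecStalk]
  have : Flat (Spec.map (Y.presheaf.germ U y hyU)) := by
    rw [Flat.SpecMap_iff]
    let x : U := ⟨y, hyU⟩
    have h := hU.isLocalization_stalk x
    let _ : Algebra Γ(Y, U) (Y.presheaf.stalk x.1) := TopCat.Presheaf.algebra_section_stalk _ x
    have h2 : Module.Flat Γ(Y, U) (Y.presheaf.stalk x.1) :=
      IsLocalization.flat _ (hU.primeIdealOf x).asIdeal.primeCompl
    exact h2
  infer_instance

/-- A flat local homomorphism is faithfully flat, hence injective; surjectivity is part of being a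
preimmersion. -/
theorem stalkMap_bijective_of_flat {T P : Scheme.{u}} (t : T ⟶ P) [IsPreimmersion t] [Flat t]
    (x : T) : Function.Bijective (t.stalkMap x) := by
  refine ⟨?_, t.stalkMap_surjective x⟩
  have h := Flat.stalkMap t x
  algebraize [(t.stalkMap x).hom]
  have : Module.FaithfullyFlat (P.presheaf.stalk (t x)) (T.presheaf.stalk x) :=
    have : IsLocalHom (algebraMap (P.presheaf.stalk (t x)) (T.presheaf.stalk x)) :=
      inferInstanceAs (IsLocalHom (t.stalkMap x).hom)
    Module.FaithfullyFlat.of_flat_of_isLocalHom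
  exact FaithfulSMul.algebraMap_injective (P.presheaf.stalk (t x)) (T.presheaf.stalk x)

/-- Stalks of `T` are stalks of `P`, so `T` is reduced; it is homeomorphic to a dense subset of an
irreducible space. -/
theorem isIntegral_of_flat_preimmersion {T P : Scheme.{u}} (t : T ⟶ P) [IsPreimmersion t] [Flat t]
    [IsDominant t] [IsIntegral P] : IsIntegral T := by
  have : IsReduced T := by
    have (x : T) : _root_.IsReduced (T.presheaf.stalk x) :=
      isReduced_of_injective (RingEquiv.ofBijective _ (stalkMap_bijective_of_flat t x)).symm
        (RingEquiv.injective _)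
    exact isReduced_of_isReduced_stalk T
  have h : IsIrreducible (Set.range t) := by
    rw [← isIrreducible_iff_closure, t.denseRange.closure_range]
    exact IrreducibleSpace.isIrreducible_univ _
  have := Subtype.irreducibleSpace h
  have : IrreducibleSpace T := by
    let g := t.isEmbedding.toHomeomorph
    exact Function.Surjective.irreducibleSpace g.symm.continuous g.symm.surjective
  exact isIntegral_of_irreducibleSpace_of_isReduced T

end FlatPreimmersions

end SelfProduct

namespace SelfProduct

/-! ### Local rings as subrings of a field, through a dominant point. -/

section StalkEvaluation

variable {Y Y' : Scheme.{u}} {K : Type u} [Field K]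

theorem apply_eq_genericPoint [IsIntegral Y] (t : Spec (.of K) ⟶ Y) [IsDominant t]
    (x : Spec (.of K)) : t x = genericPoint Y := by
  rw [← map_genericPoint t]
  exact congrArg t (Subsingleton.elim _ _)

/-- The evaluation of germs of functions at a dominant point with values in a field. -/
noncomputable def stalkEval [IsIntegral Y] (t : Spec (.of K) ⟶ Y) [IsDominant t] (y : Y) :
    Y.presheaf.stalk y ⟶ .of K :=
  Y.presheaf.stalkSpecializes
    ((specializes_of_eq (apply_eq_genericPoint t _)).trans (genericPoint_specializes y)) ≫
    Scheme.stalkClosedPointTo t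

theorem SpecMap_stalkEval [IsIntegral Y] (t : Spec (.of K) ⟶ Y) [IsDominant t] (y : Y) :
    Spec.map (stalkEval t y) ≫ Y.fromSpecStalk y = t := by
  rw [stalkEval, Spec.map_comp, Category.assoc, Scheme.SpecMap_stalkSpecializes_fromSpecStalk,
    Scheme.Spec_stalkClosedPointTo_fromSpecStalk]

/-- Uniqueness holds because `fromSpecStalk` is a monomorphism; it reduces compatibilities of
evaluations to identities of morphisms. -/
theorem eq_stalkEval [IsIntegral Y] (t : Spec (.of K) ⟶ Y) [IsDominant t] (y : Y)
    (φ : Y.presheaf.stalk y ⟶ .of K) (h : Spec.map φ ≫ Y.fromSpecStalk y = t) :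
    φ = stalkEval t y := by
  apply Spec.map_injective
  rw [← cancel_mono (Y.fromSpecStalk y), h, SpecMap_stalkEval]

theorem stalkMap_stalkEval [IsIntegral Y] [IsIntegral Y'] (t : Spec (.of K) ⟶ Y) [IsDominant t]
    (g : Y ⟶ Y') [IsDominant (t ≫ g)] (y : Y) :
    g.stalkMap y ≫ stalkEval t y = stalkEval (t ≫ g) (g y) := by
  apply eq_stalkEval
  rw [Spec.map_comp, Category.assoc, Scheme.SpecMap_stalkMap_fromSpecStalk,
    reassoc_of% SpecMap_stalkEval t y]

theorem stalkSpecializes_stalkEval [IsIntegral Y] (t : Spec (.of K) ⟶ Y) [IsDominant t] {x y : Y}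
    (h : x ⤳ y) : Y.presheaf.stalkSpecializes h ≫ stalkEval t x = stalkEval t y := by
  apply eq_stalkEval
  rw [Spec.map_comp, Category.assoc, Scheme.SpecMap_stalkSpecializes_fromSpecStalk,
    SpecMap_stalkEval]

theorem functionFieldMap_stalkEval [IsIntegral Y] [IsIntegral Y'] (t : Spec (.of K) ⟶ Y)
    [IsDominant t] (g : Y ⟶ Y') [IsDominant g] [IsDominant (t ≫ g)] :
    functionFieldMap g ≫ stalkEval t (genericPoint Y) = stalkEval (t ≫ g) (genericPoint Y') := by
  rw [functionFieldMap, Category.assoc, stalkMap_stalkEval, stalkSpecializes_stalkEval]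

theorem stalkEval_SpecMap_comp {L : Type u} [Field L] [IsIntegral Y] (t : Spec (.of K) ⟶ Y)
    [IsDominant t] (σ : CommRingCat.of K ⟶ .of L) [IsDominant (Spec.map σ ≫ t)] (y : Y) :
    stalkEval (Spec.map σ ≫ t) y = stalkEval t y ≫ σ := by
  symm
  apply eq_stalkEval
  rw [Spec.map_comp, Category.assoc, SpecMap_stalkEval]

theorem stalkEval_genericPoint_injective [IsIntegral Y] (t : Spec (.of K) ⟶ Y) [IsDominant t] :
    Function.Injective (stalkEval t (genericPoint Y)) :=
  RingHom.injective (R := Y.functionField) (stalkEval t (genericPoint Y)).hom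

theorem stalkEval_genericPoint_bijective [IsIntegral Y] (t : Spec (.of K) ⟶ Y) [IsDominant t]
    [IsPreimmersion t] : Function.Bijective (stalkEval t (genericPoint Y)) := by
  refine ⟨stalkEval_genericPoint_injective t, ?_⟩
  have h : stalkEval t (genericPoint Y) = (Y.presheaf.stalkCongr
      (.of_eq (apply_eq_genericPoint t (IsLocalRing.closedPoint K)))).inv ≫
        t.stalkMap (IsLocalRing.closedPoint K) ≫ (stalkClosedPointIso (.of K)).hom := rfl
  rw [h]
  simp only [CommRingCat.hom_comp, RingHom.coe_comp]
  exact ((ConcreteCategory.bijective_of_isIso _).surjective.comp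
    (t.stalkMap_surjective _)).comp (ConcreteCategory.bijective_of_isIso _).surjective

theorem constStalk_stalkEval [IsIntegral Y] (t : Spec (.of K) ⟶ Y) [IsDominant t] {R : CommRingCat}
    (p : Y ⟶ Spec R) (φ : R ⟶ .of K) (h : t ≫ p = Spec.map φ) (y : Y) :
    constStalk p y ≫ stalkEval t y = φ := by
  apply Spec.map_injective
  rw [Spec.map_comp, SpecMap_constStalk, reassoc_of% SpecMap_stalkEval t y, h]

/-- An automorphism `g` inducing `σ` on `K` identifies the local ring at `g y` with that at `y`.
This turns geometric automorphisms into permutations of subrings. -/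
theorem mem_range_stalkEval_iff [IsIntegral Y] (t : Spec (.of K) ⟶ Y) [IsDominant t]
    (σ : K ≃+* K) (g : Y ⟶ Y) [IsIso g]
    (h : Spec.map (CommRingCat.ofHom σ.toRingHom) ≫ t = t ≫ g) (y : Y) (z : K) :
    z ∈ Set.range (stalkEval t (g y)) ↔ σ z ∈ Set.range (stalkEval t y) := by
  have h1 : IsDominant (Spec.map (CommRingCat.ofHom σ.toRingHom) ≫ t) := by
    rw [h]; infer_instance
  have key : g.stalkMap y ≫ stalkEval t y =
      stalkEval t (g y) ≫ CommRingCat.ofHom σ.toRingHom := by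
    rw [stalkMap_stalkEval, ← stalkEval_SpecMap_comp]
    congr 1
    exact h.symm
  have key' (a) : stalkEval t y (g.stalkMap y a) = σ (stalkEval t (g y) a) :=
    congrArg (fun φ => φ.hom a) key
  constructor
  · rintro ⟨a, rfl⟩
    exact ⟨_, key' a⟩
  · rintro ⟨b, hb⟩
    obtain ⟨a, rfl⟩ := (ConcreteCategory.bijective_of_isIso (g.stalkMap y)).surjective b
    exact ⟨a, σ.injective (by rw [← key', hb])⟩

end StalkEvaluation

/-! ### The local rings of projective space inside its function field. -/

section ProjectiveEvaluation

attribute [local instance] MvPolynomial.gradedAlgebra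

open MvPolynomial

variable {m : ℕ} {Ω K : Type u} [Field Ω] [Field K]

instance : IsIntegral (projectiveSpace m Ω) :=
  inferInstanceAs (IsIntegral (Proj (homogeneousSubmodule (Fin (m + 1)) Ω)))

theorem exists_toFrac (t : Spec (.of K) ⟶ projectiveSpace m Ω) [IsDominant t] [IsPreimmersion t] :
    ∃ θ : K →+* FractionRing (MvPolynomial (Fin (m + 1)) Ω),
      ∀ (y : projectiveSpace m Ω) (z : (projectiveSpace m Ω).presheaf.stalk y),
        θ (stalkEval t y z) = stalkToFrac y z := by
  let φ := RingEquiv.ofBijective (stalkEval t (genericPoint _)).hom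
    (stalkEval_genericPoint_bijective t)
  refine ⟨(stalkToFrac (genericPoint (projectiveSpace m Ω))).comp φ.symm.toRingHom, fun y z => ?_⟩
  have h := congrArg (fun f => f.hom z)
    (stalkSpecializes_stalkEval t (genericPoint_specializes y))
  have h2 : stalkEval t y z = φ ((projectiveSpace m Ω).presheaf.stalkSpecializes
    (genericPoint_specializes y) z) := h.symm
  rw [h2]
  have h3 (a) : ((stalkToFrac (genericPoint (projectiveSpace m Ω))).comp φ.symm.toRingHom) (φ a) =
      stalkToFrac (genericPoint (projectiveSpace m Ω)) a :=
    congrArg (stalkToFrac (genericPoint (projectiveSpace m Ω))) (φ.symm_apply_apply a)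
  refine (h3 _).trans ?_
  exact stalkToFrac_stalkSpecializes (genericPoint_specializes y) z

/-- This passes from schemes to field theory. The automorphism `g` need not be over `Ω`, which is
essential for Galois elements. -/
theorem exists_toFrac_permuting [Algebra Ω K] (t : Spec (.of K) ⟶ projectiveSpace m Ω) [IsDominant t]
    [IsPreimmersion t]
    (ht : t ≫ projectiveSpaceStr m Ω = Spec.map (CommRingCat.ofHom (algebraMap Ω K))) :
    ∃ θ : K →+* FractionRing (MvPolynomial (Fin (m + 1)) Ω), Set.range θ = homLoc ⊥ ∧
      (∀ a, θ (algebraMap Ω K a) = algebraMap _ _ (C a : MvPolynomial (Fin (m + 1)) Ω)) ∧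
      ∀ (σ : K ≃+* K) (g : projectiveSpace m Ω ⟶ projectiveSpace m Ω) [IsIso g],
        Spec.map (CommRingCat.ofHom σ.toRingHom) ≫ t = t ≫ g →
        ∀ y : ProjectiveSpectrum (homogeneousSubmodule (Fin (m + 1)) Ω),
        ∃ y' : ProjectiveSpectrum (homogeneousSubmodule (Fin (m + 1)) Ω), ∀ x,
          θ x ∈ homLoc y.asHomogeneousIdeal.toIdeal ↔
            θ (σ x) ∈ homLoc y'.asHomogeneousIdeal.toIdeal := by
  obtain ⟨θ, hθ⟩ := exists_toFrac t
  have hmem (y : projectiveSpace m Ω) (x : K) :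
      θ x ∈ homLoc (pointIdeal y) ↔ x ∈ Set.range (stalkEval t y) := by
    rw [← range_stalkToFrac y]
    constructor
    · rintro ⟨z, hz⟩
      exact ⟨z, θ.injective ((hθ y z).trans hz)⟩
    · rintro ⟨z, rfl⟩
      exact ⟨z, (hθ y z).symm⟩
  refine ⟨θ, ?_, fun a => ?_, fun σ g _ h => ?_⟩
  · rw [← pointIdeal_genericPoint (ι := Fin (m + 1)) (M := Ω), ← range_stalkToFrac]
    ext q
    constructor
    · rintro ⟨x, rfl⟩
      obtain ⟨z, rfl⟩ := (stalkEval_genericPoint_bijective t).surjective x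
      exact ⟨z, (hθ _ z).symm⟩
    · rintro ⟨z, rfl⟩
      exact ⟨_, hθ _ z⟩
  · have h1 := constStalk_stalkEval t (projectiveSpaceStr m Ω) _ ht (genericPoint _)
    have h2 : algebraMap Ω K a = stalkEval t (genericPoint _)
        (constStalk (projectiveSpaceStr m Ω) (genericPoint _) a) :=
      (congrArg (fun f => f.hom a) h1).symm
    rw [h2, hθ]
    exact stalkToFrac_constStalk _ a
  · have hg (y : projectiveSpace m Ω) : ∃ y', ∀ x,
        θ x ∈ homLoc (pointIdeal y) ↔ θ (σ x) ∈ homLoc (pointIdeal y') := by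
      obtain ⟨y, rfl⟩ := (g.homeomorph).surjective y
      exact ⟨y, fun x => (hmem (g y) x).trans
        ((mem_range_stalkEval_iff t σ g h y x).trans (hmem y (σ x)).symm)⟩
    exact hg

end ProjectiveEvaluation

end SelfProduct

namespace SelfProduct

/-! ### The geometric generic fibre and its Galois automorphisms. -/

section GenericFibre

open TensorProduct

theorem IsPullback.comp_mono {C : Type*} [Category* C] {P A B Y Y' : C} {p : P ⟶ A} {q : P ⟶ B}
    {a : A ⟶ Y} {b : B ⟶ Y} (h : IsPullback p q a b) (i : Y ⟶ Y') [Mono i] :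
    IsPullback p q (a ≫ i) (b ≫ i) :=
  ⟨⟨by rw [reassoc_of% h.w]⟩, ⟨PullbackCone.isLimitOfCompMono a b i _ h.isLimit⟩⟩

theorem isPullback_SpecMap_tensorProduct (F A B : Type u) [CommRing F] [CommRing A] [CommRing B]
    [Algebra F A] [Algebra F B] :
    IsPullback (Spec.map (CommRingCat.ofHom (algebraMap A (A ⊗[F] B))))
      (Spec.map (CommRingCat.ofHom
        (Algebra.TensorProduct.includeRight.toRingHom : B →+* A ⊗[F] B)))
      (Spec.map (CommRingCat.ofHom (algebraMap F A)))
      (Spec.map (CommRingCat.ofHom (algebraMap F B))) :=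
  isPullback_SpecMap_of_isPushout _ _ _ _ (CommRingCat.isPushout_tensorProduct F A B)

variable {F Ω E : Type u} [Field F] [Field Ω] [Field E] [Algebra F Ω] [Algebra F E]
  {X S : Scheme.{u}} (f : X ⟶ S) (i : Spec (.of F) ⟶ S)
  (a : Spec (.of E) ⟶ X) (ha : a ≫ f = Spec.map (CommRingCat.ofHom (algebraMap F E)) ≫ i)

/-- The morphism from the generic fibre of the pullback to the pullback. -/
noncomputable def tensorPoint :
    Spec (.of (Ω ⊗[F] E)) ⟶
      pullback f (Spec.map (CommRingCat.ofHom (algebraMap F Ω)) ≫ i) :=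
  pullback.lift
    (Spec.map (CommRingCat.ofHom
        (Algebra.TensorProduct.includeRight.toRingHom : E →+* Ω ⊗[F] E)) ≫ a)
    (Spec.map (CommRingCat.ofHom (algebraMap Ω (Ω ⊗[F] E)))) (by
      rw [Category.assoc, ha, reassoc_of% (isPullback_SpecMap_tensorProduct F Ω E).w])

/-- As `i` is a monomorphism, the product of `Spec Ω` and `Spec E` over `Spec F` is also their
product over `S`. -/
theorem isPullback_tensorPoint [Mono i] :
    IsPullback (tensorPoint (Ω := Ω) f i a ha)
      (Spec.map (CommRingCat.ofHom
        (Algebra.TensorProduct.includeRight.toRingHom : E →+* Ω ⊗[F] E)))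
      (pullback.fst f _) a := by
  refine IsPullback.of_right ?_ (pullback.lift_fst _ _ _) (IsPullback.of_hasPullback f _).flip
  rw [tensorPoint, pullback.lift_snd, ha]
  exact IsPullback.comp_mono (isPullback_SpecMap_tensorProduct F Ω E) i

/-- `tensorPoint` is the base change of `a` along a flat morphism, so it inherits density, flatness
and being a preimmersion; its source is then integral like its target. -/
theorem isDomain_tensorProduct_of_flat [Mono i] [Flat i] [IsPreimmersion a] [Flat a]
    [IsSchemeTheoreticallyDominant a] [QuasiCompact a]
    [IsIntegral (pullback f (Spec.map (CommRingCat.ofHom (algebraMap F Ω)) ≫ i))] :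
    IsDomain (Ω ⊗[F] E) ∧ IsPreimmersion (tensorPoint (Ω := Ω) f i a ha) ∧
      IsDominant (tensorPoint (Ω := Ω) f i a ha) := by
  have h := isPullback_tensorPoint (Ω := Ω) f i a ha
  have h1 : IsPreimmersion (tensorPoint (Ω := Ω) f i a ha) :=
    MorphismProperty.of_isPullback h.flip inferInstance
  have h2 : Flat (tensorPoint (Ω := Ω) f i a ha) :=
    MorphismProperty.of_isPullback h.flip inferInstance
  have h3 : IsSchemeTheoreticallyDominant (tensorPoint (Ω := Ω) f i a ha) :=
    IsSchemeTheoreticallyDominant.of_isPullback h.flip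
  have h4 : QuasiCompact (tensorPoint (Ω := Ω) f i a ha) :=
    MorphismProperty.of_isPullback h.flip inferInstance
  have h5 : IsDominant (tensorPoint (Ω := Ω) f i a ha) := inferInstance
  have h6 : IsIntegral (Spec (.of (Ω ⊗[F] E))) :=
    isIntegral_of_flat_preimmersion (tensorPoint (Ω := Ω) f i a ha)
  exact ⟨(affine_isIntegral_iff (.of (Ω ⊗[F] E))).mp h6, h1, h5⟩

/-- The automorphism is the base change of `Spec σ`; it covers a nontrivial automorphism of `Spec Ω`
in general. -/
theorem exists_iso_of_galois (σ : Gal(Ω/F)) :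
    ∃ g : pullback f (Spec.map (CommRingCat.ofHom (algebraMap F Ω)) ≫ i) ⟶
        pullback f (Spec.map (CommRingCat.ofHom (algebraMap F Ω)) ≫ i), IsIso g ∧
      Spec.map (CommRingCat.ofHom (galoisAction F Ω E σ).toRingHom) ≫
        tensorPoint (Ω := Ω) f i a ha = tensorPoint (Ω := Ω) f i a ha ≫ g := by
  have hσ : Spec.map (CommRingCat.ofHom (σ : Ω →+* Ω)) ≫
      Spec.map (CommRingCat.ofHom (algebraMap F Ω)) =
        Spec.map (CommRingCat.ofHom (algebraMap F Ω)) := by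
    rw [← Spec.map_comp, ← CommRingCat.ofHom_comp]
    congr 2
    ext x
    exact σ.commutes x
  have : IsIso (Spec.map (CommRingCat.ofHom (σ : Ω →+* Ω))) := by
    have : IsIso (CommRingCat.ofHom (σ : Ω →+* Ω)) :=
      (σ.toRingEquiv.toCommRingCatIso).isIso_hom
    infer_instance
  refine ⟨pullback.map f _ f _ (𝟙 _) (Spec.map (CommRingCat.ofHom (σ : Ω →+* Ω))) (𝟙 _) (by simp)
    (by rw [reassoc_of% hσ, Category.comp_id]), inferInstance, ?_⟩
  apply pullback.hom_ext
  · simp only [tensorPoint, Category.assoc, pullback.lift_fst, pullback.map, Category.comp_id]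
    rw [← Spec.map_comp_assoc, ← CommRingCat.ofHom_comp]
    congr 3
    ext x
    exact (galoisAction_tmul σ 1 x).trans (by rw [map_one]; rfl)
  · simp only [tensorPoint, Category.assoc, pullback.lift_snd, pullback.map,
      pullback.lift_snd_assoc]
    rw [← Spec.map_comp, ← Spec.map_comp, ← CommRingCat.ofHom_comp, ← CommRingCat.ofHom_comp]
    congr 2

attribute [local instance] MvPolynomial.gradedAlgebra

open MvPolynomial

theorem exists_toFrac_of_fibre [Algebra.IsAlgebraic F Ω] [Mono i] [Flat i] [IsPreimmersion a] [Flat a]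
    [IsSchemeTheoreticallyDominant a] [QuasiCompact a]
    (ha : a ≫ f = Spec.map (CommRingCat.ofHom (algebraMap F E)) ≫ i) {m : ℕ}
    (e : pullback f (Spec.map (CommRingCat.ofHom (algebraMap F Ω)) ≫ i) ≅ projectiveSpace m Ω)
    (he : e.hom ≫ projectiveSpaceStr m Ω = pullback.snd f _) :
    ∃ (K : Type u) (_ : Field K) (_ : Algebra Ω K) (e : Ω ⊗[F] E ≃ₐ[Ω] K)
      (θ : K →+* FractionRing (MvPolynomial (Fin (m + 1)) Ω)), Set.range θ = homLoc ⊥ ∧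
      (∀ a, θ (algebraMap Ω K a) = algebraMap _ _ (C a : MvPolynomial (Fin (m + 1)) Ω)) ∧
      ∀ (σ : Gal(Ω/F)) (y : ProjectiveSpectrum (homogeneousSubmodule (Fin (m + 1)) Ω)),
        ∃ y' : ProjectiveSpectrum (homogeneousSubmodule (Fin (m + 1)) Ω), ∀ x,
          θ x ∈ homLoc y.asHomogeneousIdeal.toIdeal ↔
            θ (e (galoisAction F Ω E σ (e.symm x))) ∈ homLoc y'.asHomogeneousIdeal.toIdeal := by
  have : IsIntegral (pullback f (Spec.map (CommRingCat.ofHom (algebraMap F Ω)) ≫ i)) :=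
    have : Nonempty (pullback f (Spec.map (CommRingCat.ofHom (algebraMap F Ω)) ≫ i) : Scheme) :=
      ⟨e.inv (genericPoint _)⟩
    isIntegral_of_isOpenImmersion e.hom
  obtain ⟨hdom, hpre, hdense⟩ := isDomain_tensorProduct_of_flat (Ω := Ω) f i a ha
  -- The tensor product is already a field; passing to its fraction ring only supplies the field
  -- structure.
  let K := FractionRing (Ω ⊗[F] E)
  have hbij : Function.Bijective (IsScalarTower.toAlgHom Ω (Ω ⊗[F] E) K) :=
    IsField.localization_map_bijective (zero_notMem_nonZeroDivisors)
      (Algebra.TensorProduct.isField_of_isAlgebraic F Ω E (.inl inferInstance))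
  let ε : Ω ⊗[F] E ≃ₐ[Ω] K := AlgEquiv.ofBijective _ hbij
  let q : CommRingCat.of (Ω ⊗[F] E) ⟶ .of K := CommRingCat.ofHom ε.toRingHom
  have hq : IsIso q := ε.toRingEquiv.toCommRingCatIso.isIso_hom
  let t : Spec (.of K) ⟶ projectiveSpace m Ω :=
    Spec.map q ≫ tensorPoint (Ω := Ω) f i a ha ≫ e.hom
  have ht : t ≫ projectiveSpaceStr m Ω = Spec.map (CommRingCat.ofHom (algebraMap Ω K)) := by
    simp only [t, Category.assoc, he, tensorPoint, pullback.lift_snd]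
    rw [← Spec.map_comp, ← CommRingCat.ofHom_comp]
    congr 2
  obtain ⟨θ, h1, h2, h3⟩ := exists_toFrac_permuting t ht
  refine ⟨K, inferInstance, inferInstance, ε, θ, h1, h2, fun σ y => ?_⟩
  obtain ⟨g, hg, hgσ⟩ := exists_iso_of_galois (Ω := Ω) f i a ha σ
  let τ : K ≃+* K := (ε.symm.toRingEquiv.trans (galoisAction F Ω E σ)).trans ε.toRingEquiv
  have hτ : CommRingCat.ofHom τ.toRingHom = inv q ≫
      CommRingCat.ofHom (galoisAction F Ω E σ).toRingHom ≫ q := by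
    rw [← cancel_epi q, IsIso.hom_inv_id_assoc]
    refine CommRingCat.hom_ext (RingHom.ext fun x => ?_)
    exact congrArg (fun z => ε (galoisAction F Ω E σ z)) (ε.symm_apply_apply x)
  refine h3 τ (e.inv ≫ g ≫ e.hom) ?_ y
  simp only [t, hτ, Spec.map_comp, Category.assoc, e.hom_inv_id_assoc]
  have hq' : Spec.map (inv q) ≫ Spec.map q = 𝟙 _ := by
    rw [← Spec.map_comp, IsIso.hom_inv_id, Spec.map_id]
  rw [← reassoc_of% hgσ, reassoc_of% hq']

end GenericFibre

end SelfProduct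

namespace SelfProduct

/-! ### Scheme-theoretic images. -/

section Images

theorem isSchemeTheoreticallyDominant_toImage {T W : Scheme.{u}} (q : T ⟶ W) [QuasiCompact q] :
    IsSchemeTheoreticallyDominant q.toImage := by
  refine ⟨Scheme.IdealSheafData.ext_of_iSup_eq_top
    (fun U : W.affineOpens => ⟨q.imageι ⁻¹ᵁ U, U.2.preimage q.imageι⟩) ?_ fun U => ?_⟩
  · rw [← Scheme.Hom.preimage_iSup, iSup_affineOpens_eq_top W, Scheme.Hom.preimage_top]
  · rw [Scheme.Hom.ker_apply]
    exact (RingHom.injective_iff_ker_eq_bot _).mp (q.toImage_app_injective U)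

/-- The scheme-theoretic image depends only on the kernel ideal sheaf. -/
theorem exists_lift_image_of_ker_eq {T V W : Scheme.{u}} (g : T ⟶ W) (h : V ⟶ W) [QuasiCompact g]
    (hk : g.ker = h.ker) :
    ∃ g' : T ⟶ h.image, g' ≫ h.imageι = g ∧ IsSchemeTheoreticallyDominant g' ∧
      QuasiCompact g' := by
  change ∃ g' : T ⟶ h.ker.subscheme, g' ≫ h.ker.subschemeι = g ∧
    IsSchemeTheoreticallyDominant g' ∧ QuasiCompact g'
  rw [← hk]
  exact ⟨g.toImage, g.toImage_imageι, isSchemeTheoreticallyDominant_toImage g, inferInstance⟩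

theorem isIntegral_of_isSchemeTheoreticallyDominant {T Y : Scheme.{u}} (g : T ⟶ Y) [IsIntegral T]
    [IsSchemeTheoreticallyDominant g] [QuasiCompact g] : IsIntegral Y := by
  have := IsSchemeTheoreticallyDominant.isReduced g
  have : IrreducibleSpace Y := by
    have h : IsIrreducible (Set.range g) := by
      rw [← Set.image_univ]
      exact (IrreducibleSpace.isIrreducible_univ T).image _ g.continuous.continuousOn
    rw [irreducibleSpace_def, Set.top_eq_univ, ← g.denseRange.closure_range]
    exact h.closure
  exact isIntegral_of_irreducibleSpace_of_isReduced Y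

end Images

/-! ### The generic fibre of the self-product and `Spec (E ⊗ E)`. -/

section GenericFibreOfProduct

open TensorProduct

variable {F E : Type u} [Field F] [Field E] [Algebra F E]
  {X S : Scheme.{u}} (f : X ⟶ S) (i : Spec (.of F) ⟶ S)

/-- The generic fibre is the self-product of `X_F` over the field `F`, so its projections to `X_F`
are flat, and `X_F` is flat over `X` as a base change of `i`. -/
theorem flat_fst_snd [Mono i] [Flat i] :
    Flat (pullback.fst (pullback.fst f f ≫ f) i ≫ pullback.fst f f) ∧
      Flat (pullback.fst (pullback.fst f f ≫ f) i ≫ pullback.snd f f) := by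
  let ι := pullback.fst (pullback.fst f f ≫ f) i
  let v := pullback.snd (pullback.fst f f ≫ f) i
  have hv : ι ≫ pullback.fst f f ≫ f = v ≫ i := pullback.condition
  let v₁ : pullback (pullback.fst f f ≫ f) i ⟶ pullback f i :=
    pullback.lift (ι ≫ pullback.fst f f) v (by rw [Category.assoc, hv])
  let v₂ : pullback (pullback.fst f f ≫ f) i ⟶ pullback f i :=
    pullback.lift (ι ≫ pullback.snd f f) v (by rw [Category.assoc, ← pullback.condition, hv])
  have h₁ : v₁ ≫ pullback.fst f i = ι ≫ pullback.fst f f := pullback.lift_fst _ _ _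
  have h₂ : v₂ ≫ pullback.fst f i = ι ≫ pullback.snd f f := pullback.lift_fst _ _ _
  have hA : IsPullback ι v₁ (pullback.fst f f) (pullback.fst f i) := by
    refine IsPullback.of_bot ?_ h₁.symm (IsPullback.of_hasPullback f i)
    rw [pullback.lift_snd]
    exact IsPullback.of_hasPullback _ _
  have hB : IsPullback (ι ≫ pullback.snd f f) v₁ f (pullback.snd f i ≫ i) := by
    rw [← pullback.condition]
    exact hA.paste_horiz (IsPullback.of_hasPullback f f).flip
  have hC : IsPullback v₂ v₁ (pullback.snd f i) (pullback.snd f i) := by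
    refine IsPullback.of_right ?_ ?_ (IsPullback.of_hasPullback f i)
    · rw [h₂]
      exact hB
    · rw [pullback.lift_snd, pullback.lift_snd]
  have f₁ : Flat v₁ := MorphismProperty.of_isPullback hC inferInstance
  have f₂ : Flat v₂ := MorphismProperty.of_isPullback hC.flip inferInstance
  constructor
  · rw [← h₁]; infer_instance
  · rw [← h₂]; infer_instance

variable (a : Spec (.of E) ⟶ X) (ha : a ≫ f = Spec.map (CommRingCat.ofHom (algebraMap F E)) ≫ i)

/-- The morphism from the spectrum of the tensor square of the function field to the self-product. -/
noncomputable def tensorSquarePoint : Spec (.of (E ⊗[F] E)) ⟶ pullback f f :=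
  pullback.lift
    (Spec.map (CommRingCat.ofHom (algebraMap E (E ⊗[F] E))) ≫ a)
    (Spec.map (CommRingCat.ofHom
        (Algebra.TensorProduct.includeRight.toRingHom : E →+* E ⊗[F] E)) ≫ a) (by
      simp only [Category.assoc, ha]
      rw [reassoc_of% (isPullback_SpecMap_tensorProduct F E E).w])

/-- Pulling `a` back along one flat projection and then the other gives a scheme-theoretically
dominant morphism to the generic fibre which factors through `Spec (E ⊗ E)`. Conversely, `Spec (E ⊗
E)` maps to the generic fibre. -/
theorem ker_tensorSquarePoint [Mono i] [Flat i] [Flat a] [IsSchemeTheoreticallyDominant a]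
    [QuasiCompact a] :
    (tensorSquarePoint f i a ha).ker = (pullback.fst (pullback.fst f f ≫ f) i).ker := by
  apply le_antisymm
  · obtain ⟨h₁, h₂⟩ := flat_fst_snd f i
    let ι := pullback.fst (pullback.fst f f ≫ f) i
    let b := pullback.fst (ι ≫ pullback.fst f f) a
    let c := pullback.fst (b ≫ ι ≫ pullback.snd f f) a
    have : Flat b := inferInstance
    have : Flat (b ≫ ι ≫ pullback.snd f f) := inferInstance
    have : IsSchemeTheoreticallyDominant (c ≫ b) := inferInstance
    have hT := IsPullback.comp_mono (isPullback_SpecMap_tensorProduct F E E) i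
    let e₁ := c ≫ pullback.snd (ι ≫ pullback.fst f f) a
    let e₂ := pullback.snd (b ≫ ι ≫ pullback.snd f f) a
    have he₁ : e₁ ≫ a = c ≫ b ≫ ι ≫ pullback.fst f f := by
      simp only [e₁, Category.assoc, ← pullback.condition, b]
    have he₂ : e₂ ≫ a = c ≫ b ≫ ι ≫ pullback.snd f f := pullback.condition.symm
    let l := hT.lift e₁ e₂ (by
      rw [← ha, reassoc_of% he₁, reassoc_of% he₂]
      exact congrArg (fun z => c ≫ b ≫ ι ≫ z) pullback.condition)
    have hl : l ≫ tensorSquarePoint f i a ha = (c ≫ b) ≫ ι := by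
      apply pullback.hom_ext
      · rw [tensorSquarePoint, Category.assoc, pullback.lift_fst, hT.lift_fst_assoc, he₁]
        simp only [Category.assoc]
      · rw [tensorSquarePoint, Category.assoc, pullback.lift_snd, hT.lift_snd_assoc, he₂]
        simp only [Category.assoc]
    refine (l.le_ker_comp _).trans ?_
    rw [hl, Scheme.Hom.ker_comp, (c ≫ b).ker_eq_bot, Scheme.IdealSheafData.map_bot]
  · have h : tensorSquarePoint f i a ha ≫ pullback.fst f f ≫ f =
        Spec.map (CommRingCat.ofHom (algebraMap F (E ⊗[F] E))) ≫ i := by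
      rw [tensorSquarePoint, pullback.lift_fst_assoc, Category.assoc, ha, ← Spec.map_comp_assoc,
        ← CommRingCat.ofHom_comp, ← IsScalarTower.algebraMap_eq]
    conv_rhs => rw [← pullback.lift_fst (f := pullback.fst f f ≫ f) (g := i) _ _ h]
    exact Scheme.Hom.le_ker_comp _ _

end GenericFibreOfProduct

end SelfProduct

namespace SelfProduct

/-! ### Lifting to images, and dominant maps of spectra. -/

section Lifts

theorem exists_lift_image_of_ker_le {T V W : Scheme.{u}} (g : T ⟶ W) (h : V ⟶ W)
    (hk : h.ker ≤ g.ker) : ∃ g' : T ⟶ h.image, g' ≫ h.imageι = g := by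
  change ∃ g' : T ⟶ h.ker.subscheme, g' ≫ h.ker.subschemeι = g
  refine ⟨g.toImage ≫ Scheme.IdealSheafData.inclusion hk, ?_⟩
  have h1 : Scheme.IdealSheafData.inclusion hk ≫ h.ker.subschemeι = g.imageι :=
    Scheme.IdealSheafData.inclusion_subschemeι hk
  exact (Category.assoc _ _ _).trans ((congrArg (g.toImage ≫ ·) h1).trans g.toImage_imageι)

theorem isDominant_SpecMap_of_injective {R R' : CommRingCat.{u}} (φ : R ⟶ R')
    (h : Function.Injective φ) : IsDominant (Spec.map φ) := by
  refine ⟨(PrimeSpectrum.denseRange_comap_iff_ker_le_nilRadical φ.hom).mpr ?_⟩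
  rw [(RingHom.injective_iff_ker_eq_bot φ.hom).mp h]
  exact bot_le

end Lifts

/-! ### The closure `Z`: the flat case, the diagonal and the generic point. -/

section FibreProductGeneric

open TensorProduct

variable {X S : Scheme.{u}} [IsIntegral S] (f : X ⟶ S)

instance : IsIso (S.residue (genericPoint S)) := by
  have : Function.Bijective (S.residue (genericPoint S)).hom :=
    ⟨RingHom.injective (R := S.functionField) (S := S.residueField (genericPoint S)) _,
      S.residue_surjective _⟩
  exact (ConcreteCategory.isIso_iff_bijective _).mpr this

instance : Flat (S.fromSpecResidueField (genericPoint S)) := by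
  have : Flat (Spec.map (S.residue (genericPoint S))) := inferInstance
  exact inferInstanceAs (Flat (Spec.map (S.residue (genericPoint S)) ≫ S.fromSpecStalk _))

/-- The inclusion of the residue field of the generic point of `S` into the function field of `X`. -/
noncomputable def residueToFunctionField [IsIntegral X] [IsDominant f] :
    S.residueField (genericPoint S) ⟶ X.functionField :=
  inv (S.residue (genericPoint S)) ≫ functionFieldMap f

theorem SpecMap_functionFieldMap {Z Y : Scheme.{u}} [IsIntegral Z] [IsIntegral Y] (g : Z ⟶ Y)
    [IsDominant g] : Spec.map (functionFieldMap g) ≫ Y.fromSpecStalk (genericPoint Y) =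
      Z.fromSpecStalk (genericPoint Z) ≫ g := by
  rw [functionFieldMap, Spec.map_comp, Category.assoc,
    Scheme.SpecMap_stalkSpecializes_fromSpecStalk, Scheme.SpecMap_stalkMap_fromSpecStalk]

theorem functionFieldMap_comp {Z Y Y' : Scheme.{u}} [IsIntegral Z] [IsIntegral Y] [IsIntegral Y']
    (g : Z ⟶ Y) (h : Y ⟶ Y') [IsDominant g] [IsDominant h] [IsDominant (g ≫ h)] :
    functionFieldMap (g ≫ h) = functionFieldMap h ≫ functionFieldMap g := by
  apply Spec.map_injective
  rw [← cancel_mono (Y'.fromSpecStalk _), SpecMap_functionFieldMap, Spec.map_comp, Category.assoc,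
    SpecMap_functionFieldMap, ← Category.assoc, ← Category.assoc, SpecMap_functionFieldMap]

theorem fromSpecStalk_comp [IsIntegral X] [IsDominant f] :
    X.fromSpecStalk (genericPoint X) ≫ f =
      Spec.map (residueToFunctionField f) ≫ S.fromSpecResidueField (genericPoint S) := by
  rw [← SpecMap_functionFieldMap, residueToFunctionField, Spec.map_comp, Scheme.fromSpecResidueField,
    Category.assoc, ← Spec.map_comp_assoc _ (inv (S.residue (genericPoint S))), IsIso.hom_inv_id,
    Spec.map_id, Category.id_comp]

instance [IsIntegral X] : IsSchemeTheoreticallyDominant (X.fromSpecStalk (genericPoint X)) := by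
  have : IsDominant (X.fromSpecStalk (genericPoint X)) := by
    refine ⟨dense_iff_closure_eq.mpr (Set.eq_univ_of_univ_subset ?_)⟩
    rw [← genericPoint_closure (α := X)]
    refine closure_mono (Set.singleton_subset_iff.mpr ?_)
    exact ⟨IsLocalRing.closedPoint _, X.fromSpecStalk_closedPoint⟩
  exact .of_isDominant _

instance [QuasiSeparatedSpace X] [QuasiSeparated f] : QuasiSeparatedSpace (pullback f f :) :=
  quasiSeparatedSpace_of_quasiSeparated (pullback.fst f f)

theorem isDominant_of_exists {x : X} (h : f x = genericPoint S) : IsDominant f := by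
  refine ⟨dense_iff_closure_eq.mpr (Set.eq_univ_of_univ_subset ?_)⟩
  rw [← genericPoint_closure (α := S), ← h]
  exact closure_mono (Set.singleton_subset_iff.mpr ⟨x, rfl⟩)

instance [QuasiSeparatedSpace S] : QuasiCompact (S.fromSpecResidueField (genericPoint S)) :=
  inferInstance

instance : IsSchemeTheoreticallyDominant (S.fromSpecResidueField (genericPoint S)) := by
  have : IsDominant (S.fromSpecResidueField (genericPoint S)) := by
    refine ⟨dense_iff_closure_eq.mpr ?_⟩
    rw [S.range_fromSpecResidueField]
    exact genericPoint_closure (α := S)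
  exact .of_isDominant _

/-- Flat base change keeps the generic point of `S` scheme-theoretically dominant, so the generic
fibre has zero kernel. -/
theorem isIso_fibreProductι_of_flat [QuasiSeparatedSpace S] [Flat f] :
    IsIso (fibreProductι f) := by
  refine (Scheme.isIso_subschemeι_iff_eq_bot _).mpr ?_
  have : IsSchemeTheoreticallyDominant (genericFibreι f) :=
    inferInstanceAs (IsSchemeTheoreticallyDominant
      (pullback.fst (pullback.fst f f ≫ f) (S.fromSpecResidueField (genericPoint S))))
  exact (genericFibreι f).ker_eq_bot

variable {E : Type u} [Field E] [Algebra (S.residueField (genericPoint S)) E]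
  (a : Spec (.of E) ⟶ X)
  (ha : a ≫ f = Spec.map (CommRingCat.ofHom (algebraMap (S.residueField (genericPoint S)) E)) ≫
    S.fromSpecResidueField (genericPoint S))

/-- The diagonal sends the dominant point `a` into the generic fibre, so the ideal of `Z` vanishes
on the diagonal. -/
theorem exists_section_of_point
    (ha : a ≫ f = Spec.map (CommRingCat.ofHom (algebraMap (S.residueField (genericPoint S)) E)) ≫
    S.fromSpecResidueField (genericPoint S)) [IsSchemeTheoreticallyDominant a] :
    ∃ δ : X ⟶ fibreProduct f, δ ≫ fibreProductι f = pullback.diagonal f ∧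
      δ ≫ proj₁ f = 𝟙 X ∧ δ ≫ proj₂ f = 𝟙 X := by
  have hle : (genericFibreι f).ker ≤ (pullback.diagonal f).ker := by
    have h : (a ≫ pullback.diagonal f) ≫ pullback.fst f f ≫ f = Spec.map (CommRingCat.ofHom
        (algebraMap (S.residueField (genericPoint S)) E)) ≫
          S.fromSpecResidueField (genericPoint S) := by
      simp [ha]
    have h2 : pullback.lift _ _ h ≫ genericFibreι f = a ≫ pullback.diagonal f :=
      pullback.lift_fst _ _ _
    have h3 := Scheme.Hom.le_ker_comp (pullback.lift _ _ h) (genericFibreι f)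
    rw [h2, Scheme.Hom.ker_comp, a.ker_eq_bot, Scheme.IdealSheafData.map_bot] at h3
    exact h3
  obtain ⟨δ, h⟩ : ∃ δ : X ⟶ fibreProduct f, δ ≫ fibreProductι f = pullback.diagonal f :=
    exists_lift_image_of_ker_le _ _ hle
  refine ⟨δ, h, ?_, ?_⟩
  · rw [proj₁, reassoc_of% h, pullback.diagonal_fst]
  · rw [proj₂, reassoc_of% h, pullback.diagonal_snd]

theorem exists_point_fibreProduct [Flat a] [IsSchemeTheoreticallyDominant a] [QuasiCompact a]
    [IsDomain (E ⊗[S.residueField (genericPoint S)] E)]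
    [QuasiSeparatedSpace (pullback f f :)] :
    ∃ t : Spec (.of (FractionRing (E ⊗[S.residueField (genericPoint S)] E))) ⟶ fibreProduct f,
      t ≫ fibreProductι f = Spec.map (CommRingCat.ofHom (algebraMap _ _)) ≫
        tensorSquarePoint f _ a ha ∧
      IsSchemeTheoreticallyDominant t ∧ QuasiCompact t := by
  let g : Spec (.of (FractionRing (E ⊗[S.residueField (genericPoint S)] E))) ⟶ pullback f f :=
    Spec.map (CommRingCat.ofHom (algebraMap (E ⊗[S.residueField (genericPoint S)] E) _)) ≫
      tensorSquarePoint f _ a ha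
  have hg : g.ker = (genericFibreι f).ker := by
    have : IsDominant (Spec.map (CommRingCat.ofHom (algebraMap
        (E ⊗[S.residueField (genericPoint S)] E)
        (FractionRing (E ⊗[S.residueField (genericPoint S)] E))))) :=
      isDominant_SpecMap_of_injective _ (IsFractionRing.injective _ _)
    have : IsIntegral (Spec (.of (E ⊗[S.residueField (genericPoint S)] E))) := inferInstance
    have := IsSchemeTheoreticallyDominant.of_isDominant (Spec.map (CommRingCat.ofHom (algebraMap
        (E ⊗[S.residueField (genericPoint S)] E)
        (FractionRing (E ⊗[S.residueField (genericPoint S)] E)))))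
    rw [Scheme.Hom.ker_comp, Scheme.Hom.ker_eq_bot, Scheme.IdealSheafData.map_bot]
    exact ker_tensorSquarePoint f _ a ha
  exact exists_lift_image_of_ker_eq g (genericFibreι f) hg

end FibreProductGeneric

end SelfProduct

namespace SelfProduct

/-! ### The function field of `Z` and its generators. -/

section FunctionFieldOfProduct

open TensorProduct

theorem algebraicIndependent_subfield {R N ι : Type*} [CommRing R] [Field N] [Algebra R N]
    {x : ι → N} (hx : AlgebraicIndependent R x) (A : Subfield N)
    (hA : (A : Set N) = Set.range (algebraMap R N)) : AlgebraicIndependent A x := by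
  refine hx.ringHom_of_comp_eq ((algebraMap R N).codRestrict A fun r => ?_) (RingHom.id N) ?_
    Function.injective_id (RingHom.ext fun _ => rfl)
  · exact hA.ge ⟨r, rfl⟩
  · rintro ⟨y, hy⟩
    obtain ⟨r, rfl⟩ := hA.le hy
    exact ⟨r, rfl⟩

theorem closure_eq_top_of_adjoin_eq_top {F E N : Type*} [Field F] [Field E] [Field N] [Algebra F E]
    [Algebra F N] (j : E →ₐ[F] N) (s : Set N) (A : Subfield N) (hA : (A : Set N) = Set.range j)
    (h : IntermediateField.adjoin F (Set.range j ∪ s) = ⊤) :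
    Subfield.closure ((A : Set N) ∪ s) = ⊤ := by
  have h2 := congrArg IntermediateField.toSubfield h
  rw [IntermediateField.adjoin_toSubfield, IntermediateField.top_toSubfield] at h2
  rw [eq_top_iff, ← h2, Subfield.closure_le, hA]
  rintro z (⟨r, rfl⟩ | hz)
  · exact Subfield.subset_closure (.inl ⟨algebraMap F E r, j.commutes r⟩)
  · exact Subfield.subset_closure hz

variable {X S : Scheme.{u}} [IsIntegral S] [IsIntegral X] (f : X ⟶ S) [IsDominant f]

theorem exists_functionField_equiv [Algebra (S.residueField (genericPoint S)) X.functionField]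
    (hE : algebraMap (S.residueField (genericPoint S)) X.functionField =
      (residueToFunctionField f).hom)
    [IsDomain (X.functionField ⊗[S.residueField (genericPoint S)] X.functionField)]
    [QuasiSeparatedSpace X] [QuasiSeparatedSpace (pullback f f :)]
    [IsDominant (proj₁ f)] [IsDominant (proj₂ f)] :
    ∃ (_ : IsIntegral (fibreProduct f)) (φ : (fibreProduct f).functionField ≃+*
      FractionRing (X.functionField ⊗[S.residueField (genericPoint S)] X.functionField)),
      (∀ z, φ (functionFieldMap (proj₁ f) z) = algebraMap _ _
        (z ⊗ₜ 1 : X.functionField ⊗[S.residueField (genericPoint S)] X.functionField)) ∧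
      (∀ z, φ (functionFieldMap (proj₂ f) z) = algebraMap _ _
        (1 ⊗ₜ z : X.functionField ⊗[S.residueField (genericPoint S)] X.functionField)) := by
  let a : Spec (.of X.functionField) ⟶ X := X.fromSpecStalk (genericPoint X)
  have ha : a ≫ f = Spec.map (CommRingCat.ofHom (algebraMap (S.residueField (genericPoint S))
      X.functionField)) ≫ S.fromSpecResidueField (genericPoint S) := by
    rw [hE]
    exact fromSpecStalk_comp f
  have h1 : Flat a := inferInstanceAs (Flat (X.fromSpecStalk (genericPoint X)))
  have h2 : IsSchemeTheoreticallyDominant a :=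
    inferInstanceAs (IsSchemeTheoreticallyDominant (X.fromSpecStalk (genericPoint X)))
  obtain ⟨t, ht, hdom, hqc⟩ := exists_point_fibreProduct f a ha
  have hint := isIntegral_of_isSchemeTheoreticallyDominant t
  let ψ := stalkEval t (genericPoint _)
  have hp₁ : functionFieldMap (proj₁ f) ≫ ψ = CommRingCat.ofHom (algebraMap X.functionField
      (X.functionField ⊗[S.residueField (genericPoint S)] X.functionField)) ≫
        CommRingCat.ofHom (algebraMap _ _) := by
    rw [functionFieldMap_stalkEval]
    symm
    apply eq_stalkEval
    rw [proj₁, reassoc_of% ht, tensorSquarePoint, pullback.lift_fst, Spec.map_comp, Category.assoc]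
  have hp₂ : functionFieldMap (proj₂ f) ≫ ψ = CommRingCat.ofHom
      (Algebra.TensorProduct.includeRight.toRingHom : X.functionField →+*
        X.functionField ⊗[S.residueField (genericPoint S)] X.functionField) ≫
        CommRingCat.ofHom (algebraMap _ _) := by
    rw [functionFieldMap_stalkEval]
    symm
    apply eq_stalkEval
    rw [proj₂, reassoc_of% ht, tensorSquarePoint, pullback.lift_snd, Spec.map_comp, Category.assoc]
  have hp₁' (z) : ψ (functionFieldMap (proj₁ f) z) = algebraMap _ _
        (z ⊗ₜ 1 : X.functionField ⊗[S.residueField (genericPoint S)] X.functionField) :=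
    congrArg (fun g => g.hom z) hp₁
  have hp₂' (z) : ψ (functionFieldMap (proj₂ f) z) = algebraMap _ _
        (1 ⊗ₜ z : X.functionField ⊗[S.residueField (genericPoint S)] X.functionField) :=
    congrArg (fun g => g.hom z) hp₂
  let ψ' : (fibreProduct f).functionField →+*
    FractionRing (X.functionField ⊗[S.residueField (genericPoint S)] X.functionField) := ψ.hom
  -- Surjectivity: the image is a field containing both copies of `k(X)`, which generate the
  -- fraction field.
  have hmem (w : X.functionField ⊗[S.residueField (genericPoint S)] X.functionField) :
      algebraMap _ _ w ∈ ψ'.fieldRange := by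
    induction w with
    | zero => rw [map_zero]; exact zero_mem _
    | add w w' h h' => rw [map_add]; exact add_mem h h'
    | tmul z z' =>
      have : z ⊗ₜ[S.residueField (genericPoint S)] z' = z ⊗ₜ 1 * 1 ⊗ₜ z' := by simp
      rw [this, map_mul]
      exact mul_mem ⟨_, hp₁' z⟩ ⟨_, hp₂' z'⟩
  have hbij : Function.Bijective ψ' := by
    refine ⟨ψ'.injective, fun w => ?_⟩
    obtain ⟨p, q, -, rfl⟩ := IsFractionRing.div_surjective
      (A := X.functionField ⊗[S.residueField (genericPoint S)] X.functionField) w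
    exact div_mem (hmem p) (hmem q)
  exact ⟨hint, RingEquiv.ofBijective ψ' hbij, hp₁', hp₂'⟩

theorem exists_independent_generators_fibreProduct [CharZero (S.residueField (genericPoint S))]
    [QuasiSeparatedSpace X] [QuasiSeparatedSpace (pullback f f :)]
    [IsDominant (proj₁ f)] [IsDominant (proj₂ f)] [IsDominant (toBase f)] {m : ℕ}
    (e : pullback f (geometricPoint S (genericPoint S)) ≅
      projectiveSpace m (AlgebraicClosure (S.residueField (genericPoint S))))
    (he : e.hom ≫ projectiveSpaceStr m (AlgebraicClosure (S.residueField (genericPoint S))) =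
      pullback.snd f (geometricPoint S (genericPoint S))) :
    ∃ (_ : IsIntegral (fibreProduct f)) (x v : Fin m → (fibreProduct f).functionField),
      AlgebraicIndependent (functionFieldRange (toBase f)) (Sum.elim x v) ∧
      (Subfield.closure ((functionFieldRange (proj₁ f) : Set _) ∪ Set.range x) = ⊤ ∧
        AlgebraicIndependent (functionFieldRange (proj₁ f)) x) ∧
      (Subfield.closure ((functionFieldRange (proj₂ f) : Set _) ∪ Set.range v) = ⊤ ∧
        AlgebraicIndependent (functionFieldRange (proj₂ f)) v) := by
  let F := S.residueField (genericPoint S)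
  let Ω := AlgebraicClosure F
  let E := X.functionField
  let _ : Algebra F E := (residueToFunctionField f).hom.toAlgebra
  let a : Spec (.of E) ⟶ X := X.fromSpecStalk (genericPoint X)
  have ha : a ≫ f = Spec.map (CommRingCat.ofHom (algebraMap F E)) ≫
      S.fromSpecResidueField (genericPoint S) := fromSpecStalk_comp f
  have h1 : Flat a := inferInstanceAs (Flat (X.fromSpecStalk (genericPoint X)))
  have h2 : IsSchemeTheoreticallyDominant a :=
    inferInstanceAs (IsSchemeTheoreticallyDominant (X.fromSpecStalk (genericPoint X)))
  have h3 : IsPreimmersion a := inferInstanceAs (IsPreimmersion (X.fromSpecStalk (genericPoint X)))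
  -- Characteristic zero enters here: the algebraic closure is separable.
  have : IsGalois F Ω := {}
  obtain ⟨K, _, _, ε, θ, hθ, hθΩ, hperm⟩ := exists_toFrac_of_fibre (F := F) (Ω := Ω) (E := E) f
    (S.fromSpecResidueField (genericPoint S)) a ha e he
  have hdom : IsDomain (E ⊗[F] E) := isDomain_tensor_of_projective ε θ hθ hθΩ
  obtain ⟨hint, φ, hφ₁, hφ₂⟩ := exists_functionField_equiv f rfl
  let N := (fibreProduct f).functionField
  let N' := FractionRing (E ⊗[F] E)
  let _ : Algebra F N := (φ.symm.toRingHom.comp (algebraMap F N')).toAlgebra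
  let φ' : N' →ₐ[F] N := { φ.symm.toRingHom with commutes' := fun _ => rfl }
  let κ : E ⊗[F] E →ₐ[F] N := φ'.comp (IsScalarTower.toAlgHom F (E ⊗[F] E) N')
  let ι₁ : E →ₐ[F] N := κ.comp (Algebra.TensorProduct.includeLeft (S := F))
  let ι₂ : E →ₐ[F] N := κ.comp Algebra.TensorProduct.includeRight
  have hκ : Algebra.TensorProduct.productMap ι₁ ι₂ = κ := by
    apply Algebra.TensorProduct.ext
    · exact AlgHom.ext fun z => by simp [ι₁]
    · exact AlgHom.ext fun z => by simp [ι₂]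
  have hι₁ (z : E) : ι₁ z = functionFieldMap (proj₁ f) z :=
    (φ.symm_apply_eq).mpr (hφ₁ z).symm
  have hι₂ (z : E) : ι₂ z = functionFieldMap (proj₂ f) z :=
    (φ.symm_apply_eq).mpr (hφ₂ z).symm
  obtain ⟨x, v, hxv, ⟨hx, hx'⟩, hv, hv'⟩ := exists_independent_generators_of_perm ι₁ ι₂
    (by
      rw [hκ]
      exact φ.symm.injective.comp (IsFractionRing.injective (E ⊗[F] E) N'))
    (fun z => by
      obtain ⟨p, q, -, h⟩ := IsFractionRing.div_surjective (A := E ⊗[F] E) (φ z)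
      refine ⟨p, q, ?_⟩
      rw [hκ, ← φ.symm_apply_apply z, ← h]
      exact map_div₀ φ.symm _ _)
    ε θ hθ hθΩ hperm
  have hr₁ : (functionFieldRange (proj₁ f) : Set N) = Set.range ι₁ := by
    ext z
    exact exists_congr fun y => by rw [hι₁]
  have hr₂ : (functionFieldRange (proj₂ f) : Set N) = Set.range ι₂ := by
    ext z
    exact exists_congr fun y => by rw [hι₂]
  have hr : (functionFieldRange (toBase f) : Set N) = Set.range (algebraMap F N) := by
    have h4 : functionFieldMap (toBase f) = functionFieldMap f ≫ functionFieldMap (proj₁ f) :=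
      functionFieldMap_comp (proj₁ f) f
    have h5 (z : F) : algebraMap F N z =
        functionFieldMap (toBase f) (inv (S.residue (genericPoint S)) z) := by
      rw [h4, ← ι₁.commutes z, hι₁]
      rfl
    ext z
    constructor
    · rintro ⟨y, rfl⟩
      obtain ⟨w, rfl⟩ := (ConcreteCategory.bijective_of_isIso
        (inv (S.residue (genericPoint S)))).surjective y
      exact ⟨w, h5 w⟩
    · rintro ⟨w, rfl⟩
      exact ⟨_, (h5 w).symm⟩
  refine ⟨hint, x, v, algebraicIndependent_subfield hxv _ hr,
    ⟨closure_eq_top_of_adjoin_eq_top ι₁ _ _ hr₁ hx, algebraicIndependent_subfield hx' _ ?_⟩,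
    closure_eq_top_of_adjoin_eq_top ι₂ _ _ hr₂ hv, algebraicIndependent_subfield hv' _ ?_⟩
  · rw [hr₁]
    ext z
    exact ⟨fun ⟨y, hy⟩ => ⟨⟨z, y, hy⟩, rfl⟩, fun ⟨⟨w, y, hy⟩, h⟩ => ⟨y, hy.trans h⟩⟩
  · rw [hr₂]
    ext z
    exact ⟨fun ⟨y, hy⟩ => ⟨⟨z, y, hy⟩, rfl⟩, fun ⟨⟨w, y, hy⟩, h⟩ => ⟨y, hy.trans h⟩⟩

end FunctionFieldOfProduct

end SelfProduct

namespace SelfProduct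

/-! ### Birational maps from a common generic point. -/

section Birational

variable {X Y Y' : Scheme.{u}} [IsIntegral Y] {N : Type u} [Field N]

/-- Identifying `N` with the function field of `Y` makes `t'` a germ at the generic point, which
extends to an open set by finite type. -/
theorem exists_spread_out (sY : Y ⟶ X) (sY' : Y' ⟶ X) [LocallyOfFiniteType sY']
    (t : Spec (.of N) ⟶ Y) [IsDominant t] (ht : Function.Bijective (stalkEval t (genericPoint Y)))
    (t' : Spec (.of N) ⟶ Y') (h : t ≫ sY = t' ≫ sY') :
    ∃ (U : Y.Opens) (g : U.toScheme ⟶ Y') (τ : Spec (.of N) ⟶ U),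
      τ ≫ U.ι = t ∧ τ ≫ g = t' ∧ g ≫ sY' = U.ι ≫ sY := by
  have : IsIso (stalkEval t (genericPoint Y)) := (ConcreteCategory.isIso_iff_bijective _).mpr ht
  obtain ⟨U, hU, g, h1, h2⟩ := spread_out_of_isGermInjective' sY sY'
    (inv (Spec.map (stalkEval t (genericPoint Y))) ≫ t') (by
      rw [Category.assoc, ← h, IsIso.inv_comp_eq, reassoc_of% SpecMap_stalkEval t (genericPoint Y)])
  refine ⟨U, g, Spec.map (stalkEval t (genericPoint Y)) ≫ U.fromSpecStalkOfMem _ hU, ?_, ?_, h2⟩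
  · rw [Category.assoc, Scheme.Opens.fromSpecStalkOfMem_ι, SpecMap_stalkEval]
  · rw [Category.assoc, ← h1, IsIso.hom_inv_id_assoc]

theorem birationalOver_of_point [IsIntegral Y'] (sY : Y ⟶ X) (sY' : Y' ⟶ X) [LocallyOfFiniteType sY]
    [LocallyOfFiniteType sY'] [IsSeparated sY] [IsSeparated sY']
    (t : Spec (.of N) ⟶ Y) [IsDominant t] (ht : Function.Bijective (stalkEval t (genericPoint Y)))
    (t' : Spec (.of N) ⟶ Y') [IsDominant t']
    (ht' : Function.Bijective (stalkEval t' (genericPoint Y'))) (h : t ≫ sY = t' ≫ sY') :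
    Scheme.BirationalOver sY sY' := by
  obtain ⟨U, g, τ, hτ, hg, hgs⟩ := exists_spread_out sY sY' t ht t' h
  obtain ⟨U', g', τ', hτ', hg', hgs'⟩ := exists_spread_out sY' sY t' ht' t h.symm
  let P := pullback g U'.ι
  let Q := pullback g' U.ι
  let p : P ⟶ U := pullback.fst g U'.ι
  let p' : P ⟶ U' := pullback.snd g U'.ι
  let q' : Q ⟶ U' := pullback.fst g' U.ι
  let q : Q ⟶ U := pullback.snd g' U.ι
  let ρ : Spec (.of N) ⟶ P := pullback.lift τ τ' (by rw [hg, hτ'])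
  let σ : Spec (.of N) ⟶ Q := pullback.lift τ' τ (by rw [hg', hτ])
  have hρ : ρ ≫ p ≫ U.ι = t := by rw [pullback.lift_fst_assoc, hτ]
  have hσ : σ ≫ q' ≫ U'.ι = t' := by rw [pullback.lift_fst_assoc, hτ']
  have : Nonempty P := ⟨ρ (IsLocalRing.closedPoint N)⟩
  have : Nonempty Q := ⟨σ (IsLocalRing.closedPoint N)⟩
  have : IsIntegral P := isIntegral_of_isOpenImmersion (p ≫ U.ι)
  have : IsIntegral Q := isIntegral_of_isOpenImmersion (q' ≫ U'.ι)
  have : IsDominant (ρ ≫ p ≫ U.ι) := by rwa [hρ]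
  have : IsDominant (σ ≫ q' ≫ U'.ι) := by rwa [hσ]
  have : IsDominant ρ := IsDominant.of_comp_of_isOpenImmersion ρ (p ≫ U.ι)
  have : IsDominant σ := IsDominant.of_comp_of_isOpenImmersion σ (q' ≫ U'.ι)
  -- The maps agree at the dominant `N`-point, hence everywhere by reducedness and separatedness.
  -- Thus `g` and `g'` are mutually inverse on `P` and `Q`.
  have hP : p' ≫ g' = p ≫ U.ι := by
    refine ext_of_isDominant_of_isSeparated sY ?_ ρ ?_
    · rw [Category.assoc, hgs', ← pullback.condition_assoc, hgs, Category.assoc]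
    · rw [hρ, pullback.lift_snd_assoc, hg']
  have hQ : q ≫ g = q' ≫ U'.ι := by
    refine ext_of_isDominant_of_isSeparated sY' ?_ σ ?_
    · rw [Category.assoc, hgs, ← pullback.condition_assoc, hgs', Category.assoc]
    · rw [hσ, pullback.lift_snd_assoc, hg]
  obtain ⟨e, he⟩ : ∃ e : P ≅ Q, e.hom ≫ q' = p' := ⟨
    { hom := pullback.lift p' p hP
      inv := pullback.lift q q' hQ
      hom_inv_id := by
        apply pullback.hom_ext
        · rw [Category.assoc, pullback.lift_fst, pullback.lift_snd, Category.id_comp]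
        · rw [Category.assoc, pullback.lift_snd, pullback.lift_fst, Category.id_comp]
      inv_hom_id := by
        apply pullback.hom_ext
        · rw [Category.assoc, pullback.lift_fst, pullback.lift_snd, Category.id_comp]
        · rw [Category.assoc, pullback.lift_snd, pullback.lift_fst, Category.id_comp] },
    pullback.lift_fst _ _ _⟩
  have : IsOpenImmersion q' := inferInstanceAs (IsOpenImmersion (pullback.fst g' U.ι))
  have : IsOpenImmersion (e.hom ≫ q') := IsOpenImmersion.comp e.hom q'
  have : IsOpenImmersion p' := he ▸ this
  have : IsDominant (ρ ≫ p' ≫ U'.ι) := by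
    rw [pullback.lift_snd_assoc, hτ']
    infer_instance
  have : IsDominant (p ≫ U.ι) := .of_comp ρ _
  have : IsDominant (p' ≫ U'.ι) := .of_comp ρ _
  refine ((p ≫ U.ι).birationalOver sY _ rfl).symm.trans ((p' ≫ U'.ι).birationalOver sY' _ ?_)
  rw [Category.assoc, Category.assoc, ← hgs, pullback.condition_assoc]

end Birational

end SelfProduct

namespace SelfProduct

/-! ### Generators of the function field give a birational map to affine space. -/

section AffineSpaceOverVariety

instance flat_affineSpace_over (n : Type u) (S : Scheme.{u}) : Flat (𝔸(n; S) ↘ S) := by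
  have : Flat (terminal.from (Spec (.of (MvPolynomial n (ULift.{u} ℤ))))) := by
    have := isIso_of_isTerminal specULiftZIsTerminal.{u} terminalIsTerminal (terminal.from _)
    have : Flat (Spec.map (CommRingCat.ofHom
        (MvPolynomial.C : ULift.{u} ℤ →+* MvPolynomial n (ULift.{u} ℤ)))) := by
      rw [Flat.SpecMap_iff]
      have h : Module.Flat (ULift.{u} ℤ) (MvPolynomial n (ULift.{u} ℤ)) := inferInstance
      exact (RingHom.flat_algebraMap_iff).mpr h
    rw [← terminal.comp_from (Spec.map (CommRingCat.ofHom MvPolynomial.C))]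
    infer_instance
  exact inferInstanceAs (Flat (pullback.fst (terminal.from S)
    (terminal.from (Spec (.of (MvPolynomial n (ULift.{u} ℤ)))))))

theorem stalkEval_germ {Y : Scheme.{u}} {K : Type u} [Field K] [IsIntegral Y]
    (t : Spec (.of K) ⟶ Y) [IsDominant t] (y : Y) (s : Γ(Y, ⊤)) :
    stalkEval t y (Y.presheaf.germ ⊤ y trivial s) =
      (Scheme.ΓSpecIso (.of K)).hom (t.appTop s) := by
  have h : (Y.fromSpecStalk y).appTop ≫ (Spec.map (stalkEval t y)).appTop ≫
      (Scheme.ΓSpecIso (.of K)).hom = Y.presheaf.germ ⊤ y trivial ≫ stalkEval t y := by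
    rw [Scheme.ΓSpecIso_naturality, Scheme.fromSpecStalk_appTop]
    simp
  have h2 : t.appTop = (Y.fromSpecStalk y).appTop ≫ (Spec.map (stalkEval t y)).appTop := by
    rw [← Scheme.Hom.comp_appTop, SpecMap_stalkEval]
  rw [h2]
  exact (congrArg (fun g => g.hom s) h).symm

theorem appTop_affineSpace_coord {X : Scheme.{u}} {n R B : Type u} [CommRing R] [CommRing B]
    (φ : CommRingCat.of (MvPolynomial n R) ⟶ .of B) (a : Spec (.of R) ⟶ X) (i : n) :
    (Scheme.ΓSpecIso (.of B)).hom ((Spec.map φ ≫ (AffineSpace.SpecIso n (.of R)).inv ≫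
      AffineSpace.map n a).appTop (AffineSpace.coord X i)) = φ (MvPolynomial.X i) := by
  rw [Scheme.Hom.comp_appTop, Scheme.Hom.comp_appTop, CommRingCat.comp_apply,
    CommRingCat.comp_apply, AffineSpace.map_appTop_coord, AffineSpace.SpecIso_inv_appTop_coord,
    ← CommRingCat.comp_apply, ← CommRingCat.comp_apply]
  exact congrArg (fun g => g.hom (MvPolynomial.X i)) (show (Scheme.ΓSpecIso _).inv ≫
    (Spec.map φ).appTop ≫ (Scheme.ΓSpecIso _).hom = φ by
      rw [Scheme.ΓSpecIso_naturality, Iso.inv_hom_id_assoc])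

/-- The `x i` are the coordinates of an `N`-point of affine space over `X`. Independence makes it
dominant, and generation makes its function field map onto `N`. -/
theorem birationalOver_affineSpace {X Y : Scheme.{u}} [IsIntegral X] [IsIntegral Y]
    [QuasiSeparatedSpace X] (p : Y ⟶ X) [IsDominant p] [LocallyOfFiniteType p] [IsSeparated p]
    {m : ℕ} (x : Fin m → Y.functionField) (hx : AlgebraicIndependent (functionFieldRange p) x)
    (htop : Subfield.closure ((functionFieldRange p : Set _) ∪ Set.range x) = ⊤) :
    Scheme.BirationalOver p (𝔸(ULift.{u} (Fin m); X) ↘ X) := by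
  let E := X.functionField
  let N := Y.functionField
  let n := ULift.{u} (Fin m)
  let _ : Algebra E N := (functionFieldMap p).hom.toAlgebra
  have hx' : AlgebraicIndependent E (x ∘ ULift.down : n → N) := by
    have h : AlgebraicIndependent E x :=
      AlgebraicIndependent.of_ringHom_of_comp_eq (functionFieldMap p).hom.rangeRestrictField
        (RingHom.id N) hx (RingHom.injective _) rfl
    exact h.comp _ ULift.down_injective
  let φ : CommRingCat.of (MvPolynomial n E) ⟶ .of N :=
    CommRingCat.ofHom (MvPolynomial.aeval (x ∘ ULift.down : n → N)).toRingHom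
  let a : Spec (.of E) ⟶ X := X.fromSpecStalk (genericPoint X)
  have : IsSchemeTheoreticallyDominant a :=
    inferInstanceAs (IsSchemeTheoreticallyDominant (X.fromSpecStalk (genericPoint X)))
  have : IsSchemeTheoreticallyDominant (AffineSpace.map n a) :=
    .of_isPullback (AffineSpace.isPullback_map a).flip
  have : QuasiCompact (AffineSpace.map n a) :=
    MorphismProperty.of_isPullback (P := @QuasiCompact) (AffineSpace.isPullback_map a).flip inferInstance
  have : IsDominant (Spec.map φ) := isDominant_SpecMap_of_injective φ hx'
  have : IsSchemeTheoreticallyDominant (Spec.map φ) := .of_isDominant _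
  let t' : Spec (.of N) ⟶ 𝔸(n; X) := Spec.map φ ≫ (AffineSpace.SpecIso n (.of E)).inv ≫
    AffineSpace.map n a
  have : IsSchemeTheoreticallyDominant t' := inferInstance
  have : IsIntegral 𝔸(n; X) := isIntegral_of_isSchemeTheoreticallyDominant t'
  have ht' : t' ≫ 𝔸(n; X) ↘ X = Spec.map (functionFieldMap p) ≫ a := by
    simp only [t', Category.assoc, AffineSpace.map_over, AffineSpace.SpecIso_inv_over_assoc]
    rw [← Spec.map_comp_assoc]
    congr 2
    ext z
    exact MvPolynomial.aeval_C _ z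
  have hcoord (i : n) : stalkEval t' (genericPoint _)
      (𝔸(n; X).presheaf.germ ⊤ _ trivial (AffineSpace.coord X i)) = x i.down :=
    (stalkEval_germ t' _ _).trans ((appTop_affineSpace_coord φ a i).trans
      (MvPolynomial.aeval_X _ i))
  have hE : functionFieldMap (𝔸(n; X) ↘ X) ≫ stalkEval t' (genericPoint _) =
      functionFieldMap p := by
    rw [functionFieldMap_stalkEval]
    exact (eq_stalkEval _ _ _ ht'.symm).symm
  let t : Spec (.of N) ⟶ Y := Y.fromSpecStalk (genericPoint Y)
  have : IsPreimmersion t := inferInstanceAs (IsPreimmersion (Y.fromSpecStalk (genericPoint Y)))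
  have : IsSchemeTheoreticallyDominant t :=
    inferInstanceAs (IsSchemeTheoreticallyDominant (Y.fromSpecStalk (genericPoint Y)))
  have : IsDominant t :=
    isDominant_of_exists t (x := IsLocalRing.closedPoint _) Y.fromSpecStalk_closedPoint
  refine birationalOver_of_point p _ t (stalkEval_genericPoint_bijective t) t' ?_ ?_
  · let ψ : 𝔸(n; X).functionField →+* N := (stalkEval t' (genericPoint _)).hom
    have hψ : Subfield.closure ((functionFieldRange p : Set _) ∪ Set.range x) ≤ ψ.fieldRange := by
      rw [Subfield.closure_le]
      rintro _ (⟨z, rfl⟩ | ⟨i, rfl⟩)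
      · exact ⟨_, congrArg (fun g => g.hom z) hE⟩
      · exact ⟨_, hcoord ⟨i⟩⟩
    exact ⟨ψ.injective, fun w => hψ (htop ▸ Subfield.mem_top w)⟩
  · rw [ht']
    exact (SpecMap_functionFieldMap p).symm

end AffineSpaceOverVariety

end SelfProduct

namespace SelfProduct

/-! ### Coincidence of `Z` with the whole product over an open subset of `S`. -/

section GenericIsomorphism

theorem exists_isOpen_subset_or_subset_compl {T : Type*} [TopologicalSpace T] [IrreducibleSpace T]
    {C : Set T} (hC : Topology.IsConstructible C) :
    ∃ V : Set T, IsOpen V ∧ V.Nonempty ∧ (V ⊆ C ∨ V ⊆ Cᶜ) := by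
  induction hC using Topology.IsConstructible.empty_union_induction with
  | open_retrocompact U hU _ =>
    by_cases h : U.Nonempty
    · exact ⟨U, hU, h, .inl le_rfl⟩
    · rw [Set.not_nonempty_iff_eq_empty] at h
      exact ⟨Set.univ, isOpen_univ, Set.univ_nonempty, .inr (by simp [h])⟩
  | union s _ t _ hs ht =>
    obtain ⟨V, hV, hV', h | h⟩ := hs
    · exact ⟨V, hV, hV', .inl (h.trans Set.subset_union_left)⟩
    obtain ⟨V₂, hV₂, hV₂', h₂ | h₂⟩ := ht
    · exact ⟨V₂, hV₂, hV₂', .inl (h₂.trans Set.subset_union_right)⟩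
    refine ⟨V ∩ V₂, hV.inter hV₂, nonempty_preirreducible_inter hV hV₂ hV' hV₂', .inr ?_⟩
    rw [Set.compl_union]
    exact Set.inter_subset_inter h h₂
  | compl s _ hs =>
    obtain ⟨V, hV, hV', h⟩ := hs
    exact ⟨V, hV, hV', by rwa [compl_compl, or_comm]⟩

theorem locallyOfFinitePresentation_of_isLocallyNoetherian {X Y : Scheme.{u}} (f : X ⟶ Y)
    [LocallyOfFiniteType f] [IsLocallyNoetherian Y] : LocallyOfFinitePresentation f := by
  refine ⟨fun {U} hU {V} hV e => ?_⟩
  have : IsNoetherianRing Γ(Y, U) := IsLocallyNoetherian.component_noetherian ⟨U, hU⟩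
  exact RingHom.FinitePresentation.of_finiteType.mp (LocallyOfFiniteType.finiteType_appLE f hU hV e)

/-- By Chevalley's theorem the image of the complement of `O` is constructible; missing the generic
point, it misses a nonempty open set. -/
theorem exists_open_disjoint_image {W S : Scheme.{u}} (g : W ⟶ S) [IrreducibleSpace S]
    [IsLocallyNoetherian S] [CompactSpace S] [LocallyOfFiniteType g] [QuasiCompact g]
    (O : W.Opens) (hO : ∀ w, g w = genericPoint S → w ∈ O) :
    ∃ V : S.Opens, (V : Set S).Nonempty ∧ g ⁻¹ᵁ V ≤ O := by
  have := locallyOfFinitePresentation_of_isLocallyNoetherian g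
  have : IsLocallyNoetherian W := LocallyOfFiniteType.isLocallyNoetherian g
  have : CompactSpace W := QuasiCompact.compactSpace_of_compactSpace g
  have : IsNoetherian W := by constructor
  have hC : Topology.IsConstructible ((O : Set W)ᶜ) :=
    (IsRetrocompact.isConstructible O.isOpen
      fun _ _ _ => TopologicalSpace.NoetherianSpace.isCompact _).compl
  obtain ⟨V, hV, hV', h | h⟩ := exists_isOpen_subset_or_subset_compl (g.isConstructible_image hC)
  · obtain ⟨w, hw, hgw⟩ := h ((genericPoint_spec S).mem_open_set_iff hV |>.mpr (by simpa using hV'))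
    exact absurd (hO w hgw) hw
  · refine ⟨⟨V, hV⟩, hV', fun w hw => ?_⟩
    by_contra hwO
    exact h hw ⟨w, hwO, rfl⟩

/-- An immersion is a monomorphism, and a local section makes it a split epimorphism. -/
theorem isIso_morphismRestrict_of_exists_lift {Z W : Scheme.{u}} (i : Z ⟶ W) [IsImmersion i] (V : W.Opens)
    (h : ∀ x ∈ V, ∃ U : W.Opens, x ∈ U ∧ ∃ σ : U.toScheme ⟶ Z, σ ≫ i = U.ι) : IsIso (i ∣_ V) := by
  change MorphismProperty.isomorphisms Scheme (i ∣_ V)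
  refine IsZariskiLocalAtTarget.of_forall_exists_morphismRestrict fun x => ?_
  obtain ⟨U, hxU, σ, hσ⟩ := h x.1 x.2
  refine ⟨V.ι ⁻¹ᵁ U, hxU, ?_⟩
  have hr : ((V.ι ∣_ U) ≫ σ) ≫ i = (V.ι ⁻¹ᵁ U).ι ≫ V.ι := by
    rw [Category.assoc, hσ, morphismRestrict_ι]
  let τ := (isPullback_morphismRestrict i V).lift (V.ι ⁻¹ᵁ U).ι ((V.ι ∣_ U) ≫ σ) hr.symm
  have hτ : τ ≫ i ∣_ V = (V.ι ⁻¹ᵁ U).ι := IsPullback.lift_fst _ _ _ _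
  let ρ := (isPullback_morphismRestrict (i ∣_ V) (V.ι ⁻¹ᵁ U)).lift (𝟙 _) τ
    (by rw [hτ, Category.id_comp])
  have : IsSplitEpi ((i ∣_ V) ∣_ (V.ι ⁻¹ᵁ U)) := ⟨⟨ρ, IsPullback.lift_fst _ _ _ _⟩⟩
  have : IsImmersion ((i ∣_ V) ∣_ (V.ι ⁻¹ᵁ U)) :=
    IsZariskiLocalAtTarget.restrict (IsZariskiLocalAtTarget.restrict ‹_› V) _
  exact isIso_of_mono_of_isSplitEpi _

theorem exists_isIso_fibreProductι_restrict {X S : Scheme.{u}} [IsIntegral S] (f : X ⟶ S)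
    [IsLocallyNoetherian S] [CompactSpace S] [LocallyOfFiniteType f] [QuasiCompact f] :
    ∃ V : S.Opens, (V : Set S).Nonempty ∧
      IsIso (fibreProductι f ∣_ ((pullback.fst f f ≫ f) ⁻¹ᵁ V)) := by
  have : IsLocallyNoetherian (pullback f f) :=
    LocallyOfFiniteType.isLocallyNoetherian (pullback.fst f f ≫ f)
  have : IsClosedImmersion (fibreProductι f) :=
    inferInstanceAs (IsClosedImmersion (genericFibreι f).imageι)
  let O : (pullback f f).Opens := ⨆ U : {U : (pullback f f).Opens //
    ∃ σ : U.toScheme ⟶ fibreProduct f, σ ≫ fibreProductι f = U.ι}, U.1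
  -- At a point over the generic point of `S`, the spectrum of the local ring lies in the generic
  -- fibre, so it maps to `Z`; this section spreads out to a neighbourhood.
  obtain ⟨V, hV, hVO⟩ := exists_open_disjoint_image (pullback.fst f f ≫ f) O fun w hw => by
    let g := pullback.fst f f ≫ f
    have h : ∃ ℓ : Spec ((pullback f f).presheaf.stalk w) ⟶ Spec (S.residueField (genericPoint S)),
        (pullback f f).fromSpecStalk w ≫ g = ℓ ≫ S.fromSpecResidueField (genericPoint S) := by
      rw [← hw, ← Scheme.SpecMap_stalkMap_fromSpecStalk]
      have : IsIso (S.residue (g w)) := by rw [show g w = _ from hw]; infer_instance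
      exact ⟨Spec.map (inv (S.residue (g w)) ≫ g.stalkMap w), by
        rw [Scheme.fromSpecResidueField, ← Spec.map_comp_assoc, IsIso.hom_inv_id_assoc]⟩
    obtain ⟨ℓ, hℓ⟩ := h
    let φ : Spec ((pullback f f).presheaf.stalk w) ⟶ fibreProduct f :=
      pullback.lift _ ℓ hℓ ≫ (genericFibreι f).toImage
    have hφ : φ ≫ fibreProductι f = (pullback f f).fromSpecStalk w := by
      refine (Category.assoc _ _ _).trans ?_
      exact (congrArg _ (genericFibreι f).toImage_imageι).trans (pullback.lift_fst _ _ _)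
    obtain ⟨U, hU, σ, -, hσ⟩ := spread_out_of_isGermInjective' (𝟙 _) (fibreProductι f) φ
      (by rw [hφ, Category.comp_id])
    exact TopologicalSpace.Opens.mem_iSup.mpr ⟨⟨U, σ, by rw [hσ, Category.comp_id]⟩, hU⟩
  refine ⟨V, hV, isIso_morphismRestrict_of_exists_lift _ _ fun x hx => ?_⟩
  obtain ⟨U, hU⟩ := TopologicalSpace.Opens.mem_iSup.mp (hVO hx)
  exact ⟨U.1, hU, U.2⟩

end GenericIsomorphism

end SelfProduct

namespace SelfProduct

/-! ### Assembly of the theorem. -/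

section Packaging

theorem charZero_of_hom_Spec {k F : Type u} [Field k] [CharZero k] [Field F]
    (p : Spec (.of F) ⟶ Spec (.of k)) : CharZero F :=
  charZero_of_injective_ringHom (Spec.preimage p).hom.injective

theorem geometricPoint_apply {S : Scheme.{u}} (s : S)
    (z : Spec (.of (AlgebraicClosure (S.residueField s)))) : geometricPoint S s z = s :=
  S.fromSpecResidueField_apply s _

theorem isDominant_of_geometricFibre {X S : Scheme.{u}} [IsIntegral S] (f : X ⟶ S) {m : ℕ}
    (e : pullback f (geometricPoint S (genericPoint S)) ≅
      projectiveSpace m (AlgebraicClosure (S.residueField (genericPoint S)))) : IsDominant f := by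
  obtain ⟨y⟩ : Nonempty (projectiveSpace m (AlgebraicClosure (S.residueField (genericPoint S)))) :=
    inferInstance
  refine isDominant_of_exists f (x := pullback.fst f (geometricPoint S _) (e.inv y)) ?_
  rw [← Scheme.Hom.comp_apply, pullback.condition, Scheme.Hom.comp_apply]
  exact geometricPoint_apply _ _

/-- The cancellation given by one element of a system of independent generators. -/
noncomputable def cancellationOfGenerators {N ι : Type*} [Field N] {F A : Subfield N} (hF : F ≤ A)
    {x : ι → N} (hx : AlgebraicIndependent A x)
    (htop : Subfield.closure ((A : Set N) ∪ Set.range x) = ⊤) (i : ι) : Cancellation F where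
  coeff := Subfield.closure ((A : Set N) ∪ {z | ∃ j, j ≠ i ∧ z = x j})
  var := x i
  le_coeff := hF.trans fun _ hz => Subfield.subset_closure (.inl hz)
  transcendental := transcendental_closure A hx i
  closure_eq_top := closure_insert_eq_top A htop i

theorem functionFieldRange_comp_le {Z Y Y' : Scheme.{u}} [IsIntegral Z] [IsIntegral Y]
    [IsIntegral Y'] (g : Z ⟶ Y) (h : Y ⟶ Y') [IsDominant g] [IsDominant h] (q : Z ⟶ Y')
    [IsDominant q] (hq : q = g ≫ h) : functionFieldRange q ≤ functionFieldRange g := by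
  subst hq
  rintro _ ⟨z, rfl⟩
  exact ⟨functionFieldMap h z, by rw [functionFieldMap_comp]; rfl⟩

end Packaging

end SelfProduct

theorem mainTheorem7 {k : Type u} [Field k] [IsAlgClosed k] [CharZero k]
    {X S : Scheme.{u}} (sS : S ⟶ Spec (.of k)) (f : X ⟶ S)
    [IsIntegral S] [IsSeparated sS] [LocallyOfFiniteType sS] [QuasiCompact sS]
    [IsIntegral X] [IsSeparated (f ≫ sS)] [LocallyOfFiniteType (f ≫ sS)] [QuasiCompact (f ≫ sS)]
    (m : ℕ) (hf : SelfProduct.IsProjectiveSpaceFibration f m) :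
    -- the fibre product is the whole scheme `X ×_S X` over a nonempty open subset of `S`,
    -- and everywhere if `f` is flat
    (∃ V : S.Opens, (V : Set S).Nonempty ∧
      IsIso (SelfProduct.fibreProductι f ∣_ ((pullback.fst f f ≫ f) ⁻¹ᵁ V))) ∧
    (Flat f → IsIso (SelfProduct.fibreProductι f)) ∧
    -- the diagonal is a section of both projections
    (∃ δ : X ⟶ SelfProduct.fibreProduct f,
      δ ≫ SelfProduct.fibreProductι f = pullback.diagonal f ∧
      δ ≫ SelfProduct.proj₁ f = 𝟙 X ∧ δ ≫ SelfProduct.proj₂ f = 𝟙 X) ∧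
    -- birationality to `X × k^m`, over `X`, with respect to both projections
    Scheme.BirationalOver (SelfProduct.proj₁ f) (𝔸(ULift.{u} (Fin m); X) ↘ X) ∧
    Scheme.BirationalOver (SelfProduct.proj₂ f) (𝔸(ULift.{u} (Fin m); X) ↘ X) ∧
    -- `2m` algebraically independent cancellations over `S`
    ∃ (_ : IsIntegral (SelfProduct.fibreProduct f)) (_ : IsDominant (SelfProduct.proj₁ f))
      (_ : IsDominant (SelfProduct.proj₂ f)) (_ : IsDominant (SelfProduct.toBase f))
      (c : Fin m ⊕ Fin m →
        SelfProduct.Cancellation (SelfProduct.functionFieldRange (SelfProduct.toBase f))),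
      AlgebraicIndependent (SelfProduct.functionFieldRange (SelfProduct.toBase f))
        (fun i => (c i).var) ∧
      (∀ i : Fin m, (c (Sum.inl i)).coeff = Subfield.closure
        ((SelfProduct.functionFieldRange (SelfProduct.proj₁ f) : Set _) ∪
          {z | ∃ j : Fin m, j ≠ i ∧ z = (c (Sum.inl j)).var})) ∧
      (∀ i : Fin m, (c (Sum.inr i)).coeff = Subfield.closure
        ((SelfProduct.functionFieldRange (SelfProduct.proj₂ f) : Set _) ∪
          {z | ∃ j : Fin m, j ≠ i ∧ z = (c (Sum.inr j)).var})) := by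
  obtain ⟨U, hU, hfib⟩ := hf
  -- A dense open set contains the generic point.
  obtain ⟨e, he⟩ := hfib _ ((genericPoint_spec S).mem_open_set_iff U.isOpen |>.mpr
    (by simpa using hU.nonempty))
  have : LocallyOfFiniteType f := locallyOfFiniteType_of_comp f sS
  have : IsSeparated f := .of_comp f sS
  have : QuasiCompact f := .of_comp f sS
  have : IsLocallyNoetherian S := LocallyOfFiniteType.isLocallyNoetherian sS
  have : IsLocallyNoetherian X := LocallyOfFiniteType.isLocallyNoetherian f
  have : CompactSpace S := QuasiCompact.compactSpace_of_compactSpace sS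
  have : IsDominant f := SelfProduct.isDominant_of_geometricFibre f e
  have : CharZero (S.residueField (genericPoint S)) :=
    SelfProduct.charZero_of_hom_Spec (F := S.residueField (genericPoint S))
      (S.fromSpecResidueField (genericPoint S) ≫ sS)
  obtain ⟨δ, hδ, hδ₁, hδ₂⟩ : ∃ δ : X ⟶ SelfProduct.fibreProduct f,
      δ ≫ SelfProduct.fibreProductι f = pullback.diagonal f ∧
      δ ≫ SelfProduct.proj₁ f = 𝟙 X ∧ δ ≫ SelfProduct.proj₂ f = 𝟙 X := by
    let _ : Algebra (S.residueField (genericPoint S)) X.functionField :=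
      (SelfProduct.residueToFunctionField f).hom.toAlgebra
    exact SelfProduct.exists_section_of_point (E := X.functionField) f
      (X.fromSpecStalk (genericPoint X)) (SelfProduct.fromSpecStalk_comp f)
  have : IsClosedImmersion (SelfProduct.fibreProductι f) :=
    inferInstanceAs (IsClosedImmersion (SelfProduct.genericFibreι f).imageι)
  -- A morphism with a section is surjective, in particular dominant.
  have d₁ : IsDominant (SelfProduct.proj₁ f) := by
    have : IsDominant (δ ≫ SelfProduct.proj₁ f) := by rw [hδ₁]; infer_instance
    exact .of_comp δ _
  have d₂ : IsDominant (SelfProduct.proj₂ f) := by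
    have : IsDominant (δ ≫ SelfProduct.proj₂ f) := by rw [hδ₂]; infer_instance
    exact .of_comp δ _
  have d : IsDominant (SelfProduct.toBase f) :=
    inferInstanceAs (IsDominant (SelfProduct.proj₁ f ≫ f))
  have : LocallyOfFiniteType (SelfProduct.proj₁ f) :=
    inferInstanceAs (LocallyOfFiniteType (SelfProduct.fibreProductι f ≫ pullback.fst f f))
  have : LocallyOfFiniteType (SelfProduct.proj₂ f) :=
    inferInstanceAs (LocallyOfFiniteType (SelfProduct.fibreProductι f ≫ pullback.snd f f))
  have : IsSeparated (SelfProduct.proj₁ f) :=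
    inferInstanceAs (IsSeparated (SelfProduct.fibreProductι f ≫ pullback.fst f f))
  have : IsSeparated (SelfProduct.proj₂ f) :=
    inferInstanceAs (IsSeparated (SelfProduct.fibreProductι f ≫ pullback.snd f f))
  obtain ⟨hint, x, v, hxv, ⟨hx, hx'⟩, hv, hv'⟩ :=
    SelfProduct.exists_independent_generators_fibreProduct f e he
  have h₁ := SelfProduct.functionFieldRange_comp_le (SelfProduct.proj₁ f) f
    (SelfProduct.toBase f) rfl
  have h₂ := SelfProduct.functionFieldRange_comp_le (SelfProduct.proj₂ f) f
    (SelfProduct.toBase f) (by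
      simp only [SelfProduct.toBase, SelfProduct.proj₁, SelfProduct.proj₂, Category.assoc,
        pullback.condition])
  refine ⟨SelfProduct.exists_isIso_fibreProductι_restrict f,
    fun _ => SelfProduct.isIso_fibreProductι_of_flat f, ⟨δ, hδ, hδ₁, hδ₂⟩,
    SelfProduct.birationalOver_affineSpace _ x hx' hx,
    SelfProduct.birationalOver_affineSpace _ v hv' hv, hint, d₁, d₂, d,
    Sum.elim (SelfProduct.cancellationOfGenerators h₁ hx' hx)
      (SelfProduct.cancellationOfGenerators h₂ hv' hv), ?_, fun _ => rfl, fun _ => rfl⟩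
  convert hxv using 1
  ext (i | i) <;> rfl
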